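/- Let $\mathbb T=\mathbb R/2\pi\mathbb Z$, and for $u$ on $\mathbb T\times\mathbb R$ write $\tilde u(k,\xi)=\frac1{2\pi}\iint u(x,y)e^{-i(kx+\xi y)}\,dx\,dy$ ($k\in\mathbb Z$, $\xi\in\mathbb R$) and $\|u\|_{H^N}^2=\sum_{k}\int(1+k^2+\xi^2)^N|\tilde u(k,\xi)|^2\,d\xi$. Let $\nu>0$ and let $T:\mathbb R\to\mathbb R$ be differentiable. Consider the linearized Boussinesq equations with vertical dissipation of the velocity only, around Couette flow $v=(y,0)$ and the temperature profile $T(y)$, in coordinates moving with the shear: $$\partial_t\omega=\nu(\partial_y-t\partial_x)^2\omega+\partial_x\theta,\qquad \partial_t\partial_x\theta=-T'(y)\,\partial_x^2\Delta_t^{-1}\omega,\qquad \Delta_t=\partial_x^2+(\partial_y-t\partial_x)^2,$$ on $(0,\infty)\times\mathbb T\times\mathbb R$, with real initial data $(\omega_0,\theta_0)$, $\omega_0,\theta_0\in L^2$. A solution is a pair $\omega,\theta\in C([0,\infty);L^2(\mathbb T\times\mathbb R))$ with these initial data that satisfies the equations in the sense of distributions in space for every $t>0$; here $q=\partial_x^2\Delta_t^{-1}\omega$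 is the unique $q\in L^2$ with $\Delta_tq=\partial_x^2\omega$. Suppose that $T'$ has as Fourier transform a finite complex measure $\mathcal F(T')$, normalised by $T'(y)=\int e^{i\xi y}\,\mathcal F(T')(d\xi)$ (an integrable density is allowed, and so is a Dirac measure, as for affine $T$); $|\mathcal F(T')|$ denotes its total variation. Let $N\in\mathbb N=\{0,1,2,\dots\}$. **(1)** There is a universal constant $C>0$ such that, for all $N$, $\nu$, $T$ as above with $$\int(1+|\xi|)^{N+5}\,|\mathcal F(T')|(d\xi)\le 4^{-N}\nu^{1/3},$$ and all initial data $\omega_0\in H^N$, $\theta_0\in H^{N+1}$, a solution exists, and every solution satisfies, for all $t\ge0$, $$\|\omega(t)\|_{H^N}^2+\|\partial_x\theta(t)\|_{H^N}^2\le C(1+\nu^{-2/3})^2\left(\|\omega_0\|_{H^N}^2+\|\theta_0\|_{H^{N+1}}^2\right).$$ **(2)** For every $N$ there is a constant $C_N>0$ such that, for all $\nu$, $T$ as above with $$\sup_{\xi\in\mathbb R}\int\Big(\tfrac{1+|\xi+\eta|}{1+|\xi|}+\tfrac{1+|\xi|}{1+|\xi+\eta|}\Big)^N\big(1+\min(\nu^{-2/3},|\eta|^{2/3})\big)\,|\mathcal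 F(T')|(d\eta)<\tfrac1{100}\nu^{1/3},$$ and all initial data with $\omega_0,\partial_x\theta_0\in H^N$, a solution exists, and every solution satisfies, for all $t\ge0$, $$\|\omega(t)\|_{H^N}^2+\|\partial_x\theta(t)\|_{H^N}^2\le C_N(1+\nu^{-2/3})^2\left(\|\omega_0\|_{H^N}^2+\|\partial_x\theta_0\|_{H^N}^2\right).$$ **(3)** If $T(y)=\alpha y$ is affine with $\alpha>-\frac1{100}\nu^{1/3}$, then for every $N$ there is $C=C(N,\nu,\alpha)>0$ such that, for all initial data with $\omega_0,\partial_x\theta_0\in H^N$, a solution exists, and every solution satisfies $\|\omega(t)\|_{H^N}^2+\|\partial_x\theta(t)\|_{H^N}^2\le C\left(\|\omega_0\|_{H^N}^2+\|\partial_x\theta_0\|_{H^N}^2\right)$ for all $t\ge0$. -/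

import Mathlib

open MeasureTheory Set
open scoped Real ENNReal FourierTransform

noncomputable section

namespace Boussinesq

instance factTwoPiPos : Fact (0 < 2 * π) := ⟨Real.two_pi_pos⟩

/-- The domain `𝕋 × ℝ`, with `𝕋 = ℝ / 2πℤ`, carrying Lebesgue measure (of total mass `2π` on `𝕋`). -/
abbrev Dom : Type := AddCircle (2 * π) × ℝ

/-- The space `L²(𝕋 × ℝ)` of real-valued functions. -/
abbrev L2 : Type := Lp ℝ 2 (volume : Measure Dom)

/-! ### Test functions and the differential operators in shear coordinates -/

/-- Real test functions: smooth and compactly supported on `𝕋 × ℝ`. -/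
structure IsTest (φ : Dom → ℝ) : Prop where
  smooth : ContDiff ℝ (⊤ : ℕ∞) (fun p : ℝ × ℝ => φ ((p.1 : AddCircle (2 * π)), p.2))
  compact : HasCompactSupport φ

/-- `∂ₓ φ` for a function on `𝕋 × ℝ`. -/
def dx (φ : Dom → ℝ) : Dom → ℝ :=
  fun p => deriv (fun s : ℝ => φ (p.1 + (s : AddCircle (2 * π)), p.2)) 0

/-- `∂_y φ` for a function on `𝕋 × ℝ`. -/
def dy (φ : Dom → ℝ) : Dom → ℝ :=
  fun p => deriv (fun s : ℝ => φ (p.1, p.2 + s)) 0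

/-- `(∂_y - t ∂ₓ) φ`. -/
def dyt (t : ℝ) (φ : Dom → ℝ) : Dom → ℝ := fun p => dy φ p - t * dx φ p

/-- `Δ_t φ = ∂ₓ² φ + (∂_y - t ∂ₓ)² φ`. -/
def lap (t : ℝ) (φ : Dom → ℝ) : Dom → ℝ := fun p => dx (dx φ) p + dyt t (dyt t φ) p

/-- `q = ∂ₓ² Δ_t⁻¹ ω`: the function `q ∈ L²` solves `Δ_t q = ∂ₓ² ω` in the sense of
distributions. (There is exactly one such `q` in `L²`; its `x`-average vanishes.) -/
def IsDxxInvLap (t : ℝ) (ω q : L2) : Prop :=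
  ∀ φ : Dom → ℝ, IsTest φ → ∫ p, q p * lap t φ p = ∫ p, ω p * dx (dx φ) p

/-! ### The linearized system -/

/-- `(ω, θ)` is a (weak, global) solution, continuous in time with values in `L²`, of
`∂ₜ ω = ν (∂_y - t ∂ₓ)² ω + ∂ₓ θ`, `∂ₜ ∂ₓ θ = - T'(y) ∂ₓ² Δ_t⁻¹ ω` on `(0, ∞) × 𝕋 × ℝ`
with initial data `(ω₀, θ₀)`. Only the values at times `t ≥ 0` matter. -/
structure IsSolution (ν : ℝ) (T : ℝ → ℝ) (ω₀ θ₀ : L2) (ω θ : ℝ → L2) : Prop where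
  cont_ω : ContinuousOn ω (Ici 0)
  cont_θ : ContinuousOn θ (Ici 0)
  init_ω : ω 0 = ω₀
  init_θ : θ 0 = θ₀
  eq_ω : ∀ φ : Dom → ℝ, IsTest φ → ∀ t : ℝ, 0 < t →
    HasDerivAt (fun s => ∫ p, ω s p * φ p)
      (ν * (∫ p, ω t p * dyt t (dyt t φ) p) - ∫ p, θ t p * dx φ p) t
  eq_θ : ∃ q : ℝ → L2, (∀ t : ℝ, 0 < t → IsDxxInvLap t (ω t) (q t)) ∧
    ∀ φ : Dom → ℝ, IsTest φ → ∀ t : ℝ, 0 < t →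
      HasDerivAt (fun s => -∫ p, θ s p * dx φ p)
        (-∫ p, deriv T p.2 * q t p * φ p) t

/-! ### Fourier transform on `𝕋 × ℝ` and Sobolev norms -/

/-- The `k`-th Fourier coefficient `(2π)⁻¹ ∫_𝕋 u(x, y) e^{-ikx} dx` of `u` in `x`. -/
def xMode (u : L2) (k : ℤ) : ℝ → ℂ :=
  fun y => fourierCoeff (fun x : AddCircle (2 * π) => ((u (x, y) : ℝ) : ℂ)) k

theorem memLp_xMode (u : L2) (k : ℤ) : MemLp (xMode u k) 2 (volume : Measure ℝ) := by
  have hu : StronglyMeasurable (fun p : Dom => (u p : ℝ)) := Lp.stronglyMeasurable u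
  have hsm : StronglyMeasurable (xMode u k) := by
    have h : StronglyMeasurable (fun p : Dom => (fourier (-k) p.1 : ℂ) * ((u p : ℝ) : ℂ)) := by
      refine StronglyMeasurable.mul ?_ ?_
      · exact ((map_continuous (fourier (T := 2 * π) (-k))).comp continuous_fst).stronglyMeasurable
      · exact Complex.continuous_ofReal.comp_stronglyMeasurable hu
    exact h.integral_prod_left' (μ := AddCircle.haarAddCircle)
  refine ⟨hsm.aestronglyMeasurable, ?_⟩
  have hvol : (volume : Measure (AddCircle (2 * π)))
      = ENNReal.ofReal (2 * π) • AddCircle.haarAddCircle := AddCircle.volume_eq_smul_haarAddCircle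
  have hpos : ENNReal.ofReal (2 * π) ≠ 0 := by
    simpa using Real.pi_pos
  have hfin : ∫⁻ p : Dom, ‖u p‖ₑ ^ (2 : ℝ) < ⊤ := by
    have := lintegral_rpow_enorm_lt_top_of_eLpNorm_lt_top (by norm_num) (by norm_num)
      (Lp.eLpNorm_lt_top u)
    simpa using this
  have hfub : ∫⁻ p : Dom, ‖u p‖ₑ ^ (2 : ℝ)
      = ENNReal.ofReal (2 * π) * ∫⁻ y : ℝ, ∫⁻ x, ‖u (x, y)‖ₑ ^ (2 : ℝ) ∂AddCircle.haarAddCircle := by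
    have hm : Measurable (fun p : Dom => ‖u p‖ₑ ^ (2 : ℝ)) := hu.enorm.pow_const _
    have hprod := lintegral_prod_symm (μ := (volume : Measure (AddCircle (2 * π))))
      (ν := (volume : Measure ℝ)) _ hm.aemeasurable
    refine Eq.trans hprod ?_
    rw [← lintegral_const_mul' _ _ ENNReal.ofReal_ne_top]
    refine lintegral_congr fun y => ?_
    rw [hvol, lintegral_smul_measure, smul_eq_mul]
  have hbd : ∀ y : ℝ, ‖xMode u k y‖ₑ ^ (2 : ℝ)
      ≤ ∫⁻ x, ‖u (x, y)‖ₑ ^ (2 : ℝ) ∂AddCircle.haarAddCircle := by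
    intro y
    have hy : StronglyMeasurable (fun x : AddCircle (2 * π) => u (x, y)) :=
      hu.comp_measurable measurable_prodMk_right
    have h1 : ‖xMode u k y‖ₑ ≤ eLpNorm (fun x : AddCircle (2 * π) => u (x, y)) 1
        AddCircle.haarAddCircle := by
      rw [eLpNorm_one_eq_lintegral_enorm]
      refine (enorm_integral_le_lintegral_enorm _).trans (lintegral_mono fun x => ?_)
      simp only [enorm_smul]
      have h1 : ‖(fourier (-k) x : ℂ)‖ₑ = 1 := by
        rw [← ofReal_norm, fourier_apply, Circle.norm_coe, ENNReal.ofReal_one]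
      rw [h1, one_mul, ← ofReal_norm, Complex.norm_real, ofReal_norm]
    have h2 := h1.trans (eLpNorm_le_eLpNorm_of_exponent_le (p := 1) (q := 2) (by norm_num)
      hy.aestronglyMeasurable)
    rw [eLpNorm_eq_lintegral_rpow_enorm_toReal (by norm_num) (by norm_num)] at h2
    simp only [ENNReal.toReal_ofNat] at h2
    calc ‖xMode u k y‖ₑ ^ (2 : ℝ) ≤ _ := ENNReal.rpow_le_rpow h2 (by norm_num)
      _ = _ := by rw [← ENNReal.rpow_mul]; norm_num
  rw [eLpNorm_lt_top_iff_lintegral_rpow_enorm_lt_top (by norm_num) (by norm_num)]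
  refine lt_of_le_of_lt (lintegral_mono fun y => by simpa using hbd y) ?_
  rw [hfub] at hfin
  simpa using (ENNReal.lt_top_of_mul_ne_top_right hfin.ne hpos)

/-- The Fourier transform `ũ(k, ξ) = (2π)⁻¹ ∫∫ u(x, y) e^{-i(kx + ξy)} dx dy` of `u ∈ L²(𝕋 × ℝ)`
(Mathlib's `𝓕` on `L²(ℝ)` uses the phase `e^{-2πiηy}`, whence `η = ξ / 2π`). -/
def fourierTR (u : L2) (k : ℤ) (ξ : ℝ) : ℂ :=
  (𝓕 ((memLp_xMode u k).toLp (xMode u k)) : Lp ℂ 2 (volume : Measure ℝ)) (ξ / (2 * π))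

/-- The Fourier transform `i k ũ(k, ξ)` of `∂ₓ u`. -/
def fourierDx (u : L2) (k : ℤ) (ξ : ℝ) : ℂ := Complex.I * k * fourierTR u k ξ

/-- `‖f‖²_{H^N} = ∑ₖ ∫ (1 + k² + ξ²)^N |f̃(k, ξ)|² dξ ∈ [0, ∞]`, for the function (or
distribution) `f` whose Fourier transform is `F`; `f ∈ H^N` means that this is finite. -/
def sobolevSq (N : ℕ) (F : ℤ → ℝ → ℂ) : ℝ≥0∞ :=
  ∑' k : ℤ, ∫⁻ ξ : ℝ, ENNReal.ofReal ((1 + (k : ℝ) ^ 2 + ξ ^ 2) ^ N) * ‖F k ξ‖ₑ ^ 2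

/-! ### The Fourier transform of `T'` -/

/-- The Fourier transform of the function `f` on `ℝ` is the finite complex measure `g dm`, that is
`f(y) = ∫ e^{iξy} g(ξ) dm(ξ)`. The total variation of this measure is `|g| dm`. For `m` Lebesgue
measure, `g` is the usual Fourier transform `(2π)⁻¹ ∫ f(y) e^{-iξy} dy`; for `f = α` constant, it
is `α` times the Dirac measure at `0`. -/
structure HasFourierMeasure (f : ℝ → ℝ) (m : Measure ℝ) (g : ℝ → ℂ) : Prop where
  integrable : Integrable g m
  eq : ∀ y : ℝ, (f y : ℂ) = ∫ ξ, Complex.exp (Complex.I * ξ * y) * g ξ ∂m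

/-- `∫ (1 + |ξ|)^{N+5} |𝓕(T')(ξ)| dξ` for `𝓕(T') = g dm`. -/
def weightedMass (N : ℕ) (m : Measure ℝ) (g : ℝ → ℂ) : ℝ≥0∞ :=
  ∫⁻ ξ, ENNReal.ofReal ((1 + |ξ|) ^ (N + 5)) * ‖g ξ‖ₑ ∂m

/-- `sup_ξ ∫ |𝓕(T')(z - ξ)| ((1+|z|)/(1+|ξ|) + (1+|ξ|)/(1+|z|))^N
(1 + min(ν^{-2/3}, |z - ξ|^{2/3})) dz` for `𝓕(T') = g dm`, written with `z = ξ + η`. -/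
def commutatorMass (N : ℕ) (ν : ℝ) (m : Measure ℝ) (g : ℝ → ℂ) : ℝ≥0∞ :=
  ⨆ ξ : ℝ, ∫⁻ η, ENNReal.ofReal
    (((1 + |ξ + η|) / (1 + |ξ|) + (1 + |ξ|) / (1 + |ξ + η|)) ^ N
      * (1 + min (ν ^ (-(2 / 3) : ℝ)) (|η| ^ (2 / 3 : ℝ)))) * ‖g η‖ₑ ∂m

end Boussinesq

end

open Boussinesq

section

open MeasureTheory Set Filter Topology
open scoped Real ENNReal FourierTransform ContDiff

noncomputable section

namespace Boussinesq
-- Since `T'` depends on `y` alone, the system splits over the frequency k in x. Put a = ω̃(k,·), b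
-- = ikθ̃(k,·), μ = |𝓕(T')| and r(t,ξ) = k²/(k² + (ξ-kt)²). Then a' = -ν(ξ-kt)²a + b, and b' is
-- dominated by the convolution of μ with r|a|; only absolute values are used from here on.
--
-- Two facts drive the estimate for k ≠ 0. The integral of (ξ-kτ)² over [s,t] is at least (t-s)³/12,
-- so the Duhamel kernel of a has time integral at most c = 2.29 ν^{-1/3} (`lintegral_damp_le`). The
-- weight g(t,ξ) = exp(L(arctan(t-ξ/k) + π/2)) increases in t, lies between 1 and e^{Lπ}, and
-- satisfies ∂ₜg = L r g, so the integral of r g over [0,t] is at most g(t)/L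
-- (`lintegral_res_ghost_le`).
--
-- Suppose |b(s,ξ)| ≤ g(s,ξ)B(ξ) for s in [0,τ]. Duhamel gives |a(t)| ≤ damp·|a₀| + c g(t)B
-- (`enorm_a_le`). Inserted in the equation of b, with g(t,ξ-η) ≤ S(η)g(t,ξ), this yields the new
-- majorant |b₀| + c (Sμ)∗|a₀| + (c/L)(Sμ)∗B (`enorm_b_le`). If the V-weighted mass of Sμ is at most
-- Kν^{1/3}, the Schur test `eLpNorm_mul_lconv_le` makes this map contract in L²(V²dξ) by q with
-- 2.29K ≤ qL, q < 1. Every solution has some majorant on [0,τ] (`exists_majorant`); iteration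
-- forgets its size and leaves a bound independent of τ (`exists_majorant_seq`, `bound`). Summing
-- over k gives `sobolev_le`.
--
-- The three statements are three choices in `IsAdmissible`. For (1), L = 5/2 and S = (1+|η|)^5,
-- because arctan varies at most like 2 log(1+|η|). For (2), L = 1/π, so that g lies in [1,e] and S
-- = e suffices. For (3), μ is a multiple of the Dirac mass at 0, nothing is shifted, and L may be
-- taken as large as α requires.
--
-- The bound concerns arbitrary weak solutions, so the mode equations are derived from real
-- compactly supported test functions: real parts of e^{-ikx}Z(y), where Z is a cutoff of the
-- transform of a bump function. Existence comes from a mild formulation on the Fourier side, a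
-- linear Volterra equation with bounded kernels, carried back by the adjoint of the Fourier
-- isometry.
/-- Complex-valued smooth functions on `ℝ` with compact support. -/
structure IsBump (χ : ℝ → ℂ) : Prop where
  smooth : ContDiff ℝ ∞ χ
  compact : HasCompactSupport χ

/-! ### Pairings in L²: domination by duality, differentiation of L²-valued curves. -/

theorem lintegral_mul_le_eLpNorm {α : Type*} [MeasurableSpace α] {m : Measure α}
    {F G : α → ℝ≥0∞} (hF : AEMeasurable F m) (hG : AEMeasurable G m) :
    ∫⁻ x, F x * G x ∂m ≤ eLpNorm F 2 m * eLpNorm G 2 m := by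
  have := ENNReal.lintegral_mul_le_Lp_mul_Lq m Real.HolderConjugate.two_two hF hG
  simpa [eLpNorm_eq_lintegral_rpow_enorm_toReal] using this

theorem eLpNorm_two_sq {α ε : Type*} [MeasurableSpace α] {m : Measure α} [ENorm ε]
    (F : α → ε) : eLpNorm F 2 m ^ 2 = ∫⁻ x, ‖F x‖ₑ ^ 2 ∂m := by
  rw [eLpNorm_eq_lintegral_rpow_enorm_toReal (by norm_num) (by norm_num), ← ENNReal.rpow_natCast,
    ← ENNReal.rpow_mul]
  norm_num

/-- Neither integrability of the derivative nor measurability of `h` is needed: an infinite right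
side leaves nothing to prove, and a finite one makes `deriv f` integrable, so that the fundamental
theorem of calculus applies. -/
theorem enorm_sub_le_lintegral_of_hasDerivAt {f f' : ℝ → ℂ} {h : ℝ → ℝ≥0∞} {t : ℝ} (ht : 0 ≤ t)
    (hf : ContinuousOn f (Icc 0 t)) (hd : ∀ s ∈ Ioo 0 t, HasDerivAt f (f' s) s)
    (hb : ∀ s ∈ Ioo 0 t, ‖f' s‖ₑ ≤ h s) : ‖f t - f 0‖ₑ ≤ ∫⁻ s in Ioo 0 t, h s := by
  by_cases htop : ∫⁻ s in Ioo 0 t, h s = ⊤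
  · simp [htop]
  have hd' : ∀ s ∈ Ioo 0 t, HasDerivAt f (deriv f s) s := fun s hs =>
    (hd s hs).differentiableAt.hasDerivAt
  have hle : ∫⁻ s in Ioo 0 t, ‖deriv f s‖ₑ ≤ ∫⁻ s in Ioo 0 t, h s :=
    setLIntegral_mono' measurableSet_Ioo fun s hs => by rw [(hd s hs).deriv]; exact hb s hs
  have hint : IntegrableOn (deriv f) (Ioo 0 t) :=
    ⟨(measurable_deriv f).aestronglyMeasurable, hle.trans_lt (lt_top_iff_ne_top.2 htop)⟩
  have hii : IntervalIntegrable (deriv f) volume 0 t := by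
    rw [intervalIntegrable_iff_integrableOn_Ioo_of_le ht]
    exact hint
  rw [← intervalIntegral.integral_eq_sub_of_hasDerivAt_of_le ht hf hd' hii,
    intervalIntegral.integral_of_le ht, integral_Ioc_eq_integral_Ioo]
  exact (enorm_integral_le_lintegral_enorm _).trans hle

theorem integrable_mul_of_memLp {α : Type*} [MeasurableSpace α] {m : Measure α} {f g : α → ℂ}
    (hf : MemLp f 2 m) (hg : MemLp g 2 m) : Integrable (fun x => f x * g x) m :=
  hf.integrable_mul hg

theorem enorm_integral_mul_le {α : Type*} [MeasurableSpace α] {m : Measure α} {f g : α → ℂ}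
    (hf : MemLp f 2 m) (hg : MemLp g 2 m) :
    ‖∫ x, f x * g x ∂m‖ₑ ≤ eLpNorm f 2 m * eLpNorm g 2 m := by
  refine (enorm_integral_le_lintegral_enorm _).trans ?_
  simp only [enorm_mul]
  refine (lintegral_mul_le_eLpNorm hf.1.enorm hg.1.enorm).trans ?_
  simp

theorem IsBump.memLp {χ : ℝ → ℂ} (h : IsBump χ) : MemLp χ 2 (volume : Measure ℝ) :=
  h.smooth.continuous.memLp_of_hasCompactSupport h.compact

/-- A function whose pairings with bump functions are dominated by those of `G` is dominated by
`G`. -/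
theorem ae_enorm_le_of_forall_bump {f : ℝ → ℂ} (hfm : Measurable f) (hf : MemLp f 2 volume)
    {G : ℝ → ℝ≥0∞} (hGm : Measurable G) (hG : eLpNorm G 2 volume ≠ ⊤)
    (h : ∀ χ, IsBump χ → ‖∫ ξ, f ξ * χ ξ‖ₑ ≤ ∫⁻ ξ, ‖χ ξ‖ₑ * G ξ) :
    ∀ᵐ ξ, ‖f ξ‖ₑ ≤ G ξ := by
  -- The bad set. The conjugate of `f` cut off to `S` is the extremal test function; it is only in
  -- L², so the hypothesis reaches it through approximation by bump functions.
  set S : Set ℝ := {ξ | G ξ < ‖f ξ‖ₑ} with hS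
  have hSm : MeasurableSet S := measurableSet_lt hGm hfm.enorm
  set χ₀ : ℝ → ℂ := S.indicator (fun ξ => starRingEnd ℂ (f ξ)) with hχ₀
  have hχ₀L : MemLp χ₀ 2 volume := hf.star.indicator hSm
  have key : ‖∫ ξ, f ξ * χ₀ ξ‖ₑ ≤ ∫⁻ ξ, ‖χ₀ ξ‖ₑ * G ξ := by
    refine ENNReal.le_of_forall_pos_le_add fun ε hε _ => ?_
    set c : ℝ≥0∞ := eLpNorm f 2 volume + eLpNorm G 2 volume + 1 with hc
    have hctop : c ≠ ⊤ := by simp [hc, hG, hf.2.ne]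
    have hc0 : c ≠ 0 := by simp [hc]
    -- The tolerance ε/c is chosen so that the two approximation errors, against `f` and against
    -- `G`, cost at most ε together.
    have hδ : 0 < ((ε : ℝ≥0∞) / c).toReal := by
      refine ENNReal.toReal_pos ?_ ?_
      · simp [ENNReal.div_eq_zero_iff, hε.ne', hctop]
      · exact (ENNReal.div_lt_top ENNReal.coe_ne_top hc0).ne
    obtain ⟨χ, h1, h2, h3⟩ := hχ₀L.exist_eLpNorm_sub_le (by norm_num) (by norm_num) hδ
    rw [ENNReal.ofReal_toReal (ENNReal.div_lt_top ENNReal.coe_ne_top hc0).ne] at h3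
    have hχ : IsBump χ := ⟨h2, h1⟩
    have hsub : MemLp (χ₀ - χ) 2 volume := hχ₀L.sub hχ.memLp
    have e1 : ∫ ξ, f ξ * χ₀ ξ = (∫ ξ, f ξ * χ ξ) + ∫ ξ, f ξ * (χ₀ - χ) ξ := by
      rw [← integral_add (integrable_mul_of_memLp hf hχ.memLp) (integrable_mul_of_memLp hf hsub)]
      refine integral_congr_ae (Eventually.of_forall fun ξ => ?_)
      simp only [Pi.sub_apply]; ring
    have e2 : ∫⁻ ξ, ‖χ ξ‖ₑ * G ξ ≤ (∫⁻ ξ, ‖χ₀ ξ‖ₑ * G ξ) + ∫⁻ ξ, ‖(χ₀ - χ) ξ‖ₑ * G ξ := by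
      have hm : AEMeasurable (fun ξ => ‖(χ₀ - χ) ξ‖ₑ * G ξ) volume :=
        hsub.1.enorm.mul hGm.aemeasurable
      rw [← lintegral_add_right' _ hm]
      refine lintegral_mono fun ξ => ?_
      rw [← add_mul]
      gcongr
      calc ‖χ ξ‖ₑ = ‖χ₀ ξ - (χ₀ - χ) ξ‖ₑ := by simp
        _ ≤ _ := enorm_sub_le
    calc ‖∫ ξ, f ξ * χ₀ ξ‖ₑ ≤ ‖∫ ξ, f ξ * χ ξ‖ₑ + ‖∫ ξ, f ξ * (χ₀ - χ) ξ‖ₑ := by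
          rw [e1]; exact enorm_add_le _ _
      _ ≤ ((∫⁻ ξ, ‖χ₀ ξ‖ₑ * G ξ) + eLpNorm (χ₀ - χ) 2 volume * eLpNorm G 2 volume)
          + eLpNorm f 2 volume * eLpNorm (χ₀ - χ) 2 volume := by
          refine add_le_add ((h χ hχ).trans (e2.trans ?_)) (enorm_integral_mul_le hf hsub)
          gcongr
          refine (lintegral_mul_le_eLpNorm hsub.1.enorm hGm.aemeasurable).trans ?_
          rw [eLpNorm_enorm]
      _ ≤ (∫⁻ ξ, ‖χ₀ ξ‖ₑ * G ξ) + (ε / c) * c := by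
          rw [add_assoc]
          gcongr
          calc _ ≤ ε / c * eLpNorm G 2 volume + eLpNorm f 2 volume * (ε / c) := by gcongr
            _ = ε / c * (eLpNorm f 2 volume + eLpNorm G 2 volume) := by ring
            _ ≤ _ := mul_le_mul_right le_self_add _
      _ = _ := by rw [ENNReal.div_mul_cancel hc0 hctop]
  have e3 : ∫ ξ, f ξ * χ₀ ξ = ((∫ ξ in S, ‖f ξ‖ ^ 2 : ℝ) : ℂ) := by
    rw [← integral_indicator hSm, ← integral_complex_ofReal]
    refine integral_congr_ae (Eventually.of_forall fun ξ => ?_)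
    by_cases hξ : ξ ∈ S
    · simp [hχ₀, hξ, Complex.mul_conj, Complex.normSq_eq_norm_sq]
    · simp [hχ₀, hξ]
  have hint : IntegrableOn (fun ξ => ‖f ξ‖ ^ 2) S := (hf.integrable_norm_pow (by norm_num)).integrableOn
  have e4 : ‖∫ ξ, f ξ * χ₀ ξ‖ₑ = ∫⁻ ξ in S, ‖f ξ‖ₑ * ‖f ξ‖ₑ := by
    rw [e3, ← ofReal_norm, Complex.norm_real, Real.norm_of_nonneg (by positivity),
      ofReal_integral_eq_lintegral_ofReal hint (Eventually.of_forall fun _ => by positivity)]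
    refine lintegral_congr fun ξ => ?_
    rw [sq, ENNReal.ofReal_mul (norm_nonneg _), ofReal_norm]
  have e5 : ∫⁻ ξ, ‖χ₀ ξ‖ₑ * G ξ = ∫⁻ ξ in S, ‖f ξ‖ₑ * G ξ := by
    rw [← lintegral_indicator hSm]
    refine lintegral_congr fun ξ => ?_
    by_cases hξ : ξ ∈ S
    · simp [hχ₀, hξ, ← ofReal_norm]
    · simp [hχ₀, hξ]
  rw [e4, e5] at key
  have hfin : ∫⁻ ξ in S, ‖f ξ‖ₑ * G ξ ≠ ⊤ := by
    refine ((setLIntegral_le_lintegral _ _).trans_lt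
      ((lintegral_mul_le_eLpNorm hf.1.enorm hGm.aemeasurable).trans_lt ?_)).ne
    rw [eLpNorm_enorm]
    exact ENNReal.mul_lt_top hf.2 (lt_top_iff_ne_top.2 hG)
  -- On `S` the integrand ‖f‖² strictly exceeds ‖f‖G, so `key` is violated unless `S` is null.
  have hSnull : volume S = 0 := by
    by_contra hne
    refine absurd key (not_le.2 (setLIntegral_strict_mono hSm hne (hfm.enorm.mul hfm.enorm) hfin
      (Eventually.of_forall fun ξ hξ => ?_)))
    have hξ' : G ξ < ‖f ξ‖ₑ := hξ
    exact (ENNReal.mul_lt_mul_iff_right (ne_bot_of_gt hξ') enorm_ne_top).2 hξ'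
  have : ∀ᵐ ξ, ξ ∉ S := measure_eq_zero_iff_ae_notMem.1 hSnull
  filter_upwards [this] with ξ hξ
  exact not_lt.1 hξ

theorem eLpNorm_two_sq_eq_ofReal {α : Type*} [MeasurableSpace α] {m : Measure α} {f : α → ℂ}
    (hf : MemLp f 2 m) : eLpNorm f 2 m ^ 2 = ENNReal.ofReal (∫ x, ‖f x‖ ^ 2 ∂m) := by
  rw [eLpNorm_two_sq, ofReal_integral_eq_lintegral_ofReal (hf.integrable_norm_pow (by norm_num))
    (Eventually.of_forall fun _ => by positivity)]
  refine lintegral_congr fun x => ?_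
  rw [ENNReal.ofReal_pow (norm_nonneg _), ofReal_norm]

/-- Dominated convergence applied to ‖F - G‖²; it turns pointwise continuity of multipliers into
continuity in L². -/
theorem tendsto_toLp_of_dominated {α ι : Type*} [MeasurableSpace α] {m : Measure α}
    {l : Filter ι} [l.IsCountablyGenerated] {F : ι → α → ℂ} {G : α → ℂ} {bound : α → ℝ}
    (hF : ∀ i, MemLp (F i) 2 m) (hG : MemLp G 2 m) (hbound : MemLp bound 2 m)
    (hle : ∀ᶠ i in l, ∀ x, ‖F i x‖ ≤ bound x)
    (hlim : ∀ x, Tendsto (fun i => F i x) l (𝓝 (G x))) :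
    Tendsto (fun i => (hF i).toLp (F i)) l (𝓝 (hG.toLp G)) := by
  rw [Lp.tendsto_Lp_iff_tendsto_eLpNorm'']
  have h0 : Tendsto (fun i => ∫ x, ‖(F i - G) x‖ ^ 2 ∂m) l (𝓝 0) := by
    have hb : MemLp (fun x => bound x + ‖G x‖) 2 m := hbound.add hG.norm
    have := tendsto_integral_filter_of_dominated_convergence (μ := m) (l := l)
      (F := fun i x => ‖(F i - G) x‖ ^ 2) (f := fun _ => 0)
      (fun x => (bound x + ‖G x‖) ^ 2) ?_ ?_ hb.integrable_sq ?_
    · simpa using this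
    · exact Eventually.of_forall fun i => (((hF i).1.sub hG.1).norm.pow 2)
    · filter_upwards [hle] with i hi
      refine Eventually.of_forall fun x => ?_
      rw [Real.norm_of_nonneg (by positivity)]
      have h1 := norm_sub_le (F i x) (G x)
      have h2 := hi x
      exact pow_le_pow_left₀ (norm_nonneg _) (h1.trans (by linarith)) 2
    · refine Eventually.of_forall fun x => ?_
      have h1 : Tendsto (fun i => F i x - G x) l (𝓝 (G x - G x)) := (hlim x).sub_const _
      simpa using (h1.norm.pow 2)
  have h1 : Tendsto (fun i => eLpNorm (F i - G) 2 m ^ 2) l (𝓝 0) := by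
    have h2 : ∀ i, eLpNorm (F i - G) 2 m ^ 2 = ENNReal.ofReal (∫ x, ‖(F i - G) x‖ ^ 2 ∂m) :=
      fun i => eLpNorm_two_sq_eq_ofReal ((hF i).sub hG)
    simp only [h2]
    have h5 := (ENNReal.continuous_ofReal.tendsto 0).comp h0
    rwa [ENNReal.ofReal_zero] at h5
  have h3 := (ENNReal.continuous_rpow_const (y := (1 / 2 : ℝ))).tendsto 0 |>.comp h1
  rw [ENNReal.zero_rpow_of_pos (by norm_num)] at h3
  refine h3.congr fun i => ?_
  rw [Function.comp_apply, ← ENNReal.rpow_natCast, ← ENNReal.rpow_mul]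
  norm_num

/-- The difference quotients converge pointwise and are dominated by the Lipschitz bound, so they
converge in L². -/
theorem hasDerivWithinAt_toLp {α : Type*} [MeasurableSpace α] {m : Measure α} {f : ℝ → α → ℂ}
    {f' : α → ℂ} {s : ℝ} {A : Set ℝ} {bound : α → ℝ} (hf : ∀ r, MemLp (f r) 2 m)
    (hf' : MemLp f' 2 m) (hbound : MemLp bound 2 m)
    (hd : ∀ x, HasDerivWithinAt (fun r => f r x) (f' x) A s)
    (hlip : ∀ᶠ r in 𝓝[A \ {s}] s, ∀ x, ‖f r x - f s x‖ ≤ |r - s| * bound x) :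
    HasDerivWithinAt (fun r => (hf r).toLp (f r)) (hf'.toLp f') A s := by
  rw [hasDerivWithinAt_iff_tendsto_slope]
  have hF : ∀ r, MemLp (fun x => (r - s)⁻¹ • (f r x - f s x)) 2 m := fun r =>
    ((hf r).sub (hf s)).const_smul (r - s)⁻¹
  have key := tendsto_toLp_of_dominated (l := 𝓝[A \ {s}] s) hF hf' hbound ?_ ?_
  · refine key.congr fun r => ?_
    rw [slope_def_module, ← MemLp.toLp_sub (hf r) (hf s), ← MemLp.toLp_const_smul]
    rfl
  · filter_upwards [hlip, self_mem_nhdsWithin] with r hr hrs x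
    have hne : 0 < |r - s| := abs_pos.2 (sub_ne_zero.2 hrs.2)
    rw [norm_smul, norm_inv, Real.norm_eq_abs, inv_mul_le_iff₀ hne]
    exact hr x
  · intro x
    have := (hasDerivWithinAt_iff_tendsto_slope.1 (hd x))
    refine this.congr fun r => ?_
    rw [slope_def_module]

theorem exists_pairing : ∃ B : Lp ℂ 2 (volume : Measure ℝ) →L[ℝ] Lp ℂ 2 (volume : Measure ℝ) →L[ℝ] ℂ,
    ∀ f g, B f g = ∫ ξ, f ξ * g ξ :=
  ⟨ContinuousLinearMap.lpPairing (volume : Measure ℝ) 2 2 (ContinuousLinearMap.mul ℝ ℂ),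
    fun f g => by rw [ContinuousLinearMap.lpPairing_eq_integral]; rfl⟩

/-- A product rule in which `a` is merely norm continuous and differentiable against the frozen test
function κ(s): split ⟨a(r),κ(r)⟩ as ⟨a(r),κ(s)⟩ + ⟨a(r),κ(r)-κ(s)⟩. -/
theorem hasDerivAt_integral_mul {a : ℝ → Lp ℂ 2 (volume : Measure ℝ)} {κ : ℝ → ℝ → ℂ}
    {κ' : ℝ → ℂ} {s : ℝ} {D : ℂ} (ha : ContinuousAt a s) (hκ : ∀ r, MemLp (κ r) 2 volume)
    (hκ' : MemLp κ' 2 volume)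
    (hder : HasDerivAt (fun r => (hκ r).toLp (κ r)) (hκ'.toLp κ') s)
    (hD : HasDerivAt (fun r => ∫ ξ, a r ξ * κ s ξ) D s) :
    HasDerivAt (fun r => ∫ ξ, a r ξ * κ r ξ) (D + ∫ ξ, a s ξ * κ' ξ) s := by
  obtain ⟨B, hB⟩ := exists_pairing
  have e : ∀ (f : Lp ℂ 2 (volume : Measure ℝ)) (h : ℝ → ℂ) (hh : MemLp h 2 volume),
      ∫ ξ, f ξ * h ξ = B f (hh.toLp h) := by
    intro f h hh
    rw [hB]
    refine integral_congr_ae ?_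
    filter_upwards [hh.coeFn_toLp] with ξ hξ
    rw [hξ]
  have h2 : HasDerivAt (fun r => B (a r) ((hκ r).toLp (κ r) - (hκ s).toLp (κ s)))
      (B (a s) (hκ'.toLp κ')) s := by
    rw [hasDerivAt_iff_tendsto_slope] at hder ⊢
    have h3 : Tendsto (fun r => B (a r) (slope (fun r => (hκ r).toLp (κ r)) s r)) (𝓝[≠] s)
        (𝓝 (B (a s) (hκ'.toLp κ'))) := by
      have hc : Continuous fun q : Lp ℂ 2 (volume : Measure ℝ) × Lp ℂ 2 (volume : Measure ℝ) =>
          B q.1 q.2 := (B.continuous.comp continuous_fst).clm_apply continuous_snd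
      exact (hc.tendsto (a s, hκ'.toLp κ')).comp
        ((ha.tendsto.mono_left nhdsWithin_le_nhds).prodMk_nhds hder)
    refine h3.congr fun r => ?_
    rw [slope_def_module, slope_def_module]
    simp only [sub_self, map_zero, sub_zero]
    rw [map_smul]
  have h4 := hD.add h2
  rw [e (a s) κ' hκ']
  refine h4.congr_of_eventuallyEq (Eventually.of_forall fun r => ?_)
  simp only [Pi.add_apply]
  rw [e _ _ (hκ r), e _ _ (hκ s), map_sub]
  ring

theorem IsBump.mul_left {χ : ℝ → ℂ} (h : IsBump χ) {g : ℝ → ℂ} (hg : ContDiff ℝ ∞ g) :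
    IsBump (fun ξ => g ξ * χ ξ) :=
  ⟨hg.mul h.smooth, h.compact.mul_left⟩

theorem hasDerivAt_toLp_mul_bump {χ : ℝ → ℂ} (hχ : IsBump χ) {g g' : ℝ → ℝ → ℂ}
    (hg' : Continuous (Function.uncurry g'))
    (hd : ∀ r x, HasDerivAt (fun r => g r x) (g' r x) r)
    (hL : ∀ r, MemLp (fun x => g r x * χ x) 2 volume)
    (hL' : ∀ r, MemLp (fun x => g' r x * χ x) 2 volume) (s : ℝ) :
    HasDerivAt (fun r => (hL r).toLp (fun x => g r x * χ x)) ((hL' s).toLp _) s := by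
  -- The time derivative is bounded on this compact set, so the mean value inequality gives a
  -- Lipschitz bound supported in `tsupport χ`.
  have hK : IsCompact (Icc (s - 1) (s + 1) ×ˢ tsupport χ) := isCompact_Icc.prod hχ.compact
  obtain ⟨C, hC⟩ := hK.exists_bound_of_continuousOn
    (f := fun q : ℝ × ℝ => g' q.1 q.2 * χ q.2)
    ((hg'.mul (hχ.smooth.continuous.comp continuous_snd)).continuousOn)
  rw [← hasDerivWithinAt_univ]
  have hbd : MemLp ((tsupport χ).indicator fun _ => C) 2 (volume : Measure ℝ) :=
    memLp_indicator_const 2 (isClosed_tsupport χ).measurableSet C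
      (Or.inr hχ.compact.isCompact.measure_lt_top.ne)
  refine hasDerivWithinAt_toLp hL (hL' s) hbd (fun x => ?_) ?_
  · exact ((hd s x).mul_const (χ x)).hasDerivWithinAt
  · have hnhds : Icc (s - 1) (s + 1) ∈ 𝓝[univ \ {s}] s :=
      nhdsWithin_le_nhds (Icc_mem_nhds (by linarith) (by linarith))
    filter_upwards [hnhds] with r hr x
    by_cases hx : x ∈ tsupport χ
    · have := (convex_Icc (s - 1) (s + 1)).norm_image_sub_le_of_norm_hasDerivWithin_le
        (f := fun r => g r x * χ x) (f' := fun r => g' r x * χ x) (C := C)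
        (fun y _ => ((hd y x).mul_const (χ x)).hasDerivWithinAt)
        (fun y hy => hC (y, x) ⟨hy, hx⟩) (x := s) (y := r)
        ⟨by linarith, by linarith⟩ hr
      rw [indicator_of_mem hx, mul_comm |r - s|, ← Real.norm_eq_abs]
      exact this
    · have : χ x = 0 := image_eq_zero_of_notMem_tsupport hx
      simp [this, hx]

/-! ### The dissipation factor -/

/-- `∫₀ᵗ (ξ - kτ)² dτ`. -/
def phase (k : ℤ) (ξ t : ℝ) : ℝ := ξ ^ 2 * t - k * ξ * t ^ 2 + (k : ℝ) ^ 2 * t ^ 3 / 3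

/-- Completing the square about the midpoint of [s,t]. The remainder k²(t-s)³/12, which does not see
ξ, is the enhanced dissipation. -/
theorem phase_sub (k : ℤ) (ξ s t : ℝ) : phase k ξ t - phase k ξ s
    = (t - s) * ((ξ - k * (t + s) / 2) ^ 2 + (k : ℝ) ^ 2 * (t - s) ^ 2 / 12) := by
  unfold phase; ring

theorem hasDerivAt_phase (k : ℤ) (ξ t : ℝ) :
    HasDerivAt (phase k ξ) ((ξ - k * t) ^ 2) t := by
  have h := (((hasDerivAt_id t).const_mul (ξ ^ 2)).sub
    ((hasDerivAt_pow 2 t).const_mul (k * ξ))).add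
    (((hasDerivAt_pow 3 t).const_mul ((k : ℝ) ^ 2)).div_const 3)
  refine (h.congr_of_eventuallyEq (Eventually.of_forall fun y => ?_)).congr_deriv ?_
  · simp [phase]
  · simp; ring

/-- `exp (- ν ∫ₛᵗ (ξ - kτ)² dτ)`. -/
def damp (ν : ℝ) (k : ℤ) (s t ξ : ℝ) : ℝ := Real.exp (-(ν * (phase k ξ t - phase k ξ s)))

theorem damp_pos (ν : ℝ) (k : ℤ) (s t ξ : ℝ) : 0 < damp ν k s t ξ := Real.exp_pos _

theorem damp_self (ν : ℝ) (k : ℤ) (t ξ : ℝ) : damp ν k t t ξ = 1 := by simp [damp]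

theorem phase_sub_nonneg (k : ℤ) (ξ : ℝ) {s t : ℝ} (h : s ≤ t) :
    0 ≤ phase k ξ t - phase k ξ s := by
  rw [phase_sub]
  exact mul_nonneg (sub_nonneg.2 h) (by positivity)

theorem damp_le_one {ν : ℝ} (hν : 0 ≤ ν) (k : ℤ) (ξ : ℝ) {s t : ℝ} (h : s ≤ t) :
    damp ν k s t ξ ≤ 1 :=
  Real.exp_le_one_iff.2 (neg_nonpos.2 (mul_nonneg hν (phase_sub_nonneg k ξ h)))

theorem damp_le {ν : ℝ} (hν : 0 ≤ ν) {k : ℤ} (hk : k ≠ 0) (ξ : ℝ) {s t : ℝ} (h : s ≤ t) :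
    damp ν k s t ξ ≤ Real.exp (-(ν / 12) * (t - s) ^ 3) := by
  refine Real.exp_le_exp.2 ?_
  have hk1 : (1 : ℝ) ≤ (k : ℝ) ^ 2 := by
    have : (1 : ℤ) ≤ k ^ 2 := Int.one_le_abs hk |> fun h => by nlinarith [sq_abs k]
    exact_mod_cast this
  have h0 : 0 ≤ t - s := sub_nonneg.2 h
  rw [phase_sub]
  have h1 : (t - s) ^ 3 / 12 ≤ (t - s) * ((ξ - k * (t + s) / 2) ^ 2
      + (k : ℝ) ^ 2 * (t - s) ^ 2 / 12) := by
    have e1 : 0 ≤ (t - s) * (ξ - k * (t + s) / 2) ^ 2 := by positivity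
    have e2 : 0 ≤ ((k : ℝ) ^ 2 - 1) * (t - s) ^ 3 :=
      mul_nonneg (by linarith) (by positivity)
    nlinarith
  nlinarith [mul_le_mul_of_nonneg_left h1 hν]

/-- The relaxation time `2.29 ν^{-1/3}`. -/
def relax (ν : ℝ) : ℝ := 2.29 * ν ^ (-(1 / 3) : ℝ)

theorem relax_nonneg {ν : ℝ} (hν : 0 < ν) : 0 ≤ relax ν := by unfold relax; positivity

/-- The integral equals (ν/12)^{-1/3} Γ(4/3); this is the origin of the time scale ν^{-1/3} and of
the number 2.29. -/
theorem integral_exp_cubic_le {ν : ℝ} (hν : 0 < ν) :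
    ∫⁻ u in Ioi (0 : ℝ), ENNReal.ofReal (Real.exp (-(ν / 12) * u ^ 3))
      ≤ ENNReal.ofReal (relax ν) := by
  have h1 := integral_exp_neg_mul_rpow (p := 3) (b := ν / 12) (by norm_num) (by positivity)
  have h2 : IntegrableOn (fun x : ℝ => Real.exp (-(ν / 12) * x ^ (3 : ℝ))) (Ioi 0) := by
    have := integrableOn_rpow_mul_exp_neg_mul_rpow (p := 3) (s := 0) (b := ν / 12)
      (by norm_num) (by norm_num) (by positivity)
    simpa using this
  have h3 := ofReal_integral_eq_lintegral_ofReal h2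
    (Eventually.of_forall fun _ => (Real.exp_pos _).le)
  simp only [Real.rpow_ofNat] at h1 h3
  rw [← h3, h1]
  refine ENNReal.ofReal_le_ofReal ?_
  -- Γ is convex with Γ(1) = Γ(2) = 1, and 4/3 lies between 1 and 2.
  have hG : Real.Gamma (1 / 3 + 1) ≤ 1 := by
    have := Real.convexOn_Gamma.2 (show (1 : ℝ) ∈ Ioi 0 by simp)
      (show (2 : ℝ) ∈ Ioi 0 by simp) (show (0 : ℝ) ≤ 2 / 3 by norm_num)
      (show (0 : ℝ) ≤ 1 / 3 by norm_num) (by norm_num)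
    rw [Real.Gamma_two, Real.Gamma_one] at this
    norm_num at this ⊢
    exact this
  -- The constant works because 2.29³ = 12.008… exceeds 12.
  have h12 : (1 / 12 : ℝ) ^ (-1 / 3 : ℝ) ≤ 2.29 := by
    rw [one_div, Real.inv_rpow (by norm_num), ← Real.rpow_neg (by norm_num)]
    calc (12 : ℝ) ^ (-(-1 / 3) : ℝ) ≤ ((2.29 : ℝ) ^ (3 : ℝ)) ^ (-(-1 / 3) : ℝ) :=
          Real.rpow_le_rpow (by norm_num) (by norm_num) (by norm_num)
      _ = 2.29 := by rw [← Real.rpow_mul (by norm_num)]; norm_num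
  have e : (ν / 12) ^ (-1 / 3 : ℝ) = (1 / 12 : ℝ) ^ (-1 / 3 : ℝ) * ν ^ (-(1 / 3) : ℝ) := by
    rw [div_eq_mul_one_div, mul_comm ν, Real.mul_rpow (by norm_num) hν.le]
    norm_num
  rw [e]
  unfold relax
  calc _ ≤ 2.29 * ν ^ (-(1 / 3) : ℝ) * 1 := by gcongr
    _ = _ := mul_one _

theorem lintegral_damp_le {ν : ℝ} (hν : 0 < ν) {k : ℤ} (hk : k ≠ 0) (ξ t : ℝ) :
    ∫⁻ s in Ioo 0 t, ENNReal.ofReal (damp ν k s t ξ) ≤ ENNReal.ofReal (relax ν) := by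
  refine le_trans ?_ (integral_exp_cubic_le hν)
  -- Substitution u = t - s, carried out on indicator functions over the whole line.
  rw [← lintegral_indicator measurableSet_Ioi, ← lintegral_indicator measurableSet_Ioo,
    ← lintegral_sub_left_eq_self ((Ioi (0 : ℝ)).indicator _) t]
  refine lintegral_mono fun s => ?_
  by_cases hs : s ∈ Ioo 0 t
  · rw [indicator_of_mem hs, indicator_of_mem (by simpa using hs.2)]
    exact ENNReal.ofReal_le_ofReal (damp_le hν.le hk ξ hs.2.le)
  · rw [indicator_of_notMem hs]; exact bot_le

theorem lintegral_damp_zero_le {ν : ℝ} (hν : 0 < ν) {k : ℤ} (hk : k ≠ 0) (ξ t : ℝ) :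
    ∫⁻ s in Ioo 0 t, ENNReal.ofReal (damp ν k 0 s ξ) ≤ ENNReal.ofReal (relax ν) := by
  refine le_trans ?_ (integral_exp_cubic_le hν)
  refine (setLIntegral_mono' measurableSet_Ioo fun s hs => ?_).trans
    (lintegral_mono_set Ioo_subset_Ioi_self)
  simpa using ENNReal.ofReal_le_ofReal (damp_le hν.le hk ξ hs.1.le)

/-! ### The resonance factor and its primitive weight -/

/-- The symbol `k² / (k² + (ξ - kt)²)` of `∂ₓ² Δ_t⁻¹`. -/
def res (k : ℤ) (t ξ : ℝ) : ℝ := (k : ℝ) ^ 2 / ((k : ℝ) ^ 2 + (ξ - k * t) ^ 2)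

theorem res_nonneg (k : ℤ) (t ξ : ℝ) : 0 ≤ res k t ξ := by unfold res; positivity

theorem res_le_one (k : ℤ) (t ξ : ℝ) : res k t ξ ≤ 1 :=
  div_le_one_of_le₀ (by nlinarith [sq_nonneg (ξ - k * t)]) (by positivity)

theorem res_eq {k : ℤ} (hk : k ≠ 0) (t ξ : ℝ) : res k t ξ = 1 / (1 + (t - ξ / k) ^ 2) := by
  have : (k : ℝ) ≠ 0 := by exact_mod_cast hk
  unfold res
  field_simp
  ring

/-- The weight `exp (L (arctan (t - ξ/k) + π/2))`. -/
def ghost (L : ℝ) (k : ℤ) (t ξ : ℝ) : ℝ := Real.exp (L * (Real.arctan (t - ξ / k) + π / 2))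

theorem ghost_pos (L : ℝ) (k : ℤ) (t ξ : ℝ) : 0 < ghost L k t ξ := Real.exp_pos _

theorem one_le_ghost {L : ℝ} (hL : 0 ≤ L) (k : ℤ) (t ξ : ℝ) : 1 ≤ ghost L k t ξ :=
  Real.one_le_exp (mul_nonneg hL (by linarith [Real.neg_pi_div_two_lt_arctan (t - ξ / k)]))

theorem ghost_le {L : ℝ} (hL : 0 ≤ L) (k : ℤ) (t ξ : ℝ) : ghost L k t ξ ≤ Real.exp (L * π) :=
  Real.exp_le_exp.2 (mul_le_mul_of_nonneg_left
    (by linarith [Real.arctan_lt_pi_div_two (t - ξ / k)]) hL)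

theorem ghost_mono {L : ℝ} (hL : 0 ≤ L) (k : ℤ) (ξ : ℝ) {s t : ℝ} (h : s ≤ t) :
    ghost L k s ξ ≤ ghost L k t ξ :=
  Real.exp_le_exp.2 (mul_le_mul_of_nonneg_left
    (by linarith [Real.arctan_mono (sub_le_sub_right h (ξ / k))]) hL)

/-- `ghost / L` is a primitive of `res * ghost` in time, because the derivative of arctan(s - ξ/k)
is `res`. The resonance is thus absorbed for every ξ at the price of 1/L. -/
theorem lintegral_res_ghost_le {L : ℝ} (hL : 0 < L) {k : ℤ} (hk : k ≠ 0) (ξ t : ℝ) :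
    ∫⁻ s in Ioo 0 t, ENNReal.ofReal (res k s ξ * ghost L k s ξ)
      ≤ ENNReal.ofReal (ghost L k t ξ / L) := by
  rcases le_or_gt t 0 with ht | ht
  · simp [Ioo_eq_empty (not_lt.2 ht)]
  have hd : ∀ s, HasDerivAt (fun s => ghost L k s ξ / L) (res k s ξ * ghost L k s ξ) s := by
    intro s
    have h1 : HasDerivAt (fun s => L * (Real.arctan (s - ξ / k) + π / 2))
        (L * res k s ξ) s := by
      rw [res_eq hk]
      have h0 := (((Real.hasDerivAt_arctan (s - ξ / k)).comp s
        ((hasDerivAt_id s).sub_const (ξ / k))).add_const (π / 2)).const_mul L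
      simpa using h0
    refine ((h1.exp).div_const L).congr_deriv ?_
    unfold ghost
    field_simp
  have hc : Continuous fun s => res k s ξ * ghost L k s ξ := by
    simp only [res_eq hk]
    unfold ghost
    refine Continuous.mul (continuous_const.div (by fun_prop) fun s => by positivity) ?_
    have := Real.continuous_arctan
    fun_prop
  rw [← ofReal_integral_eq_lintegral_ofReal, ← integral_Ioc_eq_integral_Ioo,
    ← intervalIntegral.integral_of_le ht.le,
    intervalIntegral.integral_eq_sub_of_hasDerivAt (fun s _ => hd s) (hc.intervalIntegrable _ _)]
  · refine ENNReal.ofReal_le_ofReal (sub_le_self _ (div_nonneg (ghost_pos _ _ _ _).le hL.le))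
  · exact (hc.integrableOn_Icc).mono_set Ioo_subset_Icc_self
  · exact Eventually.of_forall fun s => mul_nonneg (res_nonneg _ _ _) (ghost_pos _ _ _ _).le

theorem measurable_ghost (L : ℝ) (k : ℤ) : Measurable fun q : ℝ × ℝ => ghost L k q.1 q.2 := by
  unfold ghost
  have := Real.continuous_arctan
  fun_prop

theorem measurable_damp (ν : ℝ) (k : ℤ) (t : ℝ) :
    Measurable fun q : ℝ × ℝ => damp ν k q.1 t q.2 := by
  unfold damp phase
  fun_prop

theorem measurable_damp_zero (ν : ℝ) (k : ℤ) :
    Measurable fun q : ℝ × ℝ => damp ν k 0 q.1 q.2 := by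
  unfold damp phase
  fun_prop

theorem measurable_res (k : ℤ) : Measurable fun q : ℝ × ℝ => res k q.1 q.2 := by
  unfold res
  fun_prop

/-! ### Convolution against a finite measure and the Schur test -/

/-- `ξ ↦ ∫ S(η) B(ξ - η) dμ(η)`. -/
def lconv (μ : Measure ℝ) (S B : ℝ → ℝ≥0∞) (ξ : ℝ) : ℝ≥0∞ := ∫⁻ η, S η * B (ξ - η) ∂μ

theorem measurable_lconv (μ : Measure ℝ) [SFinite μ] {S B : ℝ → ℝ≥0∞} (hS : Measurable S)
    (hB : Measurable B) : Measurable (lconv μ S B) := by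
  unfold lconv
  refine Measurable.lintegral_prod_right' (f := fun q : ℝ × ℝ => S q.2 * B (q.1 - q.2)) ?_
  fun_prop

/-- Tonelli after translating ξ by η; it moves the shift from the test function onto the function
being convolved. -/
theorem lintegral_lintegral_shift (μ : Measure ℝ) [SFinite μ] {F : ℝ → ℝ → ℝ≥0∞}
    (hF : Measurable (Function.uncurry F)) {X : ℝ → ℝ≥0∞} (hX : Measurable X) :
    ∫⁻ η, (∫⁻ ξ, F ξ η * X (ξ + η)) ∂μ = ∫⁻ ξ, X ξ * ∫⁻ η, F (ξ - η) η ∂μ := by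
  have h1 : ∀ η, ∫⁻ ξ, F ξ η * X (ξ + η) = ∫⁻ ξ, F (ξ - η) η * X ξ := by
    intro η
    rw [← lintegral_add_right_eq_self (fun ξ => F (ξ - η) η * X ξ) η]
    simp
  simp only [h1]
  rw [lintegral_lintegral_swap]
  · refine lintegral_congr fun ξ => ?_
    rw [← lintegral_const_mul _ (by fun_prop)]
    exact lintegral_congr fun η => mul_comm _ _
  · refine Measurable.aemeasurable ?_
    fun_prop

/-- The larger of `V(ξ+η)/V(ξ)` and its inverse. -/
def symRatio (V : ℝ → ℝ) (ξ η : ℝ) : ℝ := max (V (ξ + η) / V ξ) (V ξ / V (ξ + η))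

theorem sq_lintegral_mul_le {α : Type*} [MeasurableSpace α] {m : Measure α} {w U : α → ℝ≥0∞}
    (hw : Measurable w) (hU : Measurable U) :
    (∫⁻ x, w x * U x ∂m) ^ 2 ≤ (∫⁻ x, w x ∂m) * ∫⁻ x, w x * U x ^ 2 ∂m := by
  have hsq : ∀ y : ℝ≥0∞, y ^ (1 / 2 : ℝ) * y ^ (1 / 2 : ℝ) = y := fun y => by
    rw [← ENNReal.rpow_add_of_nonneg _ _ (by norm_num) (by norm_num)]; norm_num
  have h := lintegral_mul_le_eLpNorm (m := m) (F := fun x => w x ^ (1 / 2 : ℝ))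
    (G := fun x => w x ^ (1 / 2 : ℝ) * U x) (hw.pow_const _).aemeasurable
    ((hw.pow_const _).mul hU).aemeasurable
  have h2 := pow_le_pow_left' h 2
  rw [mul_pow, eLpNorm_two_sq, eLpNorm_two_sq] at h2
  simp only [enorm_eq_self, ← mul_assoc, hsq, mul_pow, sq (_ ^ (1 / 2 : ℝ))] at h2
  exact h2

/-- Schur's test for the kernel V(ξ)/V(ξ-η)·S(η). `symRatio` contains the ratio and its inverse, so
the one hypothesis controls both the row and the column integrals. -/
theorem eLpNorm_mul_lconv_le (μ : Measure ℝ) [SFinite μ] {S B : ℝ → ℝ≥0∞} (hS : Measurable S)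
    (hB : Measurable B) {V : ℝ → ℝ} (hV : Measurable V) (hVpos : ∀ ξ, 0 < V ξ)
    (hVeven : ∀ ξ, V (-ξ) = V ξ) {κ : ℝ≥0∞}
    (hκ : ∀ ξ, ∫⁻ η, ENNReal.ofReal (symRatio V ξ η) * S η ∂μ ≤ κ) :
    eLpNorm (fun ξ => ENNReal.ofReal (V ξ) * lconv μ S B ξ) 2 volume
      ≤ κ * eLpNorm (fun ξ => ENNReal.ofReal (V ξ) * B ξ) 2 volume := by
  have h1 : ∀ ξ, (ENNReal.ofReal (V ξ) * lconv μ S B ξ) ^ 2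
      ≤ κ * ∫⁻ η, (ENNReal.ofReal (V ξ / V (ξ - η)) * S η)
          * (ENNReal.ofReal (V (ξ - η)) * B (ξ - η)) ^ 2 ∂μ := by
    intro ξ
    have e : ENNReal.ofReal (V ξ) * lconv μ S B ξ = ∫⁻ η, (ENNReal.ofReal (V ξ / V (ξ - η)) * S η)
        * (ENNReal.ofReal (V (ξ - η)) * B (ξ - η)) ∂μ := by
      rw [lconv, ← lintegral_const_mul _ (by fun_prop)]
      refine lintegral_congr fun η => ?_
      have : ENNReal.ofReal (V ξ) = ENNReal.ofReal (V ξ / V (ξ - η))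
          * ENNReal.ofReal (V (ξ - η)) := by
        rw [← ENNReal.ofReal_mul (div_nonneg (hVpos _).le (hVpos _).le),
          div_mul_cancel₀ _ (hVpos _).ne']
      rw [this]
      ring
    rw [e]
    refine (sq_lintegral_mul_le (by fun_prop) (by fun_prop)).trans ?_
    gcongr
    -- Row integral: evenness of V turns V(ξ)/V(ξ-η) into the inverse ratio based at -ξ.
    refine le_trans (lintegral_mono fun η => ?_) (hκ (-ξ))
    gcongr
    have e1 : V (-ξ + η) = V (ξ - η) := by rw [← hVeven]; congr 1; ring
    rw [symRatio, e1, hVeven]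
    exact le_max_right _ _
  have h2 : eLpNorm (fun ξ => ENNReal.ofReal (V ξ) * lconv μ S B ξ) 2 volume ^ 2
      ≤ (κ * eLpNorm (fun ξ => ENNReal.ofReal (V ξ) * B ξ) 2 volume) ^ 2 := by
    rw [mul_pow, eLpNorm_two_sq, eLpNorm_two_sq]
    simp only [enorm_eq_self]
    refine (lintegral_mono h1).trans ?_
    rw [lintegral_const_mul]
    · rw [sq κ, mul_assoc]
      gcongr
      -- Column integral: with ζ = ξ - η the ratio becomes V(ζ+η)/V(ζ), again controlled by `hκ`.
      have h3 := lintegral_lintegral_shift μ (F := fun ζ η => (ENNReal.ofReal (V (ζ + η) / V ζ) * S η)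
          * (ENNReal.ofReal (V ζ) * B ζ) ^ 2) (by fun_prop) (X := fun _ => 1) (by fun_prop)
      simp only [sub_add_cancel, one_mul, mul_one] at h3
      rw [← h3, lintegral_lintegral_swap, ← lintegral_const_mul]
      · refine lintegral_mono fun ζ => ?_
        rw [lintegral_mul_const _ (by fun_prop)]
        gcongr
        refine le_trans (lintegral_mono fun η => ?_) (hκ ζ)
        gcongr
        exact le_max_left _ _
      · fun_prop
      · refine Measurable.aemeasurable ?_
        fun_prop
    · refine Measurable.lintegral_prod_right' (f := fun q : ℝ × ℝ =>
        ENNReal.ofReal (V q.1 / V (q.1 - q.2)) * S q.2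
          * (ENNReal.ofReal (V (q.1 - q.2)) * B (q.1 - q.2)) ^ 2) ?_
      fun_prop
  exact (ENNReal.pow_le_pow_left_iff (by norm_num)).1 h2

/-! ### The system of one mode: Duhamel's formula and the bound on a. -/

section

/-- The `k`-th mode of a solution on the Fourier side: `a = ω̂(k, ·)`, `b = i k θ̂(k, ·)`, with the
action of `T'` recorded only through the total variation `μ` of its Fourier transform. -/
structure IsModeSolution (ν : ℝ) (k : ℤ) (μ : Measure ℝ)
    (a b : ℝ → Lp ℂ 2 (volume : Measure ℝ)) : Prop where
  cont_a : ContinuousOn a (Ici 0)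
  cont_b : ContinuousOn b (Ici 0)
  eq_a : ∀ χ, IsBump χ → ∀ t : ℝ, 0 < t → HasDerivAt (fun s => ∫ ξ, a s ξ * χ ξ)
    ((∫ ξ, a t ξ * (((-(ν * (ξ - k * t) ^ 2) : ℝ) : ℂ) * χ ξ)) + ∫ ξ, b t ξ * χ ξ) t
  eq_b : ∀ χ, IsBump χ → ∀ t : ℝ, 0 < t → ∃ D, HasDerivAt (fun s => ∫ ξ, b s ξ * χ ξ) D t ∧
    ‖D‖ₑ ≤ ∫⁻ η, (∫⁻ ξ, ENNReal.ofReal (res k t ξ) * ‖a t ξ‖ₑ * ‖χ (ξ + η)‖ₑ) ∂μ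

theorem contDiff_ofReal_comp {g : ℝ → ℝ} (hg : ContDiff ℝ ∞ g) :
    ContDiff ℝ ∞ fun ξ => ((g ξ : ℝ) : ℂ) :=
  Complex.ofRealCLM.contDiff.comp hg

theorem contDiff_damp (ν : ℝ) (k : ℤ) (s t : ℝ) : ContDiff ℝ ∞ (damp ν k s t) := by
  unfold damp phase
  fun_prop

theorem measurable_ghost_right (L : ℝ) (k : ℤ) (t : ℝ) : Measurable (ghost L k t) := by
  unfold ghost
  have := Real.continuous_arctan
  fun_prop

theorem measurable_damp_left (ν : ℝ) (k : ℤ) (t ξ : ℝ) : Measurable fun s => damp ν k s t ξ := by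
  unfold damp phase
  fun_prop

theorem continuousOn_pairing {a : ℝ → Lp ℂ 2 (volume : Measure ℝ)} {A : Set ℝ}
    (ha : ContinuousOn a A) {χ : ℝ → ℂ} (hχ : MemLp χ 2 volume) :
    ContinuousOn (fun s => ∫ ξ, a s ξ * χ ξ) A := by
  obtain ⟨B, hB⟩ := exists_pairing
  have e : ∀ s, ∫ ξ, a s ξ * χ ξ = B (a s) (hχ.toLp χ) := fun s => by
    rw [hB]
    refine integral_congr_ae ?_
    filter_upwards [hχ.coeFn_toLp] with ξ hξ
    rw [hξ]
  simp only [e]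
  exact (B.continuous.comp_continuousOn ha).clm_apply continuousOn_const

theorem continuousOn_pairing₂ {a : ℝ → Lp ℂ 2 (volume : Measure ℝ)} {A : Set ℝ}
    (ha : ContinuousOn a A) {κ : ℝ → ℝ → ℂ} (hκ : ∀ r, MemLp (κ r) 2 volume)
    (hc : Continuous fun r => (hκ r).toLp (κ r)) :
    ContinuousOn (fun s => ∫ ξ, a s ξ * κ s ξ) A := by
  obtain ⟨B, hB⟩ := exists_pairing
  have e : ∀ s, ∫ ξ, a s ξ * κ s ξ = B (a s) ((hκ s).toLp (κ s)) := fun s => by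
    rw [hB]
    refine integral_congr_ae ?_
    filter_upwards [(hκ s).coeFn_toLp] with ξ hξ
    rw [hξ]
  simp only [e]
  exact (B.continuous.comp_continuousOn ha).clm_apply hc.continuousOn

theorem eLpNorm_const_mul {α : Type*} [MeasurableSpace α] {m : Measure α} (c : ℝ≥0∞)
    {F : α → ℝ≥0∞} (hF : Measurable F) :
    eLpNorm (fun x => c * F x) 2 m = c * eLpNorm F 2 m := by
  refine (ENNReal.pow_right_strictMono (n := 2) (by norm_num)).injective ?_
  rw [mul_pow, eLpNorm_two_sq, eLpNorm_two_sq, ← lintegral_const_mul _ (by fun_prop)]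
  simp [mul_pow]

theorem eLpNorm_add_le_two {α : Type*} [MeasurableSpace α] {m : Measure α}
    {F G : α → ℝ≥0∞} (hF : Measurable F) (hG : Measurable G) :
    eLpNorm (fun x => F x + G x) 2 m ≤ eLpNorm F 2 m + eLpNorm G 2 m :=
  eLpNorm_add_le hF.aestronglyMeasurable hG.aestronglyMeasurable (by norm_num)

theorem eLpNorm_mono_ennreal {α : Type*} [MeasurableSpace α] {m : Measure α}
    {F G : α → ℝ≥0∞} (h : ∀ x, F x ≤ G x) : eLpNorm F 2 m ≤ eLpNorm G 2 m :=
  eLpNorm_mono_enorm fun x => by simpa using h x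

theorem measurable_enorm_coe (f : Lp ℂ 2 (volume : Measure ℝ)) : Measurable fun ξ => ‖f ξ‖ₑ :=
  (Lp.stronglyMeasurable f).measurable.enorm

theorem ofReal_damp_mul_le {ν : ℝ} (hν : 0 < ν) (k : ℤ) {t : ℝ} (ht : 0 ≤ t) (ξ : ℝ) (x : ℝ≥0∞) :
    ENNReal.ofReal (damp ν k 0 t ξ) * x ≤ x :=
  mul_le_of_le_one_left' (ENNReal.ofReal_le_one.2 (damp_le_one hν.le k ξ ht))

namespace IsModeSolution

variable {ν : ℝ} {k : ℤ} {μ : Measure ℝ} {a b : ℝ → Lp ℂ 2 (volume : Measure ℝ)}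

/-- Integrating factor in weak form: pair a(s) with damp(s,t)χ. The time derivative of the factor
cancels the dissipation, leaving only the pairing of b. -/
theorem duhamel (h : IsModeSolution ν k μ a b) {χ : ℝ → ℂ} (hχ : IsBump χ) {t : ℝ} (ht : 0 ≤ t) :
    ‖∫ ξ, a t ξ * χ ξ‖ₑ ≤ (∫⁻ ξ, ‖χ ξ‖ₑ * (ENNReal.ofReal (damp ν k 0 t ξ) * ‖a 0 ξ‖ₑ))
      + ∫⁻ s in Ioo 0 t, ∫⁻ ξ, ‖χ ξ‖ₑ * (ENNReal.ofReal (damp ν k s t ξ) * ‖b s ξ‖ₑ) := by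
  set g : ℝ → ℝ → ℂ := fun s ξ => ((damp ν k s t ξ : ℝ) : ℂ) with hg
  set g' : ℝ → ℝ → ℂ := fun s ξ => ((ν * (ξ - k * s) ^ 2 * damp ν k s t ξ : ℝ) : ℂ) with hg'
  have hgd : ∀ r x, HasDerivAt (fun r => g r x) (g' r x) r := by
    intro r x
    have h1 := ((((hasDerivAt_phase k x r).const_sub (phase k x t)).const_mul ν).neg).exp
    refine h1.ofReal_comp.congr_deriv ?_
    simp only [hg', damp, Pi.neg_apply]
    push_cast
    ring
  have hcg : Continuous (Function.uncurry g') := by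
    simp only [hg', damp, phase, Function.uncurry_def]
    fun_prop
  have hbump : ∀ r, IsBump (fun x => g r x * χ x) := fun r =>
    hχ.mul_left (contDiff_ofReal_comp (contDiff_damp ν k r t))
  have hbump' : ∀ r, IsBump (fun x => g' r x * χ x) := fun r =>
    hχ.mul_left (contDiff_ofReal_comp (by
      have := contDiff_damp ν k r t
      fun_prop))
  have hder := hasDerivAt_toLp_mul_bump hχ hcg hgd (fun r => (hbump r).memLp)
    (fun r => (hbump' r).memLp)
  have hcont : Continuous fun r => (hbump r).memLp.toLp (fun x => g r x * χ x) :=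
    continuous_iff_continuousAt.2 fun s => (hder s).continuousAt
  have key := enorm_sub_le_lintegral_of_hasDerivAt (f := fun s => ∫ ξ, a s ξ * (g s ξ * χ ξ))
    (f' := fun s => ∫ ξ, b s ξ * (g s ξ * χ ξ))
    (h := fun s => ∫⁻ ξ, ‖χ ξ‖ₑ * (ENNReal.ofReal (damp ν k s t ξ) * ‖b s ξ‖ₑ)) ht ?_ ?_ ?_
  · have e1 : ∀ ξ, g t ξ = 1 := fun ξ => by simp [hg, damp_self]
    simp only [e1, one_mul] at key
    have e2 : ‖∫ ξ, a 0 ξ * (g 0 ξ * χ ξ)‖ₑ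
        ≤ ∫⁻ ξ, ‖χ ξ‖ₑ * (ENNReal.ofReal (damp ν k 0 t ξ) * ‖a 0 ξ‖ₑ) := by
      refine (enorm_integral_le_lintegral_enorm _).trans (lintegral_mono fun ξ => ?_)
      simp only [hg, enorm_mul]
      rw [← ofReal_norm ((damp ν k 0 t ξ : ℝ) : ℂ), Complex.norm_real,
        Real.norm_of_nonneg (damp_pos _ _ _ _ _).le]
      exact le_of_eq (by ring)
    calc ‖∫ ξ, a t ξ * χ ξ‖ₑ = ‖(∫ ξ, a 0 ξ * (g 0 ξ * χ ξ))
          + ((∫ ξ, a t ξ * χ ξ) - ∫ ξ, a 0 ξ * (g 0 ξ * χ ξ))‖ₑ := by congr 1; ring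
      _ ≤ _ := (enorm_add_le _ _).trans (add_le_add e2 key)
  · exact (continuousOn_pairing₂ h.cont_a (fun r => (hbump r).memLp) hcont).mono
      Icc_subset_Ici_self
  · intro s hs
    have h1 := hasDerivAt_integral_mul (a := a) (s := s)
      (h.cont_a.continuousAt (Ici_mem_nhds hs.1)) (fun r => (hbump r).memLp) (hbump' s).memLp
      (hder s) (h.eq_a _ (hbump s) s hs.1)
    refine h1.congr_deriv ?_
    have hL := (Lp.memLp (a s))
    have hb1 : IsBump (fun ξ => ((-(ν * (ξ - k * s) ^ 2) : ℝ) : ℂ) * (g s ξ * χ ξ)) :=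
      (hbump s).mul_left (contDiff_ofReal_comp (by fun_prop))
    -- The cancellation: ∂ₛ damp(s,t) = ν(ξ-ks)² damp(s,t).
    have e3 : (∫ ξ, a s ξ * (((-(ν * (ξ - k * s) ^ 2) : ℝ) : ℂ) * (g s ξ * χ ξ)))
        + ∫ ξ, a s ξ * (g' s ξ * χ ξ) = 0 := by
      rw [← integral_add (integrable_mul_of_memLp hL hb1.memLp)
        (integrable_mul_of_memLp hL (hbump' s).memLp)]
      rw [← integral_zero ℝ ℂ]
      congr 1
      ext ξ
      simp only [hg', hg]
      push_cast
      ring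
    linear_combination e3
  · intro s hs
    refine (enorm_integral_le_lintegral_enorm _).trans (lintegral_mono fun ξ => ?_)
    simp only [hg, enorm_mul]
    rw [← ofReal_norm ((damp ν k s t ξ : ℝ) : ℂ), Complex.norm_real,
      Real.norm_of_nonneg (damp_pos _ _ _ _ _).le]
    exact le_of_eq (by ring)

/-- Bound on `a` from a majorant of `b`. -/
theorem enorm_a_le (h : IsModeSolution ν k μ a b) (hν : 0 < ν) {L : ℝ} (hL : 0 < L) (hk : k ≠ 0)
    {B : ℝ → ℝ≥0∞} (hB : Measurable B) (hB2 : eLpNorm B 2 volume ≠ ⊤) {τ : ℝ}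
    (hb : ∀ s ∈ Icc 0 τ, ∀ᵐ ξ, ‖b s ξ‖ₑ ≤ ENNReal.ofReal (ghost L k s ξ) * B ξ) :
    ∀ t ∈ Icc 0 τ, ∀ᵐ ξ, ‖a t ξ‖ₑ ≤ ENNReal.ofReal (damp ν k 0 t ξ) * ‖a 0 ξ‖ₑ
      + ENNReal.ofReal (relax ν) * (ENNReal.ofReal (ghost L k t ξ) * B ξ) := by
  intro t ht
  have hm0 := measurable_enorm_coe (a 0)
  have hmd : ∀ s, Measurable (damp ν k s t) := fun s => (contDiff_damp ν k s t).continuous.measurable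
  have hmg : Measurable (ghost L k t) := measurable_ghost_right L k t
  refine ae_enorm_le_of_forall_bump (Lp.stronglyMeasurable (a t)).measurable (Lp.memLp (a t))
    ?_ ?_ ?_
  · exact ((hmd 0).ennreal_ofReal.mul hm0).add
      ((hmg.ennreal_ofReal.mul hB).const_mul (ENNReal.ofReal (relax ν)))
  · have hle : eLpNorm (fun ξ => ENNReal.ofReal (damp ν k 0 t ξ) * ‖a 0 ξ‖ₑ
        + ENNReal.ofReal (relax ν) * (ENNReal.ofReal (ghost L k t ξ) * B ξ)) 2 volume
        ≤ eLpNorm (fun ξ => ‖a 0 ξ‖ₑ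
          + (ENNReal.ofReal (relax ν) * ENNReal.ofReal (Real.exp (L * π))) * B ξ) 2 volume := by
      refine eLpNorm_mono_ennreal fun ξ => ?_
      rw [mul_assoc]
      refine add_le_add (ofReal_damp_mul_le hν k ht.1 ξ _) ?_
      gcongr
      exact ghost_le hL.le k t ξ
    refine (hle.trans_lt ((eLpNorm_add_le_two hm0 (hB.const_mul _)).trans_lt ?_)).ne
    refine ENNReal.add_lt_top.2 ⟨?_, ?_⟩
    · rw [eLpNorm_enorm]; exact Lp.eLpNorm_lt_top _
    · rw [eLpNorm_const_mul _ hB]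
      exact ENNReal.mul_lt_top (ENNReal.mul_lt_top ENNReal.ofReal_lt_top ENNReal.ofReal_lt_top)
        (lt_top_iff_ne_top.2 hB2)
  · intro χ hχ
    refine (h.duhamel hχ ht.1).trans ?_
    have hmχ : Measurable χ := hχ.smooth.continuous.measurable
    have e1 : ∫⁻ s in Ioo 0 t, ∫⁻ ξ, ‖χ ξ‖ₑ * (ENNReal.ofReal (damp ν k s t ξ) * ‖b s ξ‖ₑ)
        ≤ ∫⁻ s in Ioo 0 t, ∫⁻ ξ, ‖χ ξ‖ₑ * (ENNReal.ofReal (damp ν k s t ξ)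
          * (ENNReal.ofReal (ghost L k t ξ) * B ξ)) := by
      refine setLIntegral_mono' measurableSet_Ioo fun s hs => lintegral_mono_ae ?_
      filter_upwards [hb s ⟨hs.1.le, hs.2.le.trans ht.2⟩] with ξ hξ
      gcongr
      refine hξ.trans ?_
      gcongr
      -- The weight may be frozen at the final time t because it increases; then only `damp` remains
      -- under the time integral.
      exact ghost_mono hL.le k ξ hs.2.le
    have e2 : ∫⁻ s in Ioo 0 t, ∫⁻ ξ, ‖χ ξ‖ₑ * (ENNReal.ofReal (damp ν k s t ξ)
          * (ENNReal.ofReal (ghost L k t ξ) * B ξ))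
        = ∫⁻ ξ, ‖χ ξ‖ₑ * ((∫⁻ s in Ioo 0 t, ENNReal.ofReal (damp ν k s t ξ))
          * (ENNReal.ofReal (ghost L k t ξ) * B ξ)) := by
      have := measurable_damp ν k t
      rw [lintegral_lintegral_swap]
      · refine lintegral_congr fun ξ => ?_
        have hms := measurable_damp_left ν k t ξ
        rw [lintegral_const_mul _ (by fun_prop), lintegral_mul_const _ (by fun_prop)]
      · refine Measurable.aemeasurable ?_
        simp only [Function.uncurry_def]
        fun_prop
    rw [e2] at e1
    refine (add_le_add le_rfl e1).trans ?_
    rw [← lintegral_add_left (by have := hmd 0; fun_prop)]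
    refine lintegral_mono fun ξ => ?_
    simp only
    rw [← mul_add]
    gcongr
    exact lintegral_damp_le hν hk ξ t

/-- The case of the mode k = 0, where b = ikθ̃ vanishes and there is neither resonance nor enhanced
dissipation. -/
theorem enorm_a_le_of_b_eq_zero (h : IsModeSolution ν k μ a b) (hν : 0 < ν)
    (hb : ∀ s, 0 ≤ s → b s = 0) {t : ℝ} (ht : 0 ≤ t) : ∀ᵐ ξ, ‖a t ξ‖ₑ ≤ ‖a 0 ξ‖ₑ := by
  have hm0 := measurable_enorm_coe (a 0)
  refine ae_enorm_le_of_forall_bump (Lp.stronglyMeasurable (a t)).measurable (Lp.memLp (a t))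
    hm0 ?_ ?_
  · rw [eLpNorm_enorm]; exact Lp.eLpNorm_ne_top _
  · intro χ hχ
    refine (h.duhamel hχ ht).trans ?_
    have e1 : ∫⁻ s in Ioo 0 t, ∫⁻ ξ, ‖χ ξ‖ₑ * (ENNReal.ofReal (damp ν k s t ξ) * ‖b s ξ‖ₑ) = 0 := by
      rw [setLIntegral_congr_fun measurableSet_Ioo (g := fun _ => 0), lintegral_zero]
      intro s hs
      simp only
      rw [hb s hs.1.le, lintegral_congr_ae (g := fun _ => 0), lintegral_zero]
      filter_upwards [Lp.coeFn_zero ℂ 2 (volume : Measure ℝ)] with ξ hξ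
      simp
    rw [e1, add_zero]
    refine lintegral_mono fun ξ => ?_
    gcongr
    exact ofReal_damp_mul_le hν k ht ξ _

end IsModeSolution

end

/-! ### Bounds on b: a first majorant without smallness, and its improvement. -/

section

theorem eLpNorm_lconv_le (μ : Measure ℝ) [SFinite μ] {S B : ℝ → ℝ≥0∞} (hS : Measurable S)
    (hB : Measurable B) :
    eLpNorm (lconv μ S B) 2 volume ≤ (∫⁻ η, S η ∂μ) * eLpNorm B 2 volume := by
  have := eLpNorm_mul_lconv_le μ hS hB (V := fun _ => 1) measurable_const (by simp) (by simp)
    (κ := ∫⁻ η, S η ∂μ) (by simp [symRatio])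
  simpa using this

/-- A is the L²-valued integral of |a(s)| over [0,τ]; pairing with X commutes with that integral.
This avoids choosing a jointly measurable representative of (s,ξ) ↦ a(s)(ξ). -/
theorem exists_time_majorant {a : ℝ → Lp ℂ 2 (volume : Measure ℝ)} {τ : ℝ} (hτ : 0 ≤ τ)
    (ha : ContinuousOn a (Icc 0 τ)) :
    ∃ A : ℝ → ℝ≥0∞, Measurable A ∧ eLpNorm A 2 volume ≠ ⊤ ∧
      ∀ X : ℝ → ℝ≥0∞, Measurable X → eLpNorm X 2 volume ≠ ⊤ →
        ∫⁻ s in Ioo 0 τ, ∫⁻ ξ, ‖a s ξ‖ₑ * X ξ ≤ ∫⁻ ξ, A ξ * X ξ := by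
  set f : ℝ → Lp ℝ 2 (volume : Measure ℝ) := fun s =>
    (lipschitzWith_one_norm (E := ℂ)).compLp norm_zero (a s) with hf
  have hfc : ContinuousOn f (Icc 0 τ) :=
    ((lipschitzWith_one_norm (E := ℂ)).continuous_compLp norm_zero).comp_continuousOn ha
  have hfe : ∀ s, ∀ᵐ ξ, f s ξ = ‖a s ξ‖ := fun s =>
    (lipschitzWith_one_norm (E := ℂ)).coeFn_compLp norm_zero (a s)
  have hfi : IntervalIntegrable f volume 0 τ := by
    rw [← uIcc_of_le hτ] at hfc
    exact hfc.intervalIntegrable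
  set A : Lp ℝ 2 (volume : Measure ℝ) := ∫ s in (0 : ℝ)..τ, f s with hA
  refine ⟨fun ξ => ‖A ξ‖ₑ, (Lp.stronglyMeasurable A).measurable.enorm, ?_, fun X hX hX2 => ?_⟩
  · rw [eLpNorm_enorm]; exact Lp.eLpNorm_ne_top A
  have hXfin : ∀ᵐ ξ, X ξ < ⊤ := by
    have h2 : ∫⁻ ξ, X ξ ^ 2 ≠ ⊤ := by
      have := eLpNorm_two_sq (m := (volume : Measure ℝ)) X
      simp only [enorm_eq_self] at this
      rw [← this]
      exact ENNReal.pow_ne_top hX2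
    filter_upwards [ae_lt_top (hX.pow_const 2) h2] with ξ hξ
    by_contra hcon
    simp [not_lt_top_iff.1 hcon] at hξ
  have hXL : MemLp (fun ξ => (X ξ).toReal) 2 (volume : Measure ℝ) := by
    refine ⟨hX.ennreal_toReal.aestronglyMeasurable, lt_of_le_of_lt ?_ (lt_top_iff_ne_top.2 hX2)⟩
    refine eLpNorm_mono_enorm fun ξ => ?_
    rw [Real.enorm_of_nonneg ENNReal.toReal_nonneg]
    exact ENNReal.ofReal_toReal_le
  set x := hXL.toLp _ with hx
  have hpair : ∀ g : Lp ℝ 2 (volume : Measure ℝ), inner ℝ x g = ∫ ξ, g ξ * (X ξ).toReal := by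
    intro g
    rw [L2.inner_def]
    refine integral_congr_ae ?_
    filter_upwards [hXL.coeFn_toLp] with ξ hξ
    rw [hx, hξ]
    simp
  have hone : ∀ s, ∫⁻ ξ, ‖a s ξ‖ₑ * X ξ = ENNReal.ofReal (inner ℝ x (f s)) := by
    intro s
    have hint : Integrable (fun ξ => f s ξ * (X ξ).toReal) := (Lp.memLp (f s)).integrable_mul hXL
    rw [hpair, ofReal_integral_eq_lintegral_ofReal hint]
    · refine lintegral_congr_ae ?_
      filter_upwards [hfe s, hXfin] with ξ h1 h2
      rw [h1, ENNReal.ofReal_mul (norm_nonneg _), ofReal_norm, ENNReal.ofReal_toReal h2.ne]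
    · filter_upwards [hfe s] with ξ h1
      rw [h1]
      exact mul_nonneg (norm_nonneg _) ENNReal.toReal_nonneg
  have hnn : ∀ s, 0 ≤ inner ℝ x (f s) := by
    intro s
    rw [hpair]
    refine integral_nonneg_of_ae ?_
    filter_upwards [hfe s] with ξ h1
    rw [h1]
    exact mul_nonneg (norm_nonneg _) ENNReal.toReal_nonneg
  simp only [hone]
  have hic : ContinuousOn (fun s => inner ℝ x (f s)) (Icc 0 τ) := ContinuousOn.inner continuousOn_const hfc
  rw [← ofReal_integral_eq_lintegral_ofReal (hic.integrableOn_Icc.mono_set Ioo_subset_Icc_self)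
    (Eventually.of_forall hnn), ← integral_Ioc_eq_integral_Ioo,
    ← intervalIntegral.integral_of_le hτ]
  have e : ∫ s in (0 : ℝ)..τ, inner ℝ x (f s) = inner ℝ x A := by
    have := (innerSL ℝ x).intervalIntegral_comp_comm hfi
    simpa using this
  rw [e, hpair]
  calc ENNReal.ofReal (∫ ξ, A ξ * (X ξ).toReal) ≤ ‖∫ ξ, A ξ * (X ξ).toReal‖ₑ :=
        (Real.enorm_eq_ofReal_abs _).symm ▸ ENNReal.ofReal_le_ofReal (le_abs_self _)
    _ ≤ ∫⁻ ξ, ‖A ξ * (X ξ).toReal‖ₑ := enorm_integral_le_lintegral_enorm _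
    _ ≤ _ := by
      refine lintegral_mono fun ξ => ?_
      simp only [enorm_mul]
      gcongr
      rw [Real.enorm_of_nonneg ENNReal.toReal_nonneg]
      exact ENNReal.ofReal_toReal_le

theorem lintegral_lintegral_lintegral_swap (m μ : Measure ℝ) [SFinite m] [SFinite μ]
    {H : ℝ → ℝ → ℝ≥0∞} (hH : Measurable (Function.uncurry H)) {X : ℝ → ℝ≥0∞} (hX : Measurable X) :
    ∫⁻ s, (∫⁻ ξ, X ξ * ∫⁻ η, H s (ξ - η) ∂μ) ∂m
      = ∫⁻ ξ, X ξ * ∫⁻ η, (∫⁻ s, H s (ξ - η) ∂m) ∂μ := by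
  have hm3 : Measurable fun q : ℝ × ℝ => ∫⁻ η, H q.1 (q.2 - η) ∂μ :=
    Measurable.lintegral_prod_right' (f := fun q : (ℝ × ℝ) × ℝ => H q.1.1 (q.1.2 - q.2))
      (hH.comp (by fun_prop : Measurable fun q : (ℝ × ℝ) × ℝ => (q.1.1, q.1.2 - q.2)))
  rw [lintegral_lintegral_swap]
  · refine lintegral_congr fun ξ => ?_
    have hms : Measurable fun q : ℝ × ℝ => H q.1 (ξ - q.2) :=
      hH.comp (by fun_prop : Measurable fun q : ℝ × ℝ => (q.1, ξ - q.2))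
    rw [lintegral_const_mul _ (Measurable.lintegral_prod_right' hms)]
    congr 1
    exact lintegral_lintegral_swap hms.aemeasurable
  · refine Measurable.aemeasurable ?_
    exact Measurable.mul (by fun_prop) hm3

namespace IsModeSolution

variable {ν : ℝ} {k : ℤ} {μ : Measure ℝ} {a b : ℝ → Lp ℂ 2 (volume : Measure ℝ)}

/-- The derivative D is only known to exist at each time with a bound, so a choice of D is
integrated through `enorm_sub_le_lintegral_of_hasDerivAt`. -/
theorem pairing_b_le (h : IsModeSolution ν k μ a b) {χ : ℝ → ℂ} (hχ : IsBump χ) {t : ℝ}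
    (ht : 0 ≤ t) : ‖∫ ξ, b t ξ * χ ξ‖ₑ ≤ (∫⁻ ξ, ‖χ ξ‖ₑ * ‖b 0 ξ‖ₑ) + ∫⁻ s in Ioo 0 t,
      ∫⁻ η, (∫⁻ ξ, ENNReal.ofReal (res k s ξ) * ‖a s ξ‖ₑ * ‖χ (ξ + η)‖ₑ) ∂μ := by
  have hex : ∀ s, ∃ D, 0 < s → HasDerivAt (fun s => ∫ ξ, b s ξ * χ ξ) D s ∧
      ‖D‖ₑ ≤ ∫⁻ η, (∫⁻ ξ, ENNReal.ofReal (res k s ξ) * ‖a s ξ‖ₑ * ‖χ (ξ + η)‖ₑ) ∂μ := by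
    intro s
    by_cases hs : 0 < s
    · obtain ⟨D, hD⟩ := h.eq_b χ hχ s hs
      exact ⟨D, fun _ => hD⟩
    · exact ⟨0, fun h => absurd h hs⟩
  choose D hD using hex
  have key := enorm_sub_le_lintegral_of_hasDerivAt ht
    ((continuousOn_pairing h.cont_b hχ.memLp).mono Icc_subset_Ici_self)
    (fun s hs => (hD s hs.1).1) (fun s hs => (hD s hs.1).2)
  have e2 : ‖∫ ξ, b 0 ξ * χ ξ‖ₑ ≤ ∫⁻ ξ, ‖χ ξ‖ₑ * ‖b 0 ξ‖ₑ := by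
    refine (enorm_integral_le_lintegral_enorm _).trans (lintegral_mono fun ξ => ?_)
    rw [enorm_mul, mul_comm]
  calc ‖∫ ξ, b t ξ * χ ξ‖ₑ = ‖(∫ ξ, b 0 ξ * χ ξ)
        + ((∫ ξ, b t ξ * χ ξ) - ∫ ξ, b 0 ξ * χ ξ)‖ₑ := by congr 1; ring
    _ ≤ _ := (enorm_add_le _ _).trans (add_le_add e2 key)

/-- Bounding `res` by 1 and using the time majorant A of a gives |b(t)| ≤ |b₀| + μ∗A on [0,τ]. Its
size depends on the solution and on τ; it only starts the iteration. -/
theorem exists_majorant (h : IsModeSolution ν k μ a b) [IsFiniteMeasure μ] {L : ℝ} (hL : 0 ≤ L)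
    {τ : ℝ} (hτ : 0 ≤ τ) : ∃ B : ℝ → ℝ≥0∞, Measurable B ∧ eLpNorm B 2 volume ≠ ⊤ ∧
      ∀ t ∈ Icc 0 τ, ∀ᵐ ξ, ‖b t ξ‖ₑ ≤ ENNReal.ofReal (ghost L k t ξ) * B ξ := by
  obtain ⟨A, hAm, hA2, hA⟩ := exists_time_majorant hτ (h.cont_a.mono Icc_subset_Ici_self)
  have hm0 := measurable_enorm_coe (b 0)
  have hcm : Measurable (lconv μ (fun _ => 1) A) := measurable_lconv μ measurable_const hAm
  have hB2 : eLpNorm (fun ξ => ‖b 0 ξ‖ₑ + lconv μ (fun _ => 1) A ξ) 2 volume ≠ ⊤ := by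
    refine ((eLpNorm_add_le_two hm0 hcm).trans_lt (ENNReal.add_lt_top.2 ⟨?_, ?_⟩)).ne
    · rw [eLpNorm_enorm]; exact Lp.eLpNorm_lt_top _
    · refine (eLpNorm_lconv_le μ measurable_const hAm).trans_lt
        (ENNReal.mul_lt_top ?_ (lt_top_iff_ne_top.2 hA2))
      simp
  refine ⟨fun ξ => ‖b 0 ξ‖ₑ + lconv μ (fun _ => 1) A ξ, hm0.add hcm, hB2, fun t ht => ?_⟩
  have key : ∀ᵐ ξ, ‖b t ξ‖ₑ ≤ ‖b 0 ξ‖ₑ + lconv μ (fun _ => 1) A ξ := by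
    refine ae_enorm_le_of_forall_bump (Lp.stronglyMeasurable (b t)).measurable (Lp.memLp (b t))
      (hm0.add hcm) hB2 fun χ hχ => (h.pairing_b_le hχ ht.1).trans ?_
    have hmχ : Measurable χ := hχ.smooth.continuous.measurable
    set X : ℝ → ℝ≥0∞ := fun ξ => ∫⁻ η, ‖χ (ξ + η)‖ₑ ∂μ with hX
    have hXm : Measurable X :=
      Measurable.lintegral_prod_right' (f := fun q : ℝ × ℝ => ‖χ (q.1 + q.2)‖ₑ) (by fun_prop)
    have hX2 : eLpNorm X 2 volume ≠ ⊤ := by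
      -- X is the convolution of |χ| with the reflection of μ, hence square integrable.
      have e : X = lconv (μ.map (fun η => -η)) (fun _ => 1) (fun ξ => ‖χ ξ‖ₑ) := by
        ext ξ
        rw [lconv, lintegral_map (by fun_prop) (by fun_prop)]
        simp [hX]
      rw [e]
      refine ((eLpNorm_lconv_le _ measurable_const (by fun_prop)).trans_lt
        (ENNReal.mul_lt_top ?_ ?_)).ne
      · simp
      · rw [eLpNorm_enorm]; exact hχ.memLp.2
    have e1 : ∫⁻ s in Ioo 0 t,
        ∫⁻ η, (∫⁻ ξ, ENNReal.ofReal (res k s ξ) * ‖a s ξ‖ₑ * ‖χ (ξ + η)‖ₑ) ∂μ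
        ≤ ∫⁻ s in Ioo 0 τ, ∫⁻ ξ, ‖a s ξ‖ₑ * X ξ := by
      refine (lintegral_mono_set (Ioo_subset_Ioo_right ht.2)).trans (lintegral_mono fun s => ?_)
      have hms := measurable_enorm_coe (a s)
      have e3 : ∫⁻ ξ, ‖a s ξ‖ₑ * X ξ = ∫⁻ η, (∫⁻ ξ, ‖a s ξ‖ₑ * ‖χ (ξ + η)‖ₑ) ∂μ := by
        rw [lintegral_lintegral_swap]
        · refine lintegral_congr fun ξ => ?_
          rw [hX, lintegral_const_mul _ (by fun_prop)]
        · refine Measurable.aemeasurable ?_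
          exact (hms.comp measurable_snd).mul (by fun_prop)
      rw [e3]
      refine lintegral_mono fun η => lintegral_mono fun ξ => ?_
      gcongr
      exact mul_le_of_le_one_left' (ENNReal.ofReal_le_one.2 (res_le_one _ _ _))
    have e2 : ∫⁻ ξ, A ξ * X ξ = ∫⁻ ξ, ‖χ ξ‖ₑ * lconv μ (fun _ => 1) A ξ := by
      have := lintegral_lintegral_shift μ (F := fun ξ _ => A ξ) (by fun_prop)
        (X := fun ξ => ‖χ ξ‖ₑ) (by fun_prop)
      simp only [lconv, one_mul]
      rw [← this, lintegral_lintegral_swap]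
      · refine lintegral_congr fun ξ => ?_
        rw [hX, lintegral_const_mul _ (by fun_prop)]
      · refine Measurable.aemeasurable ?_
        fun_prop
    refine (add_le_add le_rfl (e1.trans ((hA X hXm hX2).trans e2.le))).trans ?_
    rw [← lintegral_add_left (by fun_prop)]
    exact lintegral_mono fun ξ => (mul_add _ _ _).ge
  filter_upwards [key] with ξ hξ
  exact hξ.trans (le_mul_of_one_le_left' (ENNReal.one_le_ofReal.2 (one_le_ghost hL k t ξ)))

/-- One step of the iteration. The bound on a is integrated in time: its first part is damped from
time 0 and costs `relax`, its second carries `res * ghost` and costs 1/L; the convolution then moves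
the weight from ξ - η to ξ at the price S(η). -/
theorem enorm_b_le (h : IsModeSolution ν k μ a b) [IsFiniteMeasure μ] (hν : 0 < ν) {L : ℝ}
    (hL : 0 < L) (hk : k ≠ 0) {S : ℝ → ℝ≥0∞} (hSm : Measurable S) (hS1 : ∀ η, 1 ≤ S η)
    (hSμ : ∫⁻ η, S η ∂μ ≠ ⊤)
    (hS : ∀ t ξ η, ENNReal.ofReal (ghost L k t (ξ - η)) ≤ S η * ENNReal.ofReal (ghost L k t ξ))
    {B : ℝ → ℝ≥0∞} (hB : Measurable B) (hB2 : eLpNorm B 2 volume ≠ ⊤) {τ : ℝ}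
    (ha : ∀ s ∈ Icc 0 τ, ∀ᵐ ξ, ‖a s ξ‖ₑ ≤ ENNReal.ofReal (damp ν k 0 s ξ) * ‖a 0 ξ‖ₑ
      + ENNReal.ofReal (relax ν) * (ENNReal.ofReal (ghost L k s ξ) * B ξ)) :
    ∀ t ∈ Icc 0 τ, ∀ᵐ ξ, ‖b t ξ‖ₑ ≤ ENNReal.ofReal (ghost L k t ξ) * (‖b 0 ξ‖ₑ
      + (ENNReal.ofReal (relax ν) * lconv μ S (fun ξ => ‖a 0 ξ‖ₑ) ξ
        + ENNReal.ofReal (relax ν / L) * lconv μ S B ξ)) := by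
  intro t ht
  have hma := measurable_enorm_coe (a 0)
  have hmb := measurable_enorm_coe (b 0)
  have hmg := measurable_ghost_right L k t
  have hc1 : Measurable (lconv μ S (fun ξ => ‖a 0 ξ‖ₑ)) := measurable_lconv μ hSm hma
  have hc2 : Measurable (lconv μ S B) := measurable_lconv μ hSm hB
  have hFm : Measurable fun ξ => ‖b 0 ξ‖ₑ
      + (ENNReal.ofReal (relax ν) * lconv μ S (fun ξ => ‖a 0 ξ‖ₑ) ξ
        + ENNReal.ofReal (relax ν / L) * lconv μ S B ξ) :=
    hmb.add ((hc1.const_mul _).add (hc2.const_mul _))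
  refine ae_enorm_le_of_forall_bump (Lp.stronglyMeasurable (b t)).measurable (Lp.memLp (b t))
    (hmg.ennreal_ofReal.mul hFm) ?_ ?_
  · have hle := eLpNorm_mono_ennreal (m := (volume : Measure ℝ)) (fun ξ => mul_le_mul_left
      (ENNReal.ofReal_le_ofReal (ghost_le hL.le k t ξ)) (‖b 0 ξ‖ₑ
      + (ENNReal.ofReal (relax ν) * lconv μ S (fun ξ => ‖a 0 ξ‖ₑ) ξ
        + ENNReal.ofReal (relax ν / L) * lconv μ S B ξ)))
    refine (hle.trans_lt ?_).ne
    rw [eLpNorm_const_mul _ hFm]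
    refine ENNReal.mul_lt_top ENNReal.ofReal_lt_top ?_
    refine (eLpNorm_add_le_two hmb ((hc1.const_mul _).add (hc2.const_mul _))).trans_lt
      (ENNReal.add_lt_top.2 ⟨?_, ?_⟩)
    · rw [eLpNorm_enorm]; exact Lp.eLpNorm_lt_top _
    refine (eLpNorm_add_le_two (hc1.const_mul _) (hc2.const_mul _)).trans_lt
      (ENNReal.add_lt_top.2 ⟨?_, ?_⟩)
    · rw [eLpNorm_const_mul _ hc1]
      refine ENNReal.mul_lt_top ENNReal.ofReal_lt_top ((eLpNorm_lconv_le μ hSm hma).trans_lt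
        (ENNReal.mul_lt_top (lt_top_iff_ne_top.2 hSμ) ?_))
      rw [eLpNorm_enorm]; exact Lp.eLpNorm_lt_top _
    · rw [eLpNorm_const_mul _ hc2]
      exact ENNReal.mul_lt_top ENNReal.ofReal_lt_top ((eLpNorm_lconv_le μ hSm hB).trans_lt
        (ENNReal.mul_lt_top (lt_top_iff_ne_top.2 hSμ) (lt_top_iff_ne_top.2 hB2)))
  intro χ hχ
  refine (h.pairing_b_le hχ ht.1).trans ?_
  have hmχ : Measurable χ := hχ.smooth.continuous.measurable
  -- The right side of `ha` times the resonance factor. It is jointly measurable in (s,ξ), as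
  -- Tonelli requires.
  set H : ℝ → ℝ → ℝ≥0∞ := fun s ξ => ENNReal.ofReal (res k s ξ)
    * (ENNReal.ofReal (damp ν k 0 s ξ) * ‖a 0 ξ‖ₑ
      + ENNReal.ofReal (relax ν) * (ENNReal.ofReal (ghost L k s ξ) * B ξ)) with hH
  have hHm : Measurable (Function.uncurry H) := by
    have h1 := measurable_res k
    have h2 := measurable_damp_zero ν k
    have h3 := measurable_ghost L k
    simp only [hH, Function.uncurry_def]
    refine h1.ennreal_ofReal.mul ((h2.ennreal_ofReal.mul (hma.comp measurable_snd)).add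
      ((h3.ennreal_ofReal.mul (hB.comp measurable_snd)).const_mul _))
  have hHm' : ∀ s, Measurable (H s) := fun s => hHm.of_uncurry_left
  have e1 : ∫⁻ s in Ioo 0 t,
        ∫⁻ η, (∫⁻ ξ, ENNReal.ofReal (res k s ξ) * ‖a s ξ‖ₑ * ‖χ (ξ + η)‖ₑ) ∂μ
      ≤ ∫⁻ s in Ioo 0 t, ∫⁻ ξ, ‖χ ξ‖ₑ * ∫⁻ η, H s (ξ - η) ∂μ := by
    refine setLIntegral_mono' measurableSet_Ioo fun s hs => ?_
    have := lintegral_lintegral_shift μ (F := fun ξ _ => H s ξ)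
      ((hHm' s).comp measurable_fst) (X := fun ξ => ‖χ ξ‖ₑ) (by fun_prop)
    rw [← this]
    refine lintegral_mono fun η => lintegral_mono_ae ?_
    filter_upwards [ha s ⟨hs.1.le, hs.2.le.trans ht.2⟩] with ξ hξ
    simp only [hH]
    gcongr
  have hHint : ∀ ζ, ∫⁻ s in Ioo 0 t, H s ζ ≤ ENNReal.ofReal (relax ν) * ‖a 0 ζ‖ₑ
      + ENNReal.ofReal (relax ν / L) * (ENNReal.ofReal (ghost L k t ζ) * B ζ) := by
    intro ζ
    have hd : Measurable fun s => damp ν k 0 s ζ := by unfold damp phase; fun_prop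
    have hr : Measurable fun s => res k s ζ := by unfold res; fun_prop
    have hg : Measurable fun s => ghost L k s ζ := by
      unfold ghost
      have := Real.continuous_arctan
      fun_prop
    -- In the term with a₀, `res` is bounded by 1 since `damp` is already integrable in time; in the
    -- other term `res` is kept, because it is what makes the weight integrable.
    have e3 : ∀ s, H s ζ ≤ ENNReal.ofReal (damp ν k 0 s ζ) * ‖a 0 ζ‖ₑ
        + ENNReal.ofReal (relax ν) * B ζ * ENNReal.ofReal (res k s ζ * ghost L k s ζ) := by
      intro s
      simp only [hH]
      rw [mul_add]
      refine add_le_add (mul_le_of_le_one_left' (ENNReal.ofReal_le_one.2 (res_le_one _ _ _)))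
        (le_of_eq ?_)
      rw [ENNReal.ofReal_mul (res_nonneg _ _ _)]
      ring
    refine (lintegral_mono e3).trans ?_
    rw [lintegral_add_left (by fun_prop), lintegral_mul_const _ (by fun_prop),
      lintegral_const_mul _ (by fun_prop)]
    refine add_le_add (by gcongr; exact lintegral_damp_zero_le hν hk ζ t) ?_
    calc _ ≤ ENNReal.ofReal (relax ν) * B ζ * ENNReal.ofReal (ghost L k t ζ / L) := by
          gcongr; exact lintegral_res_ghost_le hL hk ζ t
      _ = _ := by
          rw [ENNReal.ofReal_div_of_pos hL, ENNReal.ofReal_div_of_pos hL, ENNReal.div_eq_inv_mul,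
            ENNReal.div_eq_inv_mul]
          ring
  have e2 : ∫⁻ s in Ioo 0 t, ∫⁻ ξ, ‖χ ξ‖ₑ * ∫⁻ η, H s (ξ - η) ∂μ
      = ∫⁻ ξ, ‖χ ξ‖ₑ * ∫⁻ η, (∫⁻ s in Ioo 0 t, H s (ξ - η)) ∂μ := 
    lintegral_lintegral_lintegral_swap _ μ hHm (by fun_prop)
  rw [e2] at e1
  refine (add_le_add le_rfl e1).trans ?_
  rw [← lintegral_add_left (by fun_prop)]
  refine lintegral_mono fun ξ => ?_
  rw [← mul_add]
  gcongr ‖χ ξ‖ₑ * ?_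
  have hg1 : 1 ≤ ENNReal.ofReal (ghost L k t ξ) :=
    ENNReal.one_le_ofReal.2 (one_le_ghost hL.le k t ξ)
  rw [mul_add]
  refine add_le_add (le_mul_of_one_le_left' hg1) ?_
  calc ∫⁻ η, (∫⁻ s in Ioo 0 t, H s (ξ - η)) ∂μ
      ≤ ∫⁻ η, ENNReal.ofReal (ghost L k t ξ) * (ENNReal.ofReal (relax ν)
          * (S η * ‖a 0 (ξ - η)‖ₑ) + ENNReal.ofReal (relax ν / L) * (S η * B (ξ - η))) ∂μ := by
        refine lintegral_mono fun η => (hHint (ξ - η)).trans ?_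
        rw [mul_add]
        refine add_le_add ?_ ?_
        · refine le_trans ?_ (le_mul_of_one_le_left' hg1)
          gcongr
          exact le_mul_of_one_le_left' (hS1 η)
        · calc ENNReal.ofReal (relax ν / L) * (ENNReal.ofReal (ghost L k t (ξ - η)) * B (ξ - η))
              ≤ ENNReal.ofReal (relax ν / L)
                * ((S η * ENNReal.ofReal (ghost L k t ξ)) * B (ξ - η)) := by
                gcongr; exact hS t ξ η
            _ = _ := by ring
    _ = _ := by
        have hm1 : Measurable fun η => S η * ‖a 0 (ξ - η)‖ₑ :=
          hSm.mul (hma.comp (by fun_prop : Measurable fun η : ℝ => ξ - η))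
        have hm2 : Measurable fun η => S η * B (ξ - η) := by fun_prop
        have hm3 : Measurable fun η => ENNReal.ofReal (relax ν) * (S η * ‖a 0 (ξ - η)‖ₑ)
            + ENNReal.ofReal (relax ν / L) * (S η * B (ξ - η)) :=
          (hm1.const_mul _).add (hm2.const_mul _)
        rw [lintegral_const_mul _ hm3, lintegral_add_left (hm1.const_mul _),
          lintegral_const_mul _ hm1, lintegral_const_mul _ hm2]
        rfl

end IsModeSolution

end

/-! ### Iteration of majorants in weighted L² spaces. -/

section

theorem one_le_symRatio {V : ℝ → ℝ} (hV : ∀ ξ, 0 < V ξ) (ξ η : ℝ) : 1 ≤ symRatio V ξ η := by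
  rcases le_total (V ξ) (V (ξ + η)) with h | h
  · exact le_max_of_le_left ((one_le_div (hV _)).2 h)
  · exact le_max_of_le_right ((one_le_div (hV _)).2 h)

/-- The power ν^{1/3} in the smallness assumption exactly offsets the relaxation time, so q does not
depend on ν. -/
theorem relax_mul {ν : ℝ} (hν : 0 < ν) (K : ℝ) : relax ν * (K * ν ^ (1 / 3 : ℝ)) = 2.29 * K := by
  have : ν ^ (-(1 / 3) : ℝ) * ν ^ (1 / 3 : ℝ) = 1 := by
    rw [← Real.rpow_add hν]; norm_num
  unfold relax
  linear_combination 2.29 * K * this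

/-- The norm of `L²(V² dξ)`. -/
def wnorm (V : ℝ → ℝ) (G : ℝ → ℝ≥0∞) : ℝ≥0∞ :=
  eLpNorm (fun ξ => ENNReal.ofReal (V ξ) * G ξ) 2 volume

theorem wnorm_mono_ae {V : ℝ → ℝ} {F G : ℝ → ℝ≥0∞} (h : ∀ᵐ ξ, F ξ ≤ G ξ) :
    wnorm V F ≤ wnorm V G := by
  refine eLpNorm_mono_enorm_ae ?_
  filter_upwards [h] with ξ hξ
  simp only [enorm_eq_self]
  gcongr

theorem wnorm_const_mul {V : ℝ → ℝ} (hV : Measurable V) (c : ℝ≥0∞) {F : ℝ → ℝ≥0∞}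
    (hF : Measurable F) : wnorm V (fun ξ => c * F ξ) = c * wnorm V F := by
  unfold wnorm
  rw [← eLpNorm_const_mul c (by fun_prop)]
  congr 1
  ext ξ
  ring

theorem wnorm_add_le {V : ℝ → ℝ} (hV : Measurable V) {F G : ℝ → ℝ≥0∞}
    (hF : Measurable F) (hG : Measurable G) :
    wnorm V (fun ξ => F ξ + G ξ) ≤ wnorm V F + wnorm V G := by
  unfold wnorm
  simp only [mul_add]
  exact eLpNorm_add_le_two (by fun_prop) (by fun_prop)

theorem le_wnorm {V : ℝ → ℝ} (hV1 : ∀ ξ, 1 ≤ V ξ) (F : ℝ → ℝ≥0∞) :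
    eLpNorm F 2 volume ≤ wnorm V F :=
  eLpNorm_mono_ennreal fun ξ => le_mul_of_one_le_left' (ENNReal.one_le_ofReal.2 (hV1 ξ))

theorem wnorm_le_of_le {V : ℝ → ℝ} {R : ℝ} (hVR : ∀ ξ, V ξ ≤ R) {F : ℝ → ℝ≥0∞}
    (hF : Measurable F) : wnorm V F ≤ ENNReal.ofReal R * eLpNorm F 2 volume := by
  rw [← eLpNorm_const_mul _ hF]
  refine eLpNorm_mono_ennreal fun ξ => ?_
  gcongr
  exact hVR ξ

/-- Conditions under which the mode system is bounded in `L²(V² dξ)`: `S` controls the shifts of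
the weight `ghost`, and the `V`-weighted mass of `μ` is small compared with `ν^{1/3}`. -/
structure IsAdmissible (ν L K q : ℝ) (k : ℤ) (μ : Measure ℝ) (S : ℝ → ℝ≥0∞) (V : ℝ → ℝ) :
    Prop where
  hν : 0 < ν
  hL : 0 < L
  hK : 0 ≤ K
  hq0 : 0 ≤ q
  hq : q < 1
  hKq : 2.29 * K ≤ q * L
  hk : k ≠ 0
  hSm : Measurable S
  hS1 : ∀ η, 1 ≤ S η
  hS : ∀ t ξ η, ENNReal.ofReal (ghost L k t (ξ - η)) ≤ S η * ENNReal.ofReal (ghost L k t ξ)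
  hVm : Measurable V
  hV1 : ∀ ξ, 1 ≤ V ξ
  hVeven : ∀ ξ, V (-ξ) = V ξ
  hκ : ∀ ξ, ∫⁻ η, ENNReal.ofReal (symRatio V ξ η) * S η ∂μ ≤ ENNReal.ofReal (K * ν ^ (1 / 3 : ℝ))

namespace IsAdmissible

variable {ν L K q : ℝ} {k : ℤ} {μ : Measure ℝ} {S : ℝ → ℝ≥0∞} {V : ℝ → ℝ}
  {a b : ℝ → Lp ℂ 2 (volume : Measure ℝ)}

theorem lintegral_ne_top (h : IsAdmissible ν L K q k μ S V) : ∫⁻ η, S η ∂μ ≠ ⊤ := by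
  refine (lt_of_le_of_lt ?_ (ENNReal.ofReal_lt_top (r := K * ν ^ (1 / 3 : ℝ)))).ne
  refine le_trans (lintegral_mono fun η => ?_) (h.hκ 0)
  exact le_mul_of_one_le_left' (ENNReal.one_le_ofReal.2
    (one_le_symRatio (fun ξ => zero_lt_one.trans_le (h.hV1 ξ)) _ _))

theorem wnorm_lconv_le (h : IsAdmissible ν L K q k μ S V) [SFinite μ] {B : ℝ → ℝ≥0∞}
    (hB : Measurable B) :
    wnorm V (lconv μ S B) ≤ ENNReal.ofReal (K * ν ^ (1 / 3 : ℝ)) * wnorm V B :=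
  eLpNorm_mul_lconv_le μ h.hSm hB h.hVm (fun ξ => zero_lt_one.trans_le (h.hV1 ξ)) h.hVeven h.hκ

/-- The bound for the forcing of the majorant iteration. -/
theorem wnorm_forcing_le (h : IsAdmissible ν L K q k μ S V) [SFinite μ] {A B : ℝ → ℝ≥0∞}
    (hA : Measurable A) (hB : Measurable B) :
    wnorm V (fun ξ => B ξ + ENNReal.ofReal (relax ν) * lconv μ S A ξ)
      ≤ wnorm V B + ENNReal.ofReal (2.29 * K) * wnorm V A := by
  have hc := measurable_lconv μ h.hSm hA
  refine (wnorm_add_le h.hVm hB (hc.const_mul _)).trans ?_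
  rw [wnorm_const_mul h.hVm _ hc]
  refine add_le_add le_rfl ?_
  calc _ ≤ ENNReal.ofReal (relax ν) * (ENNReal.ofReal (K * ν ^ (1 / 3 : ℝ)) * wnorm V A) := by
        gcongr; exact h.wnorm_lconv_le hA
    _ = _ := by
        rw [← mul_assoc, ← ENNReal.ofReal_mul (relax_nonneg h.hν), relax_mul h.hν]

/-- The norms of the majorants obey x ↦ Q + qx, hence stay below Q/(1-q) + qⁿM. The bound R on V
makes M and Q finite, without which qⁿM need not tend to 0. -/
theorem exists_majorant_seq (h : IsAdmissible ν L K q k μ S V) [IsFiniteMeasure μ]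
    (hab : IsModeSolution ν k μ a b) {R : ℝ} (hVR : ∀ ξ, V ξ ≤ R) {τ : ℝ} (hτ : 0 ≤ τ) :
    ∃ M : ℝ≥0∞, M ≠ ⊤ ∧ ∀ n : ℕ, ∃ B : ℝ → ℝ≥0∞, Measurable B ∧ eLpNorm B 2 volume ≠ ⊤ ∧
      (∀ t ∈ Icc 0 τ, ∀ᵐ ξ, ‖b t ξ‖ₑ ≤ ENNReal.ofReal (ghost L k t ξ) * B ξ) ∧
      wnorm V B ≤ ENNReal.ofReal (1 / (1 - q)) * (wnorm V (fun ξ => ‖b 0 ξ‖ₑ)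
        + ENNReal.ofReal (2.29 * K) * wnorm V (fun ξ => ‖a 0 ξ‖ₑ)) + ENNReal.ofReal q ^ n * M := by
  obtain ⟨B₀, hB₀m, hB₀2, hB₀⟩ := hab.exists_majorant h.hL.le hτ
  have hma := measurable_enorm_coe (a 0)
  have hmb := measurable_enorm_coe (b 0)
  have hfin : ∀ {F : ℝ → ℝ≥0∞}, Measurable F → eLpNorm F 2 volume ≠ ⊤ → wnorm V F ≠ ⊤ := by
    intro F hF hF2
    exact ((wnorm_le_of_le hVR hF).trans_lt (ENNReal.mul_lt_top ENNReal.ofReal_lt_top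
      (lt_top_iff_ne_top.2 hF2))).ne
  set Q : ℝ≥0∞ := wnorm V (fun ξ => ‖b 0 ξ‖ₑ)
        + ENNReal.ofReal (2.29 * K) * wnorm V (fun ξ => ‖a 0 ξ‖ₑ) with hQ
  have hQtop : Q ≠ ⊤ := by
    refine ENNReal.add_ne_top.2 ⟨hfin hmb ?_, ENNReal.mul_ne_top ENNReal.ofReal_ne_top
      (hfin hma ?_)⟩ <;>
    · rw [eLpNorm_enorm]; exact Lp.eLpNorm_ne_top _
  refine ⟨wnorm V B₀, hfin hB₀m hB₀2, fun n => ?_⟩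
  induction n with
  | zero => exact ⟨B₀, hB₀m, hB₀2, hB₀, by simp⟩
  | succ n ih =>
    obtain ⟨B, hBm, hB2, hB, hBn⟩ := ih
    have hca := measurable_lconv μ h.hSm hma
    have hcB := measurable_lconv μ h.hSm hBm
    have hmF : Measurable fun ξ => ‖b 0 ξ‖ₑ
        + ENNReal.ofReal (relax ν) * lconv μ S (fun ξ => ‖a 0 ξ‖ₑ) ξ := hmb.add (hca.const_mul _)
    have hle : wnorm V (fun ξ => (‖b 0 ξ‖ₑ
        + ENNReal.ofReal (relax ν) * lconv μ S (fun ξ => ‖a 0 ξ‖ₑ) ξ)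
          + ENNReal.ofReal (relax ν / L) * lconv μ S B ξ) ≤ Q + ENNReal.ofReal q * wnorm V B := by
      refine (wnorm_add_le h.hVm hmF (hcB.const_mul _)).trans
        (add_le_add (h.wnorm_forcing_le hma hmb) ?_)
      rw [wnorm_const_mul h.hVm _ hcB]
      calc _ ≤ ENNReal.ofReal (relax ν / L)
            * (ENNReal.ofReal (K * ν ^ (1 / 3 : ℝ)) * wnorm V B) := by
            gcongr; exact h.wnorm_lconv_le hBm
        _ = ENNReal.ofReal (2.29 * K / L) * wnorm V B := by
            rw [← mul_assoc, ← ENNReal.ofReal_mul (div_nonneg (relax_nonneg h.hν) h.hL.le),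
              div_mul_eq_mul_div, relax_mul h.hν]
        _ ≤ _ := by
            gcongr
            exact (div_le_iff₀ h.hL).2 h.hKq
    refine ⟨fun ξ => (‖b 0 ξ‖ₑ + ENNReal.ofReal (relax ν) * lconv μ S (fun ξ => ‖a 0 ξ‖ₑ) ξ)
          + ENNReal.ofReal (relax ν / L) * lconv μ S B ξ, hmF.add (hcB.const_mul _), ?_, ?_, ?_⟩
    · refine ((le_wnorm h.hV1 _).trans_lt (hle.trans_lt ?_)).ne
      exact ENNReal.add_lt_top.2 ⟨lt_top_iff_ne_top.2 hQtop,
        ENNReal.mul_lt_top ENNReal.ofReal_lt_top (lt_top_iff_ne_top.2 (hfin hBm hB2))⟩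
    · have h1 := hab.enorm_a_le h.hν h.hL h.hk hBm hB2 hB
      have h2 := hab.enorm_b_le h.hν h.hL h.hk h.hSm h.hS1 h.lintegral_ne_top h.hS hBm hB2 h1
      simpa only [add_assoc] using h2
    · refine hle.trans ?_
      -- Geometric recursion: 1 + q/(1-q) = 1/(1-q).
      have hq1 : (0 : ℝ) < 1 - q := by linarith [h.hq]
      calc Q + ENNReal.ofReal q * wnorm V B
          ≤ Q + ENNReal.ofReal q * (ENNReal.ofReal (1 / (1 - q)) * Q
            + ENNReal.ofReal q ^ n * wnorm V B₀) := by gcongr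
        _ = (ENNReal.ofReal 1 + ENNReal.ofReal q * ENNReal.ofReal (1 / (1 - q))) * Q
            + ENNReal.ofReal q ^ (n + 1) * wnorm V B₀ := by
            rw [ENNReal.ofReal_one]; ring
        _ = _ := by
            rw [← ENNReal.ofReal_mul h.hq0, ← ENNReal.ofReal_add zero_le_one
              (mul_nonneg h.hq0 (by positivity))]
            congr 3
            field_simp
            ring

/-- Each majorant bounds the same b(t), so n → ∞ removes the term with M. The bound on a follows
from `enorm_a_le` applied with the same majorants. -/
theorem bound_of_bounded (h : IsAdmissible ν L K q k μ S V) [IsFiniteMeasure μ]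
    (hab : IsModeSolution ν k μ a b) {R : ℝ} (hVR : ∀ ξ, V ξ ≤ R) {t : ℝ} (ht : 0 ≤ t) :
    wnorm V (fun ξ => ‖b t ξ‖ₑ) ≤ ENNReal.ofReal (Real.exp (L * π)) *
      (ENNReal.ofReal (1 / (1 - q)) * (wnorm V (fun ξ => ‖b 0 ξ‖ₑ)
        + ENNReal.ofReal (2.29 * K) * wnorm V (fun ξ => ‖a 0 ξ‖ₑ))) ∧
    wnorm V (fun ξ => ‖a t ξ‖ₑ) ≤ wnorm V (fun ξ => ‖a 0 ξ‖ₑ)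
      + ENNReal.ofReal (relax ν) * (ENNReal.ofReal (Real.exp (L * π)) *
      (ENNReal.ofReal (1 / (1 - q)) * (wnorm V (fun ξ => ‖b 0 ξ‖ₑ)
        + ENNReal.ofReal (2.29 * K) * wnorm V (fun ξ => ‖a 0 ξ‖ₑ)))) := by
  obtain ⟨M, hM, hseq⟩ := h.exists_majorant_seq hab hVR ht
  have hma := measurable_enorm_coe (a 0)
  set Q := ENNReal.ofReal (1 / (1 - q)) * (wnorm V (fun ξ => ‖b 0 ξ‖ₑ)
        + ENNReal.ofReal (2.29 * K) * wnorm V (fun ξ => ‖a 0 ξ‖ₑ)) with hQ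
  have hlim : Tendsto (fun n : ℕ => Q + ENNReal.ofReal q ^ n * M) atTop (𝓝 Q) := by
    have h1 : Tendsto (fun n : ℕ => ENNReal.ofReal q ^ n * M) atTop (𝓝 (0 * M)) :=
      ENNReal.Tendsto.mul_const (ENNReal.tendsto_pow_atTop_nhds_zero_of_lt_one
        (by simpa using h.hq)) (Or.inr hM)
    simpa using h1.const_add Q
  have hg : ∀ ξ, ENNReal.ofReal (ghost L k t ξ) ≤ ENNReal.ofReal (Real.exp (L * π)) :=
    fun ξ => ENNReal.ofReal_le_ofReal (ghost_le h.hL.le k t ξ)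
  have htt : t ∈ Icc 0 t := ⟨ht, le_rfl⟩
  constructor
  · refine ge_of_tendsto (ENNReal.Tendsto.const_mul hlim (Or.inr ENNReal.ofReal_ne_top))
      (Eventually.of_forall fun n => ?_)
    obtain ⟨B, hBm, hB2, hB, hBn⟩ := hseq n
    calc wnorm V (fun ξ => ‖b t ξ‖ₑ)
        ≤ wnorm V (fun ξ => ENNReal.ofReal (Real.exp (L * π)) * B ξ) := by
          refine wnorm_mono_ae ?_
          filter_upwards [hB t htt] with ξ hξ
          exact hξ.trans (mul_le_mul_left (hg ξ) _)
      _ ≤ _ := by rw [wnorm_const_mul h.hVm _ hBm]; gcongr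
  · refine ge_of_tendsto ((ENNReal.Tendsto.const_mul (ENNReal.Tendsto.const_mul hlim
      (Or.inr ENNReal.ofReal_ne_top)) (Or.inr ENNReal.ofReal_ne_top)).const_add _)
      (Eventually.of_forall fun n => ?_)
    obtain ⟨B, hBm, hB2, hB, hBn⟩ := hseq n
    calc wnorm V (fun ξ => ‖a t ξ‖ₑ)
        ≤ wnorm V (fun ξ => ‖a 0 ξ‖ₑ + ENNReal.ofReal (relax ν)
          * (ENNReal.ofReal (Real.exp (L * π)) * B ξ)) := by
          refine wnorm_mono_ae ?_
          filter_upwards [hab.enorm_a_le h.hν h.hL h.hk hBm hB2 hB t htt] with ξ hξ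
          refine hξ.trans (add_le_add (ofReal_damp_mul_le h.hν k ht ξ _) ?_)
          gcongr
          exact ghost_le h.hL.le k t ξ
      _ ≤ _ := by
          refine (wnorm_add_le h.hVm hma ((hBm.const_mul _).const_mul _)).trans ?_
          rw [wnorm_const_mul h.hVm _ (hBm.const_mul _), wnorm_const_mul h.hVm _ hBm]
          gcongr

/-- Cutting V off at R ≥ 1 does not increase `symRatio`: truncation moves a quotient towards 1, and
`symRatio` is at least 1. -/
theorem truncate (h : IsAdmissible ν L K q k μ S V) {R : ℝ} (hR : 1 ≤ R) :
    IsAdmissible ν L K q k μ S (fun ξ => min (V ξ) R) where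
  hν := h.hν
  hL := h.hL
  hK := h.hK
  hq0 := h.hq0
  hq := h.hq
  hKq := h.hKq
  hk := h.hk
  hSm := h.hSm
  hS1 := h.hS1
  hS := h.hS
  hVm := h.hVm.min measurable_const
  hV1 := fun ξ => le_min (h.hV1 ξ) hR
  hVeven := fun ξ => by rw [h.hVeven]
  hκ := fun ξ => by
    refine le_trans (lintegral_mono fun η => ?_) (h.hκ ξ)
    gcongr
    have hpos : ∀ ξ, 0 < V ξ := fun ξ => zero_lt_one.trans_le (h.hV1 ξ)
    have key : ∀ x y : ℝ, 0 < x → 0 < y → min x R / min y R ≤ max (x / y) 1 := by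
      intro x y hx hy
      have hR0 : 0 < R := zero_lt_one.trans_le hR
      rw [div_le_iff₀ (lt_min hy hR0)]
      rcases le_total y R with hyR | hyR
      · rw [min_eq_left hyR]
        calc min x R ≤ x / y * y := by rw [div_mul_cancel₀ _ hy.ne']; exact min_le_left _ _
          _ ≤ _ := by gcongr; exact le_max_left _ _
      · rw [min_eq_right hyR]
        calc min x R ≤ 1 * R := by rw [one_mul]; exact min_le_right _ _
          _ ≤ _ := by gcongr; exact le_max_right _ _
    have h1 := one_le_symRatio hpos ξ η
    refine max_le ((key _ _ (hpos _) (hpos _)).trans (max_le (le_max_left _ _) h1))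
      ((key _ _ (hpos _) (hpos _)).trans (max_le (le_max_right _ _) h1))

end IsAdmissible

/-- Fatou's lemma as the truncation level tends to infinity. -/
theorem wnorm_le_of_forall_truncate {V : ℝ → ℝ} (hV : Measurable V) {G : ℝ → ℝ≥0∞}
    (hG : Measurable G) {M : ℝ≥0∞}
    (h : ∀ n : ℕ, wnorm (fun ξ => min (V ξ) (n + 1)) G ≤ M) : wnorm V G ≤ M := by
  refine (ENNReal.pow_le_pow_left_iff (n := 2) (by norm_num)).1 ?_
  have e : ∀ W : ℝ → ℝ, wnorm W G ^ 2 = ∫⁻ ξ, (ENNReal.ofReal (W ξ) * G ξ) ^ 2 := fun W => by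
    rw [wnorm, eLpNorm_two_sq]; rfl
  have hlim : ∀ ξ, (ENNReal.ofReal (V ξ) * G ξ) ^ 2
      ≤ liminf (fun n : ℕ => (ENNReal.ofReal (min (V ξ) (n + 1)) * G ξ) ^ 2) atTop := by
    intro ξ
    refine le_liminf_of_le (by isBoundedDefault) ?_
    obtain ⟨N, hN⟩ := exists_nat_ge (V ξ)
    filter_upwards [eventually_ge_atTop N] with n hn
    have : V ξ ≤ n + 1 := hN.trans (by have : (N : ℝ) ≤ n := by exact_mod_cast hn
                                       linarith)
    rw [min_eq_left this]
  rw [e]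
  refine (lintegral_mono hlim).trans ((lintegral_liminf_le fun n => ?_).trans ?_)
  · have : Measurable fun ξ => min (V ξ) ((n : ℝ) + 1) := hV.min measurable_const
    fun_prop
  · refine liminf_le_of_le (by isBoundedDefault) fun c hc => ?_
    obtain ⟨n, hn⟩ := hc.exists
    refine hn.trans ?_
    rw [← e (fun ξ => min (V ξ) (n + 1))]
    gcongr
    exact h n

theorem wnorm_truncate_le (V : ℝ → ℝ) (R : ℝ) (G : ℝ → ℝ≥0∞) :
    wnorm (fun ξ => min (V ξ) R) G ≤ wnorm V G := by
  refine eLpNorm_mono_ennreal fun ξ => ?_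
  gcongr
  exact min_le_left _ _

namespace IsAdmissible

variable {ν L K q : ℝ} {k : ℤ} {μ : Measure ℝ} {S : ℝ → ℝ≥0∞} {V : ℝ → ℝ}
  {a b : ℝ → Lp ℂ 2 (volume : Measure ℝ)}

theorem bound (h : IsAdmissible ν L K q k μ S V) [IsFiniteMeasure μ]
    (hab : IsModeSolution ν k μ a b) {t : ℝ} (ht : 0 ≤ t) :
    wnorm V (fun ξ => ‖b t ξ‖ₑ) ≤ ENNReal.ofReal (Real.exp (L * π)) *
      (ENNReal.ofReal (1 / (1 - q)) * (wnorm V (fun ξ => ‖b 0 ξ‖ₑ)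
        + ENNReal.ofReal (2.29 * K) * wnorm V (fun ξ => ‖a 0 ξ‖ₑ))) ∧
    wnorm V (fun ξ => ‖a t ξ‖ₑ) ≤ wnorm V (fun ξ => ‖a 0 ξ‖ₑ)
      + ENNReal.ofReal (relax ν) * (ENNReal.ofReal (Real.exp (L * π)) *
      (ENNReal.ofReal (1 / (1 - q)) * (wnorm V (fun ξ => ‖b 0 ξ‖ₑ)
        + ENNReal.ofReal (2.29 * K) * wnorm V (fun ξ => ‖a 0 ξ‖ₑ)))) := by
  constructor
  · refine wnorm_le_of_forall_truncate h.hVm (measurable_enorm_coe _) fun n => ?_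
    refine ((h.truncate (by simp : (1 : ℝ) ≤ n + 1)).bound_of_bounded hab
      (fun ξ => min_le_right _ _) ht).1.trans ?_
    gcongr <;> exact wnorm_truncate_le V _ _
  · refine wnorm_le_of_forall_truncate h.hVm (measurable_enorm_coe _) fun n => ?_
    refine ((h.truncate (by simp : (1 : ℝ) ≤ n + 1)).bound_of_bounded hab
      (fun ξ => min_le_right _ _) ht).2.trans ?_
    gcongr <;> exact wnorm_truncate_le V _ _

/-- The constant in the energy bound. -/
theorem sq_bound (h : IsAdmissible ν L K q k μ S V) [IsFiniteMeasure μ]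
    (hab : IsModeSolution ν k μ a b) {t : ℝ} (ht : 0 ≤ t) :
    wnorm V (fun ξ => ‖a t ξ‖ₑ) ^ 2 + wnorm V (fun ξ => ‖b t ξ‖ₑ) ^ 2
      ≤ ENNReal.ofReal (68 * (Real.exp (L * π) * (1 / (1 - q)) * (1 + 2.29 * K)) ^ 2
          * (1 + ν ^ (-(2 / 3) : ℝ)) ^ 2)
        * (wnorm V (fun ξ => ‖a 0 ξ‖ₑ) ^ 2 + wnorm V (fun ξ => ‖b 0 ξ‖ₑ) ^ 2) := by
  obtain ⟨hb, ha⟩ := h.bound hab ht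
  set x := wnorm V (fun ξ => ‖a 0 ξ‖ₑ) with hx
  set y := wnorm V (fun ξ => ‖b 0 ξ‖ₑ) with hy
  set A : ℝ := Real.exp (L * π) * (1 / (1 - q)) * (1 + 2.29 * K) with hA
  have hq1 : (0 : ℝ) < 1 - q := by linarith [h.hq]
  have hK := h.hK
  have hL := h.hL
  have hν := h.hν
  have hA1 : 1 ≤ A := by
    have h1 : 1 ≤ Real.exp (L * π) := Real.one_le_exp (by positivity)
    have h2 : 1 ≤ 1 / (1 - q) := (one_le_div hq1).2 (by linarith [h.hq0])
    have h3 : 1 ≤ 1 + 2.29 * K := by nlinarith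
    exact one_le_mul_of_one_le_of_one_le (one_le_mul_of_one_le_of_one_le h1 h2) h3
  -- With r = ν^{-1/3}, the growth of a is 1 + 2.29 r A ≤ 4A(1+r), while the theorem is stated with
  -- 1 + r².
  set r : ℝ := ν ^ (-(1 / 3) : ℝ) with hr
  have hr0 : 0 ≤ r := by positivity
  have hr2 : ν ^ (-(2 / 3) : ℝ) = r ^ 2 := by
    rw [hr, ← Real.rpow_natCast, ← Real.rpow_mul hν.le]; norm_num
  have hQ : ENNReal.ofReal (Real.exp (L * π)) * (ENNReal.ofReal (1 / (1 - q))
      * (y + ENNReal.ofReal (2.29 * K) * x)) ≤ ENNReal.ofReal A * (x + y) := by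
    have hA2 : ENNReal.ofReal A = ENNReal.ofReal (Real.exp (L * π)) * ENNReal.ofReal (1 / (1 - q))
        * ENNReal.ofReal (1 + 2.29 * K) := by
      rw [hA, ENNReal.ofReal_mul (by positivity), ENNReal.ofReal_mul (by positivity)]
    rw [hA2, mul_assoc, mul_assoc]
    refine mul_le_mul' le_rfl (mul_le_mul' le_rfl ?_)
    rw [ENNReal.ofReal_add zero_le_one (by positivity), ENNReal.ofReal_one, add_mul, one_mul,
      mul_add (ENNReal.ofReal (2.29 * K))]
    calc y + ENNReal.ofReal (2.29 * K) * x ≤ x + y + ENNReal.ofReal (2.29 * K) * x :=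
          add_le_add_left le_add_self _
      _ ≤ x + y + (ENNReal.ofReal (2.29 * K) * x + ENNReal.ofReal (2.29 * K) * y) :=
          add_le_add_right le_self_add _
  have hb' : wnorm V (fun ξ => ‖b t ξ‖ₑ) ≤ ENNReal.ofReal A * (x + y) := hb.trans hQ
  have ha' : wnorm V (fun ξ => ‖a t ξ‖ₑ) ≤ ENNReal.ofReal (4 * A * (1 + r)) * (x + y) := by
    calc _ ≤ x + ENNReal.ofReal (relax ν) * (ENNReal.ofReal A * (x + y)) :=
          ha.trans (by gcongr)
      _ ≤ ENNReal.ofReal 1 * (x + y) + ENNReal.ofReal (relax ν) * (ENNReal.ofReal A * (x + y)) := by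
          rw [ENNReal.ofReal_one, one_mul]; gcongr; exact le_self_add
      _ = ENNReal.ofReal (1 + relax ν * A) * (x + y) := by
          rw [ENNReal.ofReal_add zero_le_one (mul_nonneg (relax_nonneg hν) (by linarith)),
            ENNReal.ofReal_mul (relax_nonneg hν)]
          ring
      _ ≤ _ := by
          gcongr
          rw [relax, ← hr]
          nlinarith [mul_nonneg hr0 (by linarith : (0 : ℝ) ≤ A)]
  have hxy : (x + y) ^ 2 ≤ 2 * (x ^ 2 + y ^ 2) := by
    have := ENNReal.rpow_add_le_mul_rpow_add_rpow x y (p := 2) (by norm_num)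
    norm_num at this
    exact this
  calc _ ≤ (ENNReal.ofReal (4 * A * (1 + r)) * (x + y)) ^ 2 + (ENNReal.ofReal A * (x + y)) ^ 2 := by
        gcongr
    _ = ENNReal.ofReal ((4 * A * (1 + r)) ^ 2 + A ^ 2) * (x + y) ^ 2 := by
        rw [ENNReal.ofReal_add (by positivity) (by positivity), ENNReal.ofReal_pow (by positivity),
          ENNReal.ofReal_pow (by positivity)]
        ring
    _ ≤ ENNReal.ofReal ((4 * A * (1 + r)) ^ 2 + A ^ 2) * (ENNReal.ofReal 2 * (x ^ 2 + y ^ 2)) := by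
        gcongr
        simpa using hxy
    _ ≤ _ := by
        rw [← mul_assoc, ← ENNReal.ofReal_mul (by positivity)]
        refine mul_le_mul_left (ENNReal.ofReal_le_ofReal ?_) _
        rw [hr2]
        have h1 : (1 + r) ^ 2 ≤ 2 * (1 + r ^ 2) := by nlinarith [sq_nonneg (1 - r)]
        have h2 : 1 + r ^ 2 ≤ (1 + r ^ 2) ^ 2 := by nlinarith [sq_nonneg r]
        have h3 : 1 ≤ (1 + r ^ 2) ^ 2 := by nlinarith [sq_nonneg r]
        -- 16(1+r)² + 1 ≤ 33(1+r²)²; the factor 2 from (x+y)² ≤ 2(x²+y²) then gives 66 ≤ 68.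
        have h4 : (4 * A * (1 + r)) ^ 2 + A ^ 2 ≤ A ^ 2 * (33 * (1 + r ^ 2) ^ 2) := by
          nlinarith [sq_nonneg A]
        nlinarith [sq_nonneg A, mul_nonneg (sq_nonneg A) (sq_nonneg (1 + r ^ 2))]

end IsAdmissible

end

/-! ### The Fourier transform of bump functions, with phase `e^{-iξy}` -/

/-- `∫ χ(ξ) e^{-iξy} dξ`. -/
def xft (χ : ℝ → ℂ) (y : ℝ) : ℂ := ∫ ξ : ℝ, Complex.exp (-(Complex.I * ξ * y)) * χ ξ

/-- Change of variable ξ = 2πη between the phases e^{-iξy} and e^{-2πiηy}; it makes the calculus of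
`𝓕` on Schwartz functions available for `xft`. -/
theorem xft_eq_fourier (χ : ℝ → ℂ) :
    xft χ = 𝓕 (fun η : ℝ => (2 * π : ℂ) * χ (2 * π * η)) := by
  ext y
  have h := Measure.integral_comp_mul_left
    (fun ξ : ℝ => (2 * π : ℂ) * (Complex.exp (-(Complex.I * ξ * y)) * χ ξ)) (2 * π)
  rw [Real.fourier_real_eq_integral_exp_smul]
  have h2 : xft χ y = |(2 * π)⁻¹| • ∫ ξ : ℝ,
      (2 * π : ℂ) * (Complex.exp (-(Complex.I * ξ * y)) * χ ξ) := by
    rw [integral_const_mul, abs_of_pos (by positivity), Complex.real_smul, xft, ← mul_assoc]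
    have : (((2 * π)⁻¹ : ℝ) : ℂ) * (2 * π) = 1 := by
      push_cast; field_simp
    rw [this, one_mul]
  rw [h2, ← h]
  refine integral_congr_ae (Eventually.of_forall fun η => ?_)
  simp only [smul_eq_mul]
  rw [mul_left_comm]
  congr 2
  push_cast
  ring_nf

theorem IsBump.comp_mul {χ : ℝ → ℂ} (h : IsBump χ) {c : ℝ} (hc : c ≠ 0) :
    IsBump (fun η => (c : ℂ) * χ (c * η)) := by
  refine ⟨contDiff_const.mul (h.smooth.comp (contDiff_const.mul contDiff_id)), ?_⟩
  exact (h.compact.comp_homeomorph (Homeomorph.mulLeft₀ c hc)).mul_left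

theorem IsBump.comp_add {χ : ℝ → ℂ} (h : IsBump χ) (c : ℝ) : IsBump (fun ξ => χ (ξ + c)) :=
  ⟨h.smooth.comp (contDiff_id.add contDiff_const), h.compact.comp_homeomorph (Homeomorph.addRight c)⟩

theorem IsBump.exists_schwartz {χ : ℝ → ℂ} (h : IsBump χ) :
    ∃ f : SchwartzMap ℝ ℂ, (∀ η, f η = (2 * π : ℂ) * χ (2 * π * η)) ∧ ∀ y, 𝓕 f y = xft χ y := by
  have hb := h.comp_mul (c := 2 * π) (by positivity)
  refine ⟨hb.compact.toSchwartzMap hb.smooth, fun η => ?_, fun y => ?_⟩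
  · simp
  · rw [xft_eq_fourier, SchwartzMap.fourier_coe]
    refine congrArg (fun F : ℝ → ℂ => 𝓕 F y) (funext fun η => ?_)
    simp

theorem IsBump.memLp_xft {χ : ℝ → ℂ} (h : IsBump χ) : MemLp (xft χ) 2 (volume : Measure ℝ) := by
  obtain ⟨f, -, hf⟩ := h.exists_schwartz
  have := (𝓕 f).memLp 2 (volume : Measure ℝ)
  convert! this using 1
  ext y
  exact (hf y).symm

theorem IsBump.hasDerivAt_xft {χ : ℝ → ℂ} (h : IsBump χ) (y : ℝ) :
    HasDerivAt (xft χ) (xft (fun ξ => -(Complex.I * ξ) * χ ξ) y) y := by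
  have hb := h.comp_mul (c := 2 * π) (by positivity)
  have hi : Integrable (fun η : ℝ => ((2 * π : ℝ) : ℂ) * χ (2 * π * η)) :=
    hb.smooth.continuous.integrable_of_hasCompactSupport hb.compact
  have hi' : Integrable (fun η : ℝ => η • (((2 * π : ℝ) : ℂ) * χ (2 * π * η))) :=
    (continuous_id.smul hb.smooth.continuous).integrable_of_hasCompactSupport hb.compact.smul_left
  have := Real.hasDerivAt_fourier hi hi' y
  rw [xft_eq_fourier, xft_eq_fourier]
  convert! this using 1
  · ext; push_cast; rfl
  · refine congrArg (fun F : ℝ → ℂ => 𝓕 F y) (funext fun η => ?_)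
    push_cast
    simp only [smul_eq_mul]
    ring

/-- Modulation becomes translation of the bump function. This is how multiplication by T' turns into
a convolution in ξ. -/
theorem exp_mul_xft (χ : ℝ → ℂ) (η y : ℝ) :
    Complex.exp (Complex.I * η * y) * xft χ y = xft (fun ξ => χ (ξ + η)) y := by
  have h := integral_add_right_eq_self (μ := (volume : Measure ℝ))
    (fun ξ : ℝ => Complex.exp (-(Complex.I * (ξ - η : ℝ) * y)) * χ ξ) η
  simp only [add_sub_cancel_right] at h
  rw [xft, xft, h, ← integral_const_mul]
  refine integral_congr_ae (Eventually.of_forall fun ξ => ?_)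
  simp only
  rw [← mul_assoc, ← Complex.exp_add]
  congr 2
  push_cast
  ring

/-- The transform `f ↦ f̂(ξ / 2π)` of `L²(ℝ)` is dual to `xft`. -/
theorem integral_fourier_mul_bump (f : Lp ℂ 2 (volume : Measure ℝ)) {χ : ℝ → ℂ} (h : IsBump χ) :
    ∫ ξ, (𝓕 f : Lp ℂ 2 (volume : Measure ℝ)) (ξ / (2 * π)) * χ ξ = ∫ y, f y * xft χ y := by
  obtain ⟨g, hg, hgx⟩ := h.exists_schwartz
  have h1 := congrArg (fun L => L g) (Lp.fourier_toTemperedDistribution_eq f)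
  simp only [TemperedDistribution.fourier_apply, Lp.toTemperedDistribution_apply, smul_eq_mul,
    hgx, hg] at h1
  have h2 := Measure.integral_comp_mul_left
    (fun ξ : ℝ => (𝓕 f : Lp ℂ 2 (volume : Measure ℝ)) (ξ / (2 * π)) * χ ξ) (2 * π)
  rw [abs_of_pos (by positivity), Complex.real_smul] at h2
  have h3 : (2 * π : ℂ) * (((2 * π)⁻¹ : ℝ) : ℂ) = 1 := by
    push_cast; field_simp
  rw [← one_mul (∫ ξ, _), ← h3, mul_assoc, ← h2, ← integral_const_mul]
  calc _ = ∫ x, (2 * π * χ (2 * π * x)) * (𝓕 f : Lp ℂ 2 (volume : Measure ℝ)) x := by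
        refine integral_congr_ae (Eventually.of_forall fun η => ?_)
        have : 2 * π * η / (2 * π) = η := by field_simp
        simp only [this]
        ring
    _ = _ := by
        rw [← h1]
        exact integral_congr_ae (Eventually.of_forall fun η => mul_comm _ _)

/-! ### Fourier modes of functions on `𝕋 × ℝ` -/

theorem lintegral_dom {F : Dom → ℝ≥0∞} (hF : Measurable F) :
    ∫⁻ p, F p = ENNReal.ofReal (2 * π) * ∫⁻ y : ℝ, ∫⁻ x, F (x, y) ∂AddCircle.haarAddCircle := by
  have hprod := lintegral_prod_symm (μ := (volume : Measure (AddCircle (2 * π))))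
    (ν := (volume : Measure ℝ)) _ hF.aemeasurable
  refine Eq.trans hprod ?_
  rw [← lintegral_const_mul' _ _ ENNReal.ofReal_ne_top]
  refine lintegral_congr fun y => ?_
  rw [AddCircle.volume_eq_smul_haarAddCircle, lintegral_smul_measure, smul_eq_mul]

theorem integral_dom {F : Dom → ℂ} (hF : Integrable F) :
    ∫ p, F p = (2 * π : ℂ) * ∫ y : ℝ, ∫ x, F (x, y) ∂AddCircle.haarAddCircle := by
  have hprod := integral_prod_symm (μ := (volume : Measure (AddCircle (2 * π))))
    (ν := (volume : Measure ℝ)) F hF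
  refine Eq.trans hprod ?_
  rw [← integral_const_mul]
  refine integral_congr_ae (Eventually.of_forall fun y => ?_)
  simp only
  rw [AddCircle.volume_eq_smul_haarAddCircle, integral_smul_measure,
    ENNReal.toReal_ofReal (by positivity), Complex.real_smul]
  push_cast
  rfl

theorem memLp_ofReal (u : L2) : MemLp (fun p => ((u p : ℝ) : ℂ)) 2 (volume : Measure Dom) :=
  (Lp.memLp u).ofReal

theorem norm_fourier_apply {T : ℝ} [Fact (0 < T)] (k : ℤ) (x : AddCircle T) :
    ‖(fourier k x : ℂ)‖ = 1 := by
  rw [fourier_apply, Circle.norm_coe]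

/-- The function `e^{-ikx} Y(y)`. -/
def wave (k : ℤ) (Y : ℝ → ℂ) (p : Dom) : ℂ := fourier (-k) p.1 * Y p.2

theorem memLp_wave (k : ℤ) {Y : ℝ → ℂ} (hY : MemLp Y 2 volume) :
    MemLp (wave k Y) 2 (volume : Measure Dom) := by
  have h1 : MemLp (fun p : Dom => Y p.2) 2 (volume : Measure Dom) :=
    hY.comp_snd (volume : Measure (AddCircle (2 * π)))
  have hc : Continuous (fun p : Dom => (fourier (-k) p.1 : ℂ)) :=
    (map_continuous (fourier (T := 2 * π) (-k))).comp continuous_fst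
  refine h1.of_le (hc.aestronglyMeasurable.mul h1.1) (Eventually.of_forall fun p => ?_)
  rw [wave, norm_mul, norm_fourier_apply, one_mul]

theorem integral_mul_wave (u : L2) (k : ℤ) {Y : ℝ → ℂ} (hY : MemLp Y 2 volume) :
    ∫ p, ((u p : ℝ) : ℂ) * wave k Y p = (2 * π : ℂ) * ∫ y, xMode u k y * Y y := by
  rw [integral_dom (integrable_mul_of_memLp (memLp_ofReal u) (memLp_wave k hY))]
  congr 1
  refine integral_congr_ae (Eventually.of_forall fun y => ?_)
  simp only [xMode, fourierCoeff, wave]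
  rw [← integral_mul_const]
  refine integral_congr_ae (Eventually.of_forall fun x => ?_)
  simp only [smul_eq_mul]
  ring

theorem integral_mul_wave_xft (u : L2) (k : ℤ) {χ : ℝ → ℂ} (hχ : IsBump χ) :
    ∫ p, ((u p : ℝ) : ℂ) * wave k (xft χ) p = (2 * π : ℂ) * ∫ ξ, fourierTR u k ξ * χ ξ := by
  rw [integral_mul_wave u k hχ.memLp_xft]
  congr 1
  simp only [fourierTR]
  rw [integral_fourier_mul_bump _ hχ]
  refine integral_congr_ae ?_
  filter_upwards [(memLp_xMode u k).coeFn_toLp] with y hy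
  rw [hy]

theorem lintegral_comp_div {F : ℝ → ℝ≥0∞} (hF : Measurable F) {c : ℝ} (hc : 0 < c) :
    ∫⁻ x, F (x / c) = ENNReal.ofReal c * ∫⁻ x, F x := by
  have hm : Measurable (fun x : ℝ => F (x / c)) := by fun_prop
  conv_lhs => rw [← Real.smul_map_volume_mul_left hc.ne']
  rw [lintegral_smul_measure, lintegral_map hm (by fun_prop), abs_of_pos hc, smul_eq_mul]
  congr 1
  refine lintegral_congr fun x => ?_
  congr 1
  field_simp

theorem measurable_fourierTR (u : L2) (k : ℤ) : Measurable (fourierTR u k) := by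
  have h : Measurable ((𝓕 ((memLp_xMode u k).toLp (xMode u k)) : Lp ℂ 2 (volume : Measure ℝ))) :=
    (Lp.stronglyMeasurable _).measurable
  unfold fourierTR
  fun_prop

/-- The factor 2π from ξ = 2πη is the same 2π that relates Lebesgue and Haar measure on the circle,
so Plancherel on 𝕋 × ℝ holds without constants. -/
theorem lintegral_fourierTR (u : L2) (k : ℤ) :
    ∫⁻ ξ, ‖fourierTR u k ξ‖ₑ ^ 2 = ENNReal.ofReal (2 * π) * ∫⁻ y, ‖xMode u k y‖ₑ ^ 2 := by
  set f := (memLp_xMode u k).toLp (xMode u k) with hf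
  have h : Measurable ((𝓕 f : Lp ℂ 2 (volume : Measure ℝ))) :=
    (Lp.stronglyMeasurable _).measurable
  have h1 := lintegral_comp_div (F := fun η => ‖(𝓕 f : Lp ℂ 2 (volume : Measure ℝ)) η‖ₑ ^ 2)
    (by fun_prop) Real.two_pi_pos
  simp only [fourierTR]
  rw [h1, ← eLpNorm_two_sq, ← eLpNorm_two_sq, ← Lp.enorm_def, ← eLpNorm_congr_ae
    (memLp_xMode u k).coeFn_toLp, ← Lp.enorm_def, ← ofReal_norm, Lp.norm_fourier_eq, ofReal_norm]

theorem enorm_ofReal (r : ℝ) : ‖(r : ℂ)‖ₑ = ‖r‖ₑ := by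
  rw [← ofReal_norm, Complex.norm_real, ofReal_norm]

theorem tsum_enorm_fourierCoeff {T : ℝ} [hT : Fact (0 < T)] {f : AddCircle T → ℂ}
    (hf : MemLp f 2 AddCircle.haarAddCircle) :
    ∑' k, ‖fourierCoeff f k‖ₑ ^ 2 = ∫⁻ x, ‖f x‖ₑ ^ 2 ∂AddCircle.haarAddCircle := by
  have h := hasSum_sq_fourierCoeff (hf.toLp f)
  have e : ∀ k, fourierCoeff (hf.toLp f) k = fourierCoeff f k := fun k => by
    rw [fourierCoeff_congr_ae hf.coeFn_toLp]
  have e2 : ∫ t, ‖hf.toLp f t‖ ^ 2 ∂AddCircle.haarAddCircle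
      = ∫ t, ‖f t‖ ^ 2 ∂AddCircle.haarAddCircle := by
    refine integral_congr_ae ?_
    filter_upwards [hf.coeFn_toLp] with t ht
    rw [ht]
  simp only [e, e2] at h
  rw [← eLpNorm_two_sq, eLpNorm_two_sq_eq_ofReal hf, ← h.tsum_eq,
    ENNReal.ofReal_tsum_of_nonneg (fun _ => by positivity) h.summable]
  refine tsum_congr fun k => ?_
  rw [ENNReal.ofReal_pow (norm_nonneg _), ofReal_norm]

/-- Plancherel's identity on `𝕋 × ℝ`. -/
theorem tsum_lintegral_fourierTR (u : L2) :
    ∑' k, ∫⁻ ξ, ‖fourierTR u k ξ‖ₑ ^ 2 = ‖u‖ₑ ^ 2 := by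
  have hu : Measurable (u : Dom → ℝ) := (Lp.stronglyMeasurable u).measurable
  have hm : Measurable (fun p => ‖u p‖ₑ ^ 2) := by fun_prop
  have hfin : ∫⁻ p, ‖u p‖ₑ ^ 2 ≠ ⊤ := by
    rw [← eLpNorm_two_sq]
    exact ENNReal.pow_ne_top (Lp.eLpNorm_ne_top u)
  have hmode : ∀ k, AEMeasurable (fun y => ‖xMode u k y‖ₑ ^ 2) := fun k =>
    (memLp_xMode u k).1.enorm.pow_const _
  simp only [lintegral_fourierTR]
  rw [ENNReal.tsum_mul_left, ← lintegral_tsum hmode, Lp.enorm_def, eLpNorm_two_sq, lintegral_dom hm]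
  rw [lintegral_dom hm] at hfin
  have hfin2 : ∫⁻ y, ∫⁻ x, ‖u (x, y)‖ₑ ^ 2 ∂AddCircle.haarAddCircle ≠ ⊤ := by
    refine (ENNReal.lt_top_of_mul_ne_top_right hfin ?_).ne
    simpa using Real.pi_pos
  have hm2 : Measurable fun y => ∫⁻ x, ‖u (x, y)‖ₑ ^ 2 ∂AddCircle.haarAddCircle :=
    hm.lintegral_prod_left'
  congr 1
  refine lintegral_congr_ae ?_
  filter_upwards [ae_lt_top hm2 hfin2] with y hy
  have hfm : Measurable (fun x => ((u (x, y) : ℝ) : ℂ)) := by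
    have : Measurable (fun x => u (x, y)) := hu.comp measurable_prodMk_right
    fun_prop
  have hmem : MemLp (fun x => ((u (x, y) : ℝ) : ℂ)) 2 AddCircle.haarAddCircle := by
    refine ⟨hfm.aestronglyMeasurable, ?_⟩
    have : eLpNorm (fun x => ((u (x, y) : ℝ) : ℂ)) 2 AddCircle.haarAddCircle ^ 2 < ⊤ := by
      rw [eLpNorm_two_sq]
      simpa [enorm_ofReal] using hy
    by_contra h
    rw [not_lt, top_le_iff] at h
    simp [h] at this
  have := tsum_enorm_fourierCoeff hmem
  simpa [xMode, enorm_ofReal] using this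

theorem memLp_fourierTR (u : L2) (k : ℤ) : MemLp (fourierTR u k) 2 volume := by
  refine ⟨(measurable_fourierTR u k).aestronglyMeasurable, ?_⟩
  have h : eLpNorm (fourierTR u k) 2 volume ^ 2 ≤ ‖u‖ₑ ^ 2 := by
    rw [eLpNorm_two_sq, ← tsum_lintegral_fourierTR]
    exact ENNReal.le_tsum k
  by_contra h2
  rw [not_lt, top_le_iff] at h2
  simp [h2] at h

/-- Two locally integrable functions with the same pairings with bump functions agree. -/
theorem ae_eq_of_forall_bump {f g : ℝ → ℂ} (hf : LocallyIntegrable f) (hg : LocallyIntegrable g)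
    (h : ∀ χ, IsBump χ → ∫ ξ, f ξ * χ ξ = ∫ ξ, g ξ * χ ξ) : f =ᵐ[volume] g := by
  refine ae_eq_of_integral_contDiff_smul_eq hf hg fun χ hχ hc => ?_
  have hb : IsBump (fun ξ => (χ ξ : ℂ)) :=
    ⟨Complex.ofRealCLM.contDiff.comp hχ, hc.comp_left (g := Complex.ofReal) Complex.ofReal_zero⟩
  simpa only [Complex.real_smul, mul_comm] using h _ hb

/-- The identification principle behind all later formulas for transforms: it is enough to test
against e^{-ikx}`xft χ`. -/
theorem fourierTR_ae_eq {u : L2} {k : ℤ} {G : ℝ → ℂ} (hG : LocallyIntegrable G)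
    (h : ∀ χ, IsBump χ → ∫ p, ((u p : ℝ) : ℂ) * wave k (xft χ) p
      = (2 * π : ℂ) * ∫ ξ, G ξ * χ ξ) : fourierTR u k =ᵐ[volume] G := by
  refine ae_eq_of_forall_bump ((memLp_fourierTR u k).locallyIntegrable one_le_two) hG fun χ hχ => ?_
  have := h χ hχ
  rw [integral_mul_wave_xft u k hχ] at this
  exact mul_left_cancel₀ (by simp [Real.pi_ne_zero]) this

theorem fourierTR_add (u v : L2) (k : ℤ) :
    fourierTR (u + v) k =ᵐ[volume] fun ξ => fourierTR u k ξ + fourierTR v k ξ := by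
  refine fourierTR_ae_eq (((memLp_fourierTR u k).add (memLp_fourierTR v k)).locallyIntegrable
    one_le_two) fun χ hχ => ?_
  have hw := memLp_wave k hχ.memLp_xft
  simp only [add_mul]
  rw [integral_add (integrable_mul_of_memLp (memLp_fourierTR u k) hχ.memLp)
    (integrable_mul_of_memLp (memLp_fourierTR v k) hχ.memLp), mul_add,
    ← integral_mul_wave_xft u k hχ, ← integral_mul_wave_xft v k hχ,
    ← integral_add (integrable_mul_of_memLp (memLp_ofReal u) hw)
    (integrable_mul_of_memLp (memLp_ofReal v) hw)]
  refine integral_congr_ae ?_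
  filter_upwards [Lp.coeFn_add u v] with p hp
  rw [hp, Pi.add_apply]
  push_cast
  ring

theorem fourierTR_smul (c : ℝ) (u : L2) (k : ℤ) :
    fourierTR (c • u) k =ᵐ[volume] fun ξ => (c : ℂ) * fourierTR u k ξ := by
  refine fourierTR_ae_eq (((memLp_fourierTR u k).const_mul _).locallyIntegrable one_le_two) fun χ hχ => ?_
  simp only [mul_assoc]
  have e : ∀ z : ℂ, (2 * (π * (c * z)) : ℂ) = c * (2 * π * z) := fun z => by ring
  rw [integral_const_mul, e, ← integral_mul_wave_xft u k hχ, ← integral_const_mul]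
  refine integral_congr_ae ?_
  filter_upwards [Lp.coeFn_smul c u] with p hp
  rw [hp, Pi.smul_apply, smul_eq_mul]
  push_cast
  ring

/-! ### The Fourier transform as an isometry -/

/-- The product of counting measure and Lebesgue measure on the dual group `ℤ × ℝ`. -/
def dualMeasure : Measure (ℤ × ℝ) :=
  Measure.sum fun k : ℤ => (volume : Measure ℝ).map (fun ξ => (k, ξ))

/-- Square integrable functions on `ℤ × ℝ`. -/
abbrev L2hat : Type := Lp ℂ 2 dualMeasure

theorem measurableEmbedding_mk (k : ℤ) : MeasurableEmbedding (fun ξ : ℝ => (k, ξ)) :=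
  MeasurableEmbedding.id.prodMk_left k

theorem lintegral_dualMeasure (F : ℤ × ℝ → ℝ≥0∞) :
    ∫⁻ z, F z ∂dualMeasure = ∑' k, ∫⁻ ξ, F (k, ξ) := by
  rw [dualMeasure, lintegral_sum_measure]
  exact tsum_congr fun k => (measurableEmbedding_mk k).lintegral_map _

theorem ae_dualMeasure {p : ℤ × ℝ → Prop} :
    (∀ᵐ z ∂dualMeasure, p z) ↔ ∀ k, ∀ᵐ ξ, p (k, ξ) := by
  rw [dualMeasure, Measure.ae_sum_iff]
  exact forall_congr' fun k => (measurableEmbedding_mk k).ae_map_iff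

theorem memLp_hat (u : L2) : MemLp (fun z : ℤ × ℝ => fourierTR u z.1 z.2) 2 dualMeasure := by
  have hm : Measurable (fun z : ℤ × ℝ => fourierTR u z.1 z.2) :=
    measurable_from_prod_countable_right fun k => measurable_fourierTR u k
  refine ⟨hm.aestronglyMeasurable, ?_⟩
  have h : eLpNorm (fun z : ℤ × ℝ => fourierTR u z.1 z.2) 2 dualMeasure ^ 2 < ⊤ := by
    rw [eLpNorm_two_sq, lintegral_dualMeasure, tsum_lintegral_fourierTR]
    simp
  by_contra h2
  rw [not_lt, top_le_iff] at h2
  simp [h2] at h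

/-- The Fourier transform as a real linear isometry. -/
def hat : L2 →ₗᵢ[ℝ] L2hat where
  toFun u := (memLp_hat u).toLp _
  map_add' u v := by
    rw [← MemLp.toLp_add]
    exact MemLp.toLp_congr _ _ (ae_dualMeasure.2 fun k => fourierTR_add u v k)
  map_smul' c u := by
    rw [RingHom.id_apply, ← MemLp.toLp_const_smul]
    refine MemLp.toLp_congr _ _ (ae_dualMeasure.2 fun k => ?_)
    filter_upwards [fourierTR_smul c u k] with ξ hξ
    rw [hξ, Pi.smul_apply, Complex.real_smul]
  norm_map' u := by
    have h : ‖(memLp_hat u).toLp _‖ₑ ^ 2 = ‖u‖ₑ ^ 2 := by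
      rw [Lp.enorm_toLp, eLpNorm_two_sq, lintegral_dualMeasure, tsum_lintegral_fourierTR]
    have h2 : ‖(memLp_hat u).toLp _‖ₑ = ‖u‖ₑ := (ENNReal.pow_right_strictMono two_ne_zero).injective h
    simpa [← ofReal_norm, ENNReal.ofReal_eq_ofReal_iff] using h2

theorem coeFn_hat (u : L2) : hat u =ᵐ[dualMeasure] fun z => fourierTR u z.1 z.2 :=
  (memLp_hat u).coeFn_toLp

theorem memLp_mode (k : ℤ) {f : ℤ × ℝ → ℂ} (hf : MemLp f 2 dualMeasure) :
    MemLp (fun ξ => f (k, ξ)) 2 volume :=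
  (measurableEmbedding_mk k).memLp_map_measure_iff.1 (hf.mono_measure (Measure.le_sum _ k))

/-- The `k`-th mode of an element of `L²(ℤ × ℝ)`. -/
def modeL (k : ℤ) : L2hat →L[ℝ] Lp ℂ 2 (volume : Measure ℝ) := by
  refine LinearMap.mkContinuous
    { toFun := fun f => (memLp_mode k (Lp.memLp f)).toLp _
      map_add' := fun f g => ?_
      map_smul' := fun c f => ?_ } 1 fun f => ?_
  · rw [← MemLp.toLp_add]
    refine MemLp.toLp_congr _ _ ?_
    filter_upwards [ae_dualMeasure.1 (Lp.coeFn_add f g) k] with ξ hξ using hξ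
  · rw [RingHom.id_apply, ← MemLp.toLp_const_smul]
    refine MemLp.toLp_congr _ _ ?_
    filter_upwards [ae_dualMeasure.1 (Lp.coeFn_smul c f) k] with ξ hξ using hξ
  · have h : ‖(memLp_mode k (Lp.memLp f)).toLp _‖ₑ ≤ ‖f‖ₑ := by
      rw [Lp.enorm_toLp, Lp.enorm_def]
      refine (ENNReal.pow_le_pow_left_iff two_ne_zero).1 ?_
      rw [eLpNorm_two_sq, eLpNorm_two_sq, lintegral_dualMeasure]
      exact ENNReal.le_tsum (f := fun k => ∫⁻ ξ, ‖f (k, ξ)‖ₑ ^ 2) k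
    rw [one_mul]
    simpa [← ofReal_norm, ENNReal.ofReal_le_ofReal_iff] using h

theorem coeFn_modeL (k : ℤ) (f : L2hat) : modeL k f =ᵐ[volume] fun ξ => f (k, ξ) :=
  (memLp_mode k (Lp.memLp f)).coeFn_toLp

theorem coeFn_modeL_hat (k : ℤ) (u : L2) : modeL k (hat u) =ᵐ[volume] fourierTR u k := by
  filter_upwards [coeFn_modeL k (hat u), ae_dualMeasure.1 (coeFn_hat u) k] with ξ h1 h2
  rw [h1, h2]

/-! ### Calculus of test functions -/

theorem isOpenQuotientMap_lift :
    IsOpenQuotientMap (fun p : ℝ × ℝ => ((p.1 : AddCircle (2 * π)), p.2)) :=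
  (QuotientAddGroup.isOpenQuotientMap_mk
    (N := AddSubgroup.zmultiples (2 * π))).prodMap IsOpenQuotientMap.id

theorem IsTest.continuous {φ : Dom → ℝ} (h : IsTest φ) : Continuous φ :=
  isOpenQuotientMap_lift.isQuotientMap.continuous_iff.2 h.smooth.continuous

theorem IsTest.memLp {φ : Dom → ℝ} (h : IsTest φ) : MemLp φ 2 (volume : Measure Dom) :=
  h.continuous.memLp_of_hasCompactSupport h.compact

theorem dx_coe (φ : Dom → ℝ) (x y : ℝ) :
    dx φ ((x : AddCircle (2 * π)), y) = deriv (fun s : ℝ => φ ((s : AddCircle (2 * π)), y)) x := by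
  have := deriv_comp_const_add (fun s : ℝ => φ ((s : AddCircle (2 * π)), y)) x 0
  rw [add_zero] at this
  rw [← this, dx]
  simp only [AddCircle.coe_add]

theorem dy_eq (φ : Dom → ℝ) (p : Dom) : dy φ p = deriv (fun s : ℝ => φ (p.1, s)) p.2 := by
  have := deriv_comp_const_add (fun s : ℝ => φ (p.1, s)) p.2 0
  rw [add_zero] at this
  rw [← this, dy]

theorem IsTest.hasDerivAt_dx {φ : Dom → ℝ} (h : IsTest φ) (x y : ℝ) :
    HasDerivAt (fun s : ℝ => φ ((s : AddCircle (2 * π)), y))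
      (dx φ ((x : AddCircle (2 * π)), y)) x := by
  rw [dx_coe]
  have hd : DifferentiableAt ℝ (fun s : ℝ => φ ((s : AddCircle (2 * π)), y)) x :=
    ((h.smooth.differentiable (by simp)).comp (g := fun p : ℝ × ℝ =>
      φ ((p.1 : AddCircle (2 * π)), p.2)) (f := fun s : ℝ => (s, y)) (by fun_prop)) x
  exact hd.hasDerivAt

theorem IsTest.hasDerivAt_dy {φ : Dom → ℝ} (h : IsTest φ) (x : AddCircle (2 * π)) (y : ℝ) :
    HasDerivAt (fun s : ℝ => φ (x, s)) (dy φ (x, y)) y := by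
  rw [dy_eq]
  obtain ⟨x, rfl⟩ := QuotientAddGroup.mk_surjective x
  have hd : DifferentiableAt ℝ (fun s : ℝ => φ ((x : AddCircle (2 * π)), s)) y :=
    ((h.smooth.differentiable (by simp)).comp (g := fun p : ℝ × ℝ =>
      φ ((p.1 : AddCircle (2 * π)), p.2)) (f := fun s : ℝ => (x, s)) (by fun_prop)) y
  exact hd.hasDerivAt

theorem IsTest.dx {φ : Dom → ℝ} (h : IsTest φ) : IsTest (dx φ) := by
  refine ⟨?_, h.compact.mono' fun p hp => ?_⟩
  · have e : (fun p : ℝ × ℝ => Boussinesq.dx φ ((p.1 : AddCircle (2 * π)), p.2))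
        = fun p => fderiv ℝ (fun p : ℝ × ℝ => φ ((p.1 : AddCircle (2 * π)), p.2)) p (1, 0) := by
      ext p
      have h1 := ((h.smooth.differentiable (by simp)) (p.1, p.2)).hasFDerivAt
      have h2 : HasDerivAt (fun s : ℝ => (s, p.2)) ((1 : ℝ), (0 : ℝ)) p.1 :=
        (hasDerivAt_id p.1).prodMk (hasDerivAt_const _ _)
      have h3 := h1.comp_hasDerivAt p.1 h2
      exact (h.hasDerivAt_dx p.1 p.2).unique h3
    rw [e]
    exact (h.smooth.fderiv_right (m := ((⊤ : ℕ∞) : WithTop ℕ∞)) (by simp)).clm_apply contDiff_const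
  · by_contra hn
    refine hp ?_
    have h0 : φ =ᶠ[𝓝 p] 0 := notMem_tsupport_iff_eventuallyEq.1 hn
    have hc : Tendsto (fun s : ℝ => ((p.1 + (s : AddCircle (2 * π)), p.2) : Dom)) (𝓝 0) (𝓝 p) := by
      have : Continuous (fun s : ℝ => ((p.1 + (s : AddCircle (2 * π)), p.2) : Dom)) :=
        (continuous_const.add (AddCircle.continuous_mk' (2 * π))).prodMk continuous_const
      simpa using this.tendsto 0
    have h1 : (fun s : ℝ => φ (p.1 + (s : AddCircle (2 * π)), p.2)) =ᶠ[𝓝 0] fun _ => 0 :=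
      hc.eventually h0
    rw [Boussinesq.dx, h1.deriv_eq, deriv_const]

theorem IsTest.dy {φ : Dom → ℝ} (h : IsTest φ) : IsTest (dy φ) := by
  refine ⟨?_, h.compact.mono' fun p hp => ?_⟩
  · have e : (fun p : ℝ × ℝ => Boussinesq.dy φ ((p.1 : AddCircle (2 * π)), p.2))
        = fun p => fderiv ℝ (fun p : ℝ × ℝ => φ ((p.1 : AddCircle (2 * π)), p.2)) p (0, 1) := by
      ext p
      have h1 := ((h.smooth.differentiable (by simp)) (p.1, p.2)).hasFDerivAt
      have h2 : HasDerivAt (fun s : ℝ => (p.1, s)) ((0 : ℝ), (1 : ℝ)) p.2 :=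
        (hasDerivAt_const _ _).prodMk (hasDerivAt_id p.2)
      have h3 := h1.comp_hasDerivAt p.2 h2
      exact (h.hasDerivAt_dy p.1 p.2).unique h3
    rw [e]
    exact (h.smooth.fderiv_right (m := ((⊤ : ℕ∞) : WithTop ℕ∞)) (by simp)).clm_apply contDiff_const
  · by_contra hn
    refine hp ?_
    have h0 : φ =ᶠ[𝓝 p] 0 := notMem_tsupport_iff_eventuallyEq.1 hn
    have hc : Tendsto (fun s : ℝ => ((p.1, p.2 + s) : Dom)) (𝓝 0) (𝓝 p) := by
      have : Continuous (fun s : ℝ => ((p.1, p.2 + s) : Dom)) := by fun_prop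
      simpa using this.tendsto 0
    have h1 : (fun s : ℝ => φ (p.1, p.2 + s)) =ᶠ[𝓝 0] fun _ => 0 := hc.eventually h0
    rw [Boussinesq.dy, h1.deriv_eq, deriv_const]

theorem IsTest.dyt {φ : Dom → ℝ} (h : IsTest φ) (t : ℝ) : IsTest (dyt t φ) :=
  ⟨h.dy.smooth.sub (contDiff_const.mul h.dx.smooth),
    h.dy.compact.sub h.dx.compact.mul_left⟩

theorem IsTest.lap {φ : Dom → ℝ} (h : IsTest φ) (t : ℝ) : IsTest (lap t φ) :=
  ⟨h.dx.dx.smooth.add ((h.dyt t).dyt t).smooth, h.dx.dx.compact.add ((h.dyt t).dyt t).compact⟩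

/-! ### Fourier transform of derivatives of test functions -/

/-- The `k`-th Fourier coefficient in `x` of a test function. -/
theorem xMode_ae_eq {u : L2} {φ : Dom → ℝ} (h : u =ᵐ[volume] φ) (k : ℤ) :
    xMode u k =ᵐ[volume] fun y => fourierCoeff (fun x : AddCircle (2 * π) => ((φ (x, y) : ℝ) : ℂ)) k := by
  have h3 : ∀ᵐ p ∂((volume : Measure (AddCircle (2 * π))).prod (volume : Measure ℝ)),
    u p = φ p := h
  have h4 := Measure.ae_ae_of_ae_prod
    ((Measure.measurePreserving_swap (μ := (volume : Measure ℝ))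
    (ν := (volume : Measure (AddCircle (2 * π))))).quasiMeasurePreserving.ae h3)
  filter_upwards [h4] with y hy
  refine integral_congr_ae ?_
  have hy2 : ∀ᵐ x ∂AddCircle.haarAddCircle (T := 2 * π), u (x, y) = φ (x, y) := by
    rw [AddCircle.volume_eq_smul_haarAddCircle] at hy
    exact (Measure.ae_ennreal_smul_measure_iff (by simpa using Real.pi_pos)).1 hy
  filter_upwards [hy2] with x hx
  rw [hx]

theorem fourierCoeff_dx {φ : Dom → ℝ} (h : IsTest φ) (k : ℤ) (y : ℝ) :
    fourierCoeff (fun x : AddCircle (2 * π) => ((dx φ (x, y) : ℝ) : ℂ)) k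
      = Complex.I * k * fourierCoeff (fun x : AddCircle (2 * π) => ((φ (x, y) : ℝ) : ℂ)) k := by
  -- The integrand is the x-derivative of e^{-ikx}φ, whose integral over a period vanishes.
  have hper : ∫ x : AddCircle (2 * π), ((fourier (-k) x : ℂ) * (Boussinesq.dx φ (x, y) : ℂ)
      + (-(Complex.I * k)) * ((fourier (-k) x : ℂ) * (φ (x, y) : ℂ))) = 0 := by
    rw [← AddCircle.intervalIntegral_preimage (2 * π) 0]
    have hd : ∀ x : ℝ, HasDerivAt (fun s : ℝ => (fourier (-k) (s : AddCircle (2 * π)) : ℂ)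
        * (φ ((s : AddCircle (2 * π)), y) : ℂ))
        ((fourier (-k) (x : AddCircle (2 * π)) : ℂ) * (Boussinesq.dx φ ((x : AddCircle (2 * π)), y) : ℂ)
      + (-(Complex.I * k)) * ((fourier (-k) (x : AddCircle (2 * π)) : ℂ)
        * (φ ((x : AddCircle (2 * π)), y) : ℂ))) x := by
      intro x
      have h1 := hasDerivAt_fourier (2 * π) (-k) x
      have h2 := (h.hasDerivAt_dx x y).ofReal_comp
      convert! h1.mul h2 using 1
      push_cast
      have : (π : ℂ) ≠ 0 := by simp [Real.pi_ne_zero]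
      field_simp
      ring
    rw [intervalIntegral.integral_eq_sub_of_hasDerivAt (fun x _ => hd x)]
    · have e : ((0 + 2 * π : ℝ) : AddCircle (2 * π)) = ((0 : ℝ) : AddCircle (2 * π)) := by simp
      rw [e, sub_self]
    · refine Continuous.intervalIntegrable ?_ _ _
      have c1 : Continuous (fun x : ℝ => (fourier (-k) (x : AddCircle (2 * π)) : ℂ)) :=
        (map_continuous (fourier (T := 2 * π) (-k))).comp (AddCircle.continuous_mk' _)
      have cm : Continuous (fun x : ℝ => (((x : AddCircle (2 * π)), y) : Dom)) :=
        (AddCircle.continuous_mk' _).prodMk continuous_const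
      have c2 := Complex.continuous_ofReal.comp (h.continuous.comp cm)
      have c3 := Complex.continuous_ofReal.comp (h.dx.continuous.comp cm)
      exact (c1.mul c3).add (continuous_const.mul (c1.mul c2))
  have hc : ∀ {ψ : Dom → ℝ}, IsTest ψ →
      Continuous (fun x : AddCircle (2 * π) => (fourier (-k) x : ℂ) * (ψ (x, y) : ℂ)) := fun hψ =>
    (map_continuous (fourier (T := 2 * π) (-k))).mul
      (Complex.continuous_ofReal.comp (hψ.continuous.comp (by fun_prop)))
  have hi : ∀ {ψ : Dom → ℝ}, IsTest ψ →
      Integrable (fun x : AddCircle (2 * π) => (fourier (-k) x : ℂ) * (ψ (x, y) : ℂ)) := fun hψ =>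
    (hc hψ).integrable_of_hasCompactSupport (HasCompactSupport.of_compactSpace _)
  rw [integral_add (hi h.dx) ((hi h).const_mul _), integral_const_mul] at hper
  simp only [fourierCoeff, smul_eq_mul, AddCircle.integral_haarAddCircle]
  rw [eq_neg_of_add_eq_zero_left hper, Complex.real_smul, Complex.real_smul]
  ring

theorem fourierTR_congr {u v : L2} {k : ℤ} {c : ℂ}
    (h : xMode u k =ᵐ[volume] fun y => c * xMode v k y) :
    fourierTR u k =ᵐ[volume] fun ξ => c * fourierTR v k ξ := by
  refine fourierTR_ae_eq (((memLp_fourierTR v k).const_mul _).locallyIntegrable one_le_two)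
    fun χ hχ => ?_
  have e : ∀ z : ℂ, (2 * π * (c * z) : ℂ) = c * (2 * π * z) := fun z => by ring
  have e2 : ∫ y, xMode u k y * xft χ y = c * ∫ y, xMode v k y * xft χ y := by
    rw [← integral_const_mul]
    refine integral_congr_ae ?_
    filter_upwards [h] with y hy
    rw [hy, mul_assoc]
  simp only [mul_assoc c]
  rw [integral_const_mul, e, ← integral_mul_wave_xft v k hχ, integral_mul_wave _ _ hχ.memLp_xft,
    integral_mul_wave _ _ hχ.memLp_xft, e2, e]

/-- Fourier transform of `g(y) ∂ₓφ`. -/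
theorem fourierTR_mul_dx {u v : L2} {φ : Dom → ℝ} (h : IsTest φ) (g : ℝ → ℝ)
    (hu : u =ᵐ[volume] fun p => g p.2 * dx φ p) (hv : v =ᵐ[volume] fun p => g p.2 * φ p) (k : ℤ) :
    fourierTR u k =ᵐ[volume] fun ξ => Complex.I * k * fourierTR v k ξ := by
  refine fourierTR_congr ?_
  have hg : ∀ (ψ : Dom → ℝ) (y : ℝ),
      fourierCoeff (fun x : AddCircle (2 * π) => ((g y * ψ (x, y) : ℝ) : ℂ)) k
        = g y * fourierCoeff (fun x : AddCircle (2 * π) => ((ψ (x, y) : ℝ) : ℂ)) k := by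
    intro ψ y
    simp only [fourierCoeff, smul_eq_mul, ← integral_const_mul]
    refine integral_congr_ae (Eventually.of_forall fun x => ?_)
    push_cast
    ring
  filter_upwards [xMode_ae_eq hu k, xMode_ae_eq hv k] with y h1 h2
  rw [h1, h2, hg, hg, fourierCoeff_dx h]
  ring

theorem IsTest.hasCompactSupport_slice {φ : Dom → ℝ} (h : IsTest φ) (x : AddCircle (2 * π)) :
    HasCompactSupport (fun y => φ (x, y)) :=
  HasCompactSupport.intro (h.compact.isCompact.image continuous_snd) fun y hy =>
    image_eq_zero_of_notMem_tsupport fun hn => hy ⟨(x, y), hn, rfl⟩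

/-- Integration by parts in y on each slice. The compact support of φ removes boundary terms, so Y
itself need not decay at a given rate. -/
theorem integral_dy_mul_wave {φ : Dom → ℝ} (h : IsTest φ) (k : ℤ) {Y Y' : ℝ → ℂ}
    (hY : ∀ y, HasDerivAt Y (Y' y) y) (hY2 : MemLp Y 2 volume) (hY2' : MemLp Y' 2 volume)
    (hY' : Continuous Y') :
    ∫ p, (dy φ p : ℂ) * wave k Y p = -∫ p, (φ p : ℂ) * wave k Y' p := by
  have hYc : Continuous Y := continuous_iff_continuousAt.2 fun y => (hY y).continuousAt
  have h1 : Integrable (fun p => (dy φ p : ℂ) * wave k Y p) :=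
    integrable_mul_of_memLp h.dy.memLp.ofReal (memLp_wave k hY2)
  have h2 : Integrable (fun p => (φ p : ℂ) * wave k Y' p) :=
    integrable_mul_of_memLp h.memLp.ofReal (memLp_wave k hY2')
  have e1 := integral_prod (μ := (volume : Measure (AddCircle (2 * π))))
    (ν := (volume : Measure ℝ)) _ h1
  have e2 := integral_prod (μ := (volume : Measure (AddCircle (2 * π))))
    (ν := (volume : Measure ℝ)) _ h2
  refine e1.trans (Eq.trans ?_ (congrArg Neg.neg e2.symm))
  rw [← integral_neg]
  refine integral_congr_ae (Eventually.of_forall fun x => ?_)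
  simp only [wave]
  have hcs : ∀ {ψ : Dom → ℝ}, IsTest ψ → ∀ {Z : ℝ → ℂ}, Continuous Z →
      Integrable ((fun y => (ψ (x, y) : ℂ)) * Z) := fun {ψ} hψ {Z} hZ => by
    have hc : Continuous (fun y => (ψ (x, y) : ℂ)) :=
      Complex.continuous_ofReal.comp (hψ.continuous.comp (by fun_prop))
    exact (hc.mul hZ).integrable_of_hasCompactSupport
      (HasCompactSupport.mul_right ((hψ.hasCompactSupport_slice x).comp_left (g := Complex.ofReal)
        Complex.ofReal_zero))
  have key := integral_mul_deriv_eq_deriv_mul_of_integrable (u := fun y => (φ (x, y) : ℂ))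
    (u' := fun y => (dy φ (x, y) : ℂ)) (v := Y) (v' := Y')
    (fun y _ => (h.hasDerivAt_dy x y).ofReal_comp) (fun y _ => hY y) (hcs h hY') (hcs h.dy hYc)
    (hcs h hYc)
  have f : ∀ a b c : ℂ, a * (b * c) = b * (a * c) := fun a b c => by ring
  simp only [f _ (fourier (-k) x : ℂ), integral_const_mul]
  rw [key]
  ring

theorem IsBump.id_mul {χ : ℝ → ℂ} (h : IsBump χ) (c : ℂ) : IsBump (fun ξ => c * ξ * χ ξ) :=
  ⟨(contDiff_const.mul Complex.ofRealCLM.contDiff).mul h.smooth, h.compact.mul_left⟩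

theorem fourierTR_dy {u v : L2} {φ : Dom → ℝ} (h : IsTest φ)
    (hu : u =ᵐ[volume] dy φ) (hv : v =ᵐ[volume] φ) (k : ℤ) :
    fourierTR u k =ᵐ[volume] fun ξ => Complex.I * ξ * fourierTR v k ξ := by
  refine fourierTR_ae_eq ?_ fun χ hχ => ?_
  · have hc : Continuous (fun ξ : ℝ => Complex.I * (ξ : ℂ)) := by fun_prop
    simpa using ((memLp_fourierTR v k).locallyIntegrable one_le_two).continuous_smul hc
  · have hb : IsBump (fun ξ => -(Complex.I * ξ) * χ ξ) := by
      simpa only [neg_mul] using hχ.id_mul (-Complex.I)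
    have key := integral_dy_mul_wave h k hχ.hasDerivAt_xft hχ.memLp_xft hb.memLp_xft
      (continuous_iff_continuousAt.2 fun y => (hb.hasDerivAt_xft y).continuousAt)
    have e1 : ∫ p, ((u p : ℝ) : ℂ) * wave k (xft χ) p
        = ∫ p, (dy φ p : ℂ) * wave k (xft χ) p := by
      refine integral_congr_ae ?_
      filter_upwards [hu] with p hp
      rw [hp]
    have e2 : ∫ p, (φ p : ℂ) * wave k (xft (fun ξ => -(Complex.I * ξ) * χ ξ)) p
        = ∫ p, ((v p : ℝ) : ℂ) * wave k (xft (fun ξ => -(Complex.I * ξ) * χ ξ)) p := by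
      refine integral_congr_ae ?_
      filter_upwards [hv] with p hp
      rw [hp]
    rw [e1, key, e2, integral_mul_wave_xft v k hb, ← mul_neg, ← integral_neg]
    congr 1
    refine integral_congr_ae (Eventually.of_forall fun ξ => ?_)
    simp only
    ring

/-- A test function as an element of `L²`. -/
def IsTest.toL2 {φ : Dom → ℝ} (h : IsTest φ) : L2 := h.memLp.toLp φ

theorem IsTest.coeFn_toL2 {φ : Dom → ℝ} (h : IsTest φ) : h.toL2 =ᵐ[volume] φ := h.memLp.coeFn_toLp

theorem fourierTR_toL2_dx {φ : Dom → ℝ} (h : IsTest φ) (k : ℤ) :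
    fourierTR h.dx.toL2 k =ᵐ[volume] fun ξ => Complex.I * k * fourierTR h.toL2 k ξ :=
  fourierTR_mul_dx h (fun _ => 1) (by simpa using h.dx.coeFn_toL2) (by simpa using h.coeFn_toL2) k

theorem fourierTR_toL2_dyt {φ : Dom → ℝ} (h : IsTest φ) (t : ℝ) (k : ℤ) :
    fourierTR (h.dyt t).toL2 k =ᵐ[volume]
      fun ξ => Complex.I * (ξ - k * t : ℝ) * fourierTR h.toL2 k ξ := by
  have e : (h.dyt t).toL2 = h.dy.toL2 + (-t) • h.dx.toL2 := by
    refine Lp.ext ?_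
    filter_upwards [(h.dyt t).coeFn_toL2, h.dy.coeFn_toL2, h.dx.coeFn_toL2,
      Lp.coeFn_add h.dy.toL2 ((-t) • h.dx.toL2), Lp.coeFn_smul (-t) h.dx.toL2] with p h1 h2 h3 h4 h5
    rw [h1, h4, Pi.add_apply, h5, Pi.smul_apply, h2, h3, smul_eq_mul, Boussinesq.dyt]
    ring
  rw [e]
  filter_upwards [fourierTR_add h.dy.toL2 ((-t) • h.dx.toL2) k, fourierTR_smul (-t) h.dx.toL2 k,
    fourierTR_toL2_dx h k, fourierTR_dy h h.dy.coeFn_toL2 h.coeFn_toL2 k] with ξ h1 h2 h3 h4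
  rw [h1, h2, h3, h4]
  push_cast
  ring

theorem fourierTR_toL2_dyt_dyt {φ : Dom → ℝ} (h : IsTest φ) (t : ℝ) (k : ℤ) :
    fourierTR ((h.dyt t).dyt t).toL2 k =ᵐ[volume]
      fun ξ => (-(ξ - k * t) ^ 2 : ℝ) * fourierTR h.toL2 k ξ := by
  filter_upwards [fourierTR_toL2_dyt h t k, fourierTR_toL2_dyt (h.dyt t) t k] with ξ h1 h2
  rw [h2, h1]
  push_cast
  linear_combination (ξ - k * t : ℂ) ^ 2 * fourierTR h.toL2 k ξ * Complex.I_sq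

theorem fourierTR_toL2_dx_dx {φ : Dom → ℝ} (h : IsTest φ) (k : ℤ) :
    fourierTR h.dx.dx.toL2 k =ᵐ[volume] fun ξ => (-(k : ℝ) ^ 2 : ℝ) * fourierTR h.toL2 k ξ := by
  filter_upwards [fourierTR_toL2_dx h k, fourierTR_toL2_dx h.dx k] with ξ h1 h2
  rw [h2, h1]
  push_cast
  linear_combination (k : ℂ) ^ 2 * fourierTR h.toL2 k ξ * Complex.I_sq

theorem fourierTR_toL2_lap {φ : Dom → ℝ} (h : IsTest φ) (t : ℝ) (k : ℤ) :
    fourierTR (h.lap t).toL2 k =ᵐ[volume]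
      fun ξ => (-((k : ℝ) ^ 2 + (ξ - k * t) ^ 2) : ℝ) * fourierTR h.toL2 k ξ := by
  have e : (h.lap t).toL2 = h.dx.dx.toL2 + ((h.dyt t).dyt t).toL2 := by
    refine Lp.ext ?_
    filter_upwards [(h.lap t).coeFn_toL2, h.dx.dx.coeFn_toL2, ((h.dyt t).dyt t).coeFn_toL2,
      Lp.coeFn_add h.dx.dx.toL2 ((h.dyt t).dyt t).toL2] with p h1 h2 h3 h4
    rw [h1, h4, Pi.add_apply, h2, h3, Boussinesq.lap]
  rw [e]
  filter_upwards [fourierTR_add h.dx.dx.toL2 ((h.dyt t).dyt t).toL2 k,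
    fourierTR_toL2_dx_dx h k, fourierTR_toL2_dyt_dyt h t k] with ξ h1 h2 h3
  rw [h1, h2, h3]
  push_cast
  ring

/-! ### Waves as test functions -/

/-- `∫ u(x, y) e^{-ikx} Y(y) dx dy`. -/
def wavePair (u : L2) (k : ℤ) (Y : ℝ → ℂ) : ℂ := ∫ p, ((u p : ℝ) : ℂ) * wave k Y p

theorem wave_add (k : ℤ) (Y Z : ℝ → ℂ) (p : Dom) :
    wave k (fun y => Y y + Z y) p = wave k Y p + wave k Z p := mul_add _ _ _

theorem wave_const_mul (k : ℤ) (c : ℂ) (Y : ℝ → ℂ) (p : Dom) :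
    wave k (fun y => c * Y y) p = c * wave k Y p := mul_left_comm _ _ _

theorem wavePair_add (u : L2) (k : ℤ) {Y Z : ℝ → ℂ} (hY : MemLp Y 2 volume)
    (hZ : MemLp Z 2 volume) :
    wavePair u k (fun y => Y y + Z y) = wavePair u k Y + wavePair u k Z := by
  simp only [wavePair, wave_add, mul_add]
  exact integral_add (integrable_mul_of_memLp (memLp_ofReal u) (memLp_wave k hY))
    (integrable_mul_of_memLp (memLp_ofReal u) (memLp_wave k hZ))

theorem wavePair_const_mul (u : L2) (k : ℤ) (c : ℂ) (Y : ℝ → ℂ) :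
    wavePair u k (fun y => c * Y y) = c * wavePair u k Y := by
  simp only [wavePair, wave_const_mul, ← integral_const_mul]
  exact integral_congr_ae (Eventually.of_forall fun p => by ring)

theorem wavePair_sub (u : L2) (k : ℤ) {Y Z : ℝ → ℂ} (hY : MemLp Y 2 volume)
    (hZ : MemLp Z 2 volume) :
    wavePair u k (fun y => Y y - Z y) = wavePair u k Y - wavePair u k Z := by
  have := wavePair_add u k hY (hZ.const_mul (-1))
  rw [wavePair_const_mul] at this
  simpa [sub_eq_add_neg] using this

theorem integral_mul_re_wave (u : L2) (k : ℤ) {Y : ℝ → ℂ} (hY : MemLp Y 2 volume) :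
    ∫ p, u p * (wave k Y p).re = (wavePair u k Y).re := by
  have h := integrable_mul_of_memLp (memLp_ofReal u) (memLp_wave k hY)
  have := integral_re h
  simp only [RCLike.re_eq_complex_re] at this
  rw [wavePair, ← this]
  refine integral_congr_ae (Eventually.of_forall fun p => ?_)
  simp

/-- Only the k-th mode of u enters. This matters for q, whose modes k ≠ 0 are controlled by those of
ω. -/
theorem norm_wavePair_le (u : L2) (k : ℤ) {Y : ℝ → ℂ} (hY : MemLp Y 2 volume) :
    ‖wavePair u k Y‖ ≤ 2 * π * ‖modeL k (hat u)‖ * (eLpNorm Y 2 volume).toReal := by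
  have h1 : wavePair u k Y = (2 * π : ℂ) * ∫ y, xMode u k y * Y y := integral_mul_wave u k hY
  have h2 : ‖∫ y, xMode u k y * Y y‖ₑ ≤ eLpNorm (xMode u k) 2 volume * eLpNorm Y 2 volume :=
    enorm_integral_mul_le (memLp_xMode u k) hY
  have h3 : eLpNorm (xMode u k) 2 volume ≤ ‖modeL k (hat u)‖ₑ := by
    rw [Lp.enorm_def, eLpNorm_congr_ae (coeFn_modeL_hat k u)]
    refine (ENNReal.pow_le_pow_left_iff two_ne_zero).1 ?_
    rw [eLpNorm_two_sq, eLpNorm_two_sq, lintegral_fourierTR]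
    refine le_mul_of_one_le_left' ?_
    rw [ENNReal.one_le_ofReal]
    nlinarith [Real.pi_gt_three]
  have h4 : ‖∫ y, xMode u k y * Y y‖ ≤ ‖modeL k (hat u)‖ * (eLpNorm Y 2 volume).toReal := by
    have h5 := h2.trans (mul_le_mul' h3 le_rfl)
    have h6 := ENNReal.toReal_mono (ENNReal.mul_ne_top enorm_ne_top hY.2.ne) h5
    rwa [ENNReal.toReal_mul, toReal_enorm, toReal_enorm] at h6
  rw [h1, norm_mul, mul_assoc (2 * π)]
  have : ‖(2 * π : ℂ)‖ = 2 * π := by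
    rw [norm_mul, Complex.norm_real, Real.norm_of_nonneg Real.pi_pos.le]; simp
  rw [this]
  gcongr

theorem wave_coe (k : ℤ) (Y : ℝ → ℂ) (x y : ℝ) :
    wave k Y ((x : AddCircle (2 * π)), y) = Complex.exp (-(Complex.I * k * x)) * Y y := by
  rw [wave, fourier_coe_apply]
  congr 2
  push_cast
  have : (π : ℂ) ≠ 0 := by simp [Real.pi_ne_zero]
  field_simp

theorem isTest_re_wave (k : ℤ) {Z : ℝ → ℂ} (hZ : IsBump Z) : IsTest (fun p => (wave k Z p).re) := by
  refine ⟨?_, ?_⟩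
  · simp only [wave_coe]
    have h1 : ContDiff ℝ ∞ (fun p : ℝ × ℝ => Complex.exp (-(Complex.I * k * p.1)) * Z p.2) := by
      refine ContDiff.mul ?_ (hZ.smooth.comp contDiff_snd)
      exact ((contDiff_const.mul (Complex.ofRealCLM.contDiff.comp contDiff_fst)).neg).cexp
    exact Complex.reCLM.contDiff.comp h1
  · refine HasCompactSupport.intro (isCompact_univ.prod hZ.compact.isCompact) fun p hp => ?_
    have : Z p.2 = 0 := image_eq_zero_of_notMem_tsupport fun hn => hp ⟨mem_univ _, hn⟩
    simp [wave, this]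

theorem dx_re_wave (k : ℤ) (Z : ℝ → ℂ) :
    dx (fun p => (wave k Z p).re) = fun p => (wave k (fun y => -(Complex.I * k) * Z y) p).re := by
  ext ⟨x, y⟩
  obtain ⟨x, rfl⟩ := QuotientAddGroup.mk_surjective x
  refine (dx_coe _ x y).trans ?_
  simp only [wave_coe]
  have h1 : HasDerivAt (fun s : ℝ => Complex.exp (-(Complex.I * k * s)) * Z y)
      (Complex.exp (-(Complex.I * k * x)) * (-(Complex.I * k)) * Z y) x := by
    have h2 : HasDerivAt (fun s : ℝ => -(Complex.I * k * s)) (-(Complex.I * k * 1)) x :=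
      (((hasDerivAt_id x).ofReal_comp).const_mul _).neg
    rw [mul_one] at h2
    exact h2.cexp.mul_const _
  refine (Complex.reCLM.hasFDerivAt.comp_hasDerivAt x h1).deriv.trans ?_
  simp only [Complex.reCLM_apply]
  congr 1
  ring

theorem dy_re_wave (k : ℤ) {Z Z' : ℝ → ℂ} (h : ∀ y, HasDerivAt Z (Z' y) y) :
    dy (fun p => (wave k Z p).re) = fun p => (wave k Z' p).re := by
  ext ⟨x, y⟩
  rw [dy_eq]
  have h1 : HasDerivAt (fun s => (wave k Z (x, s))) (wave k Z' (x, y)) y :=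
    (h y).const_mul (fourier (-k) x : ℂ)
  exact (Complex.reCLM.hasFDerivAt.comp_hasDerivAt y h1).deriv

theorem dyt_re_wave (k : ℤ) (t : ℝ) {Z Z' : ℝ → ℂ} (h : ∀ y, HasDerivAt Z (Z' y) y) :
    dyt t (fun p => (wave k Z p).re)
      = fun p => (wave k (fun y => Z' y + Complex.I * k * t * Z y) p).re := by
  ext p
  rw [dyt, dy_re_wave k h, dx_re_wave]
  simp only
  rw [wave_add, wave_const_mul, wave_const_mul, Complex.add_re, sub_eq_add_neg]
  congr 1
  rw [← Complex.re_ofReal_mul, ← Complex.neg_re]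
  congr 1
  ring

theorem dyt_dyt_re_wave (k : ℤ) (t : ℝ) {Z Z1 Z2 : ℝ → ℂ} (h : ∀ y, HasDerivAt Z (Z1 y) y)
    (h1 : ∀ y, HasDerivAt Z1 (Z2 y) y) :
    dyt t (dyt t (fun p => (wave k Z p).re))
      = fun p => (wave k (fun y => Z2 y + (2 * (Complex.I * k * t) * Z1 y
        + (Complex.I * k * t) ^ 2 * Z y)) p).re := by
  have h2 : ∀ y, HasDerivAt (fun y => Z1 y + Complex.I * k * t * Z y)
      (Z2 y + Complex.I * k * t * Z1 y) y := fun y => (h1 y).add ((h y).const_mul _)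
  rw [dyt_re_wave k t h, dyt_re_wave k t h2]
  ext p
  congr 2
  ext y
  ring

/-- Real test functions see only real parts; multiplying the profile by -i recovers the imaginary
part. -/
theorem hasDerivAt_of_re {f : ℝ → ℂ} {d : ℂ} {t : ℝ} (h1 : HasDerivAt (fun s => (f s).re) d.re t)
    (h2 : HasDerivAt (fun s => (-Complex.I * f s).re) (-Complex.I * d).re t) :
    HasDerivAt f d t := by
  have e : ∀ z : ℂ, (z.re : ℂ) + Complex.I * ((-Complex.I * z).re : ℝ) = z := by
    intro z
    apply Complex.ext <;> simp
  have h := h1.ofReal_comp.add (h2.ofReal_comp.const_mul Complex.I)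
  rw [e] at h
  refine h.congr_of_eventuallyEq (Eventually.of_forall fun s => ?_)
  exact (e (f s)).symm

theorem IsBump.contDiff_xft {χ : ℝ → ℂ} (h : IsBump χ) : ContDiff ℝ ∞ (xft χ) := by
  obtain ⟨f, -, hf⟩ := h.exists_schwartz
  have : xft χ = 𝓕 f := funext fun y => (hf y).symm
  rw [this]
  exact (𝓕 f).smooth _

theorem IsBump.deriv {χ : ℝ → ℂ} (h : IsBump χ) : IsBump (deriv χ) :=
  ⟨(contDiff_infty_iff_deriv.1 h.smooth).2, h.compact.deriv⟩

theorem IsBump.hasDerivAt {χ : ℝ → ℂ} (h : IsBump χ) (y : ℝ) :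
    HasDerivAt χ (_root_.deriv χ y) y :=
  (h.smooth.differentiable (by simp) y).hasDerivAt

theorem IsBump.exists_bound {χ : ℝ → ℂ} (h : IsBump χ) : ∃ C, ∀ y, ‖χ y‖ ≤ C :=
  h.compact.exists_bound_of_continuous h.smooth.continuous

theorem exists_isBump_one : ∃ χ : ℝ → ℂ, IsBump χ ∧ χ 0 = 1 := by
  let f : ContDiffBump (0 : ℝ) := ⟨1, 2, one_pos, one_lt_two⟩
  refine ⟨fun y => (f y : ℂ), ⟨Complex.ofRealCLM.contDiff.comp f.contDiff,
    f.hasCompactSupport.comp_left (g := Complex.ofReal) Complex.ofReal_zero⟩, ?_⟩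
  have : f 0 = 1 := f.one_of_mem_closedBall (Metric.mem_closedBall_self zero_le_one)
  simp [this]

theorem tendsto_eLpNorm_sub_of_dominated {F : ℕ → ℝ → ℂ} {G : ℝ → ℂ} {bound : ℝ → ℝ}
    (hF : ∀ i, MemLp (F i) 2 volume) (hG : MemLp G 2 volume) (hbound : MemLp bound 2 volume)
    (hle : ∀ i x, ‖F i x‖ ≤ bound x) (hlim : ∀ x, Tendsto (fun i => F i x) atTop (𝓝 (G x))) :
    Tendsto (fun n => (eLpNorm (fun x => F n x - G x) 2 volume).toReal) atTop (𝓝 0) := by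
  have h := tendsto_toLp_of_dominated hF hG hbound (Eventually.of_forall hle) hlim
  rw [tendsto_iff_norm_sub_tendsto_zero] at h
  refine h.congr fun n => ?_
  rw [← MemLp.toLp_sub, Lp.norm_toLp]
  rfl

/-- Smooth cutoffs of the transform of a bump function, with two derivatives. -/
theorem IsBump.exists_cutoff {χ : ℝ → ℂ} (h : IsBump χ) {X1 X2 : ℝ → ℂ}
    (hX1 : ∀ y, HasDerivAt (xft χ) (X1 y) y) (hX2 : ∀ y, HasDerivAt X1 (X2 y) y)
    (hL1 : MemLp X1 2 volume) (hL2 : MemLp X2 2 volume) :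
    ∃ (Z Z1 Z2 : ℕ → ℝ → ℂ) (ε : ℕ → ℝ), Tendsto ε atTop (𝓝 0) ∧ ∀ n, IsBump (Z n) ∧
      IsBump (Z1 n) ∧ IsBump (Z2 n) ∧
      (∀ y, HasDerivAt (Z n) (Z1 n y) y) ∧ (∀ y, HasDerivAt (Z1 n) (Z2 n y) y) ∧
      (eLpNorm (fun y => Z n y - xft χ y) 2 volume).toReal ≤ ε n ∧
      (eLpNorm (fun y => Z1 n y - X1 y) 2 volume).toReal ≤ ε n ∧
      (eLpNorm (fun y => Z2 n y - X2 y) 2 volume).toReal ≤ ε n := by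
  obtain ⟨K, hK, hK0⟩ := exists_isBump_one
  obtain ⟨M0, hM0⟩ := hK.exists_bound
  obtain ⟨M1, hM1⟩ := hK.deriv.exists_bound
  obtain ⟨M2, hM2⟩ := hK.deriv.deriv.exists_bound
  have hM0p : 0 ≤ M0 := (norm_nonneg _).trans (hM0 0)
  have hM1p : 0 ≤ M1 := (norm_nonneg _).trans (hM1 0)
  have hM2p : 0 ≤ M2 := (norm_nonneg _).trans (hM2 0)
  set X := xft χ with hX
  -- The cutoffs are K(y/(n+1)) with K(0) = 1. Each derivative falling on K brings a factor r(n) →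
  -- 0, so Z, Z' and Z'' converge in L² to those of `xft χ`.
  set r : ℕ → ℝ := fun n => 1 / ((n : ℝ) + 1) with hr
  have hr0 : ∀ n, 0 < r n := fun n => by positivity
  have hr1 : ∀ n, r n ≤ 1 := fun n => by
    rw [hr]
    simp only
    rw [div_le_one (by positivity)]
    linarith [(Nat.cast_nonneg n : (0 : ℝ) ≤ n)]
  have hrl : Tendsto r atTop (𝓝 0) := tendsto_one_div_add_atTop_nhds_zero_nat
  have hd : ∀ {f : ℝ → ℂ}, IsBump f → ∀ n y, HasDerivAt (fun y => f (r n * y))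
      (r n * _root_.deriv f (r n * y)) y := fun {f} hf n y => by
    have h1 : HasDerivAt (fun y => r n * y) (r n) y := by
      simpa using (hasDerivAt_id y).const_mul (r n)
    have := (hf.hasDerivAt (r n * y)).scomp y h1
    simpa [Function.comp_def] using this
  have hlim : ∀ {f : ℝ → ℂ}, IsBump f → ∀ y, Tendsto (fun n => f (r n * y)) atTop (𝓝 (f 0)) :=
    fun {f} hf y => by
      have h1 : Tendsto (fun n => r n * y) atTop (𝓝 0) := by simpa using hrl.mul_const y
      exact (hf.smooth.continuous.tendsto 0).comp h1
  have hrc : Tendsto (fun n => (r n : ℂ)) atTop (𝓝 0) := by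
    simpa [Function.comp_def] using (Complex.continuous_ofReal.tendsto 0).comp hrl
  have hnr : ∀ n, ‖(r n : ℂ)‖ ≤ 1 := fun n => by
    rw [Complex.norm_real, Real.norm_of_nonneg (hr0 n).le]; exact hr1 n
  set Z : ℕ → ℝ → ℂ := fun n y => K (r n * y) * X y with hZ
  set Z1 : ℕ → ℝ → ℂ := fun n y => r n * _root_.deriv K (r n * y) * X y + K (r n * y) * X1 y with hZ1
  set Z2 : ℕ → ℝ → ℂ := fun n y => (r n * (r n * _root_.deriv (_root_.deriv K) (r n * y)) * X y
    + r n * _root_.deriv K (r n * y) * X1 y)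
    + (r n * _root_.deriv K (r n * y) * X1 y + K (r n * y) * X2 y) with hZ2
  have hZb : ∀ n, IsBump (Z n) := fun n => by
    refine ⟨(hK.smooth.comp (contDiff_const.mul contDiff_id)).mul h.contDiff_xft, ?_⟩
    exact (hK.compact.comp_homeomorph (Homeomorph.mulLeft₀ (r n) (hr0 n).ne')).mul_right
  have hZd : ∀ n y, HasDerivAt (Z n) (Z1 n y) y := fun n y => (hd hK n y).mul (hX1 y)
  have hZ1d : ∀ n y, HasDerivAt (Z1 n) (Z2 n y) y := fun n y =>
    (((hd hK.deriv n y).const_mul _).mul (hX1 y)).add ((hd hK n y).mul (hX2 y))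
  have hZ1b : ∀ n, IsBump (Z1 n) := fun n => by
    have : Z1 n = _root_.deriv (Z n) := funext fun y => (hZd n y).deriv.symm
    rw [this]; exact (hZb n).deriv
  have hZ2b : ∀ n, IsBump (Z2 n) := fun n => by
    have : Z2 n = _root_.deriv (Z1 n) := funext fun y => (hZ1d n y).deriv.symm
    rw [this]; exact (hZ1b n).deriv
  have hLX : MemLp X 2 volume := h.memLp_xft
  have t0 := tendsto_eLpNorm_sub_of_dominated (G := X) (fun n => (hZb n).memLp) hLX
    (hLX.norm.const_mul M0) (fun n y => by
      rw [hZ]; simp only [norm_mul]; gcongr; exact hM0 _) fun y => by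
      simpa [hK0] using (hlim hK y).mul_const (X y)
  have t1 := tendsto_eLpNorm_sub_of_dominated (G := X1) (fun n => (hZ1b n).memLp) hL1
    ((hLX.norm.const_mul M1).add (hL1.norm.const_mul M0)) (fun n y => by
      refine (norm_add_le _ _).trans ?_
      simp only [norm_mul, Pi.add_apply]
      gcongr
      · calc ‖(r n : ℂ)‖ * ‖_root_.deriv K (r n * y)‖ ≤ 1 * M1 := by gcongr; exacts [hnr n, hM1 _]
          _ = M1 := one_mul _
      · exact hM0 _) fun y => by
      simpa [hK0] using ((hrc.mul (hlim hK.deriv y)).mul_const (X y)).add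
        ((hlim hK y).mul_const (X1 y))
  have t2 := tendsto_eLpNorm_sub_of_dominated (G := X2) (fun n => (hZ2b n).memLp) hL2
    (((hLX.norm.const_mul M2).add (hL1.norm.const_mul M1)).add
      ((hL1.norm.const_mul M1).add (hL2.norm.const_mul M0))) (fun n y => by
      have b1 : ‖(r n : ℂ)‖ * ‖_root_.deriv K (r n * y)‖ ≤ M1 := by
        calc _ ≤ 1 * M1 := by gcongr; exacts [hnr n, hM1 _]
          _ = M1 := one_mul _
      have b2 : ‖(r n : ℂ)‖ * (‖(r n : ℂ)‖ * ‖_root_.deriv (_root_.deriv K) (r n * y)‖) ≤ M2 := by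
        calc _ ≤ 1 * (1 * M2) := by gcongr; exacts [hnr n, hnr n, hM2 _]
          _ = M2 := by ring
      refine (norm_add_le _ _).trans (add_le_add ((norm_add_le _ _).trans ?_)
        ((norm_add_le _ _).trans ?_))
      · simp only [norm_mul, Pi.add_apply]
        gcongr
      · simp only [norm_mul, Pi.add_apply]
        gcongr
        exact hM0 _) fun y => by
      simpa [hK0] using (((hrc.mul (hrc.mul (hlim hK.deriv.deriv y))).mul_const (X y)).add
        ((hrc.mul (hlim hK.deriv y)).mul_const (X1 y))).add
        (((hrc.mul (hlim hK.deriv y)).mul_const (X1 y)).add ((hlim hK y).mul_const (X2 y)))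
  refine ⟨Z, Z1, Z2, _, by simpa using (t0.add t1).add t2, fun n => ⟨hZb n, hZ1b n, hZ2b n, hZd n,
    hZ1d n, ?_, ?_, ?_⟩⟩
  · rw [add_assoc]
    exact le_add_of_nonneg_right (by positivity)
  · rw [add_right_comm]
    exact le_add_of_nonneg_left (by positivity)
  · exact le_add_of_nonneg_left (by positivity)

/-! ### Weak solutions in Fourier variables -/

/-- Continuity of M makes the convergence of the derivatives locally uniform on (0,∞), which allows
differentiation of the limit. -/
theorem hasDerivAt_of_approx {c c' : ℕ → ℝ → ℂ} {C d : ℝ → ℂ} {M : ℝ → ℝ} {ε : ℕ → ℝ}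
    (hc : ∀ n t, 0 < t → HasDerivAt (c n) (c' n t) t)
    (hC : ∀ t, 0 < t → Tendsto (fun n => c n t) atTop (𝓝 (C t)))
    (hd : ∀ n t, 0 < t → ‖c' n t - d t‖ ≤ M t * ε n) (hM : ContinuousOn M (Ici 0))
    (hε : Tendsto ε atTop (𝓝 0)) {t : ℝ} (ht : 0 < t) : HasDerivAt C (d t) t := by
  refine hasDerivAt_of_tendstoLocallyUniformlyOn (s := Ioi 0) isOpen_Ioi (f := c) (f' := c') ?_
    (Eventually.of_forall fun n x hx => hc n x hx) (fun x hx => hC x hx) ht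
  rw [Metric.tendstoLocallyUniformlyOn_iff]
  intro e he x hx
  have hMx : ContinuousAt M x := hM.continuousAt (Ici_mem_nhds hx)
  have h1 : ∀ᶠ y in 𝓝 x, |M y| < |M x| + 1 :=
    hMx.abs.eventually_lt continuousAt_const (by linarith)
  refine ⟨_, inter_mem (mem_nhdsWithin_of_mem_nhds h1) self_mem_nhdsWithin, ?_⟩
  have h2 : ∀ᶠ n in atTop, (|M x| + 1) * |ε n| < e := by
    have : Tendsto (fun n => (|M x| + 1) * |ε n|) atTop (𝓝 0) := by
      simpa using hε.abs.const_mul (|M x| + 1)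
    exact this.eventually_lt_const he
  filter_upwards [h2] with n hn y hy
  rw [dist_comm, dist_eq_norm]
  calc ‖c' n y - d y‖ ≤ |M y * ε n| := (hd n y hy.2).trans (le_abs_self _)
    _ ≤ (|M x| + 1) * |ε n| := by
      rw [abs_mul]
      gcongr
      exact le_of_lt hy.1
    _ < e := hn

theorem wavePair_xft (u : L2) (k : ℤ) {χ : ℝ → ℂ} (hχ : IsBump χ) :
    wavePair u k (xft χ) = (2 * π : ℂ) * ∫ ξ, modeL k (hat u) ξ * χ ξ := by
  rw [wavePair, integral_mul_wave_xft u k hχ]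
  congr 1
  refine integral_congr_ae ?_
  filter_upwards [coeFn_modeL_hat k u] with ξ hξ
  rw [hξ]

theorem norm_wavePair_sub_le (u : L2) (k : ℤ) {Y Z : ℝ → ℂ} (hY : MemLp Y 2 volume)
    (hZ : MemLp Z 2 volume) {e : ℝ} (h : (eLpNorm (fun y => Y y - Z y) 2 volume).toReal ≤ e) :
    ‖wavePair u k Y - wavePair u k Z‖ ≤ 2 * π * ‖modeL k (hat u)‖ * e := by
  rw [← wavePair_sub u k hY hZ]
  exact (norm_wavePair_le u k (hY.sub hZ)).trans (by gcongr; exact h)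

theorem tendsto_wavePair (u : L2) (k : ℤ) {Y : ℕ → ℝ → ℂ} {Z : ℝ → ℂ}
    (hY : ∀ n, MemLp (Y n) 2 volume) (hZ : MemLp Z 2 volume) {ε : ℕ → ℝ}
    (hε : Tendsto ε atTop (𝓝 0))
    (h : ∀ n, (eLpNorm (fun y => Y n y - Z y) 2 volume).toReal ≤ ε n) :
    Tendsto (fun n => wavePair u k (Y n)) atTop (𝓝 (wavePair u k Z)) := by
  rw [tendsto_iff_norm_sub_tendsto_zero]
  refine squeeze_zero (fun _ => norm_nonneg _)
    (fun n => norm_wavePair_sub_le u k (hY n) hZ (h n)) ?_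
  simpa using hε.const_mul (2 * π * ‖modeL k (hat u)‖)

/-- The pairing of `u` with `(∂_y - t∂ₓ)²` applied to the wave with profile `Y`, in terms of the
derivatives `Y1`, `Y2` of `Y`. -/
def dytPair (u : L2) (k : ℤ) (t : ℝ) (Y Y1 Y2 : ℝ → ℂ) : ℂ :=
  wavePair u k Y2 + (2 * (Complex.I * k * t) * wavePair u k Y1
    + (Complex.I * k * t) ^ 2 * wavePair u k Y)

theorem integral_mul_dyt_dyt_re_wave (u : L2) (k : ℤ) (t : ℝ) {Y Y1 Y2 : ℝ → ℂ}
    (h : ∀ y, HasDerivAt Y (Y1 y) y) (h1 : ∀ y, HasDerivAt Y1 (Y2 y) y) (hY : MemLp Y 2 volume)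
    (hY1 : MemLp Y1 2 volume) (hY2 : MemLp Y2 2 volume) :
    ∫ p, u p * dyt t (dyt t (fun p => (wave k Y p).re)) p = (dytPair u k t Y Y1 Y2).re := by
  have h3 := (hY1.const_mul (2 * (Complex.I * k * t))).add (hY.const_mul ((Complex.I * k * t) ^ 2))
  have h4 := hY2.add h3
  rw [dyt_dyt_re_wave k t h h1]
  refine (integral_mul_re_wave u k h4).trans ?_
  congr 1
  have e1 := wavePair_add u k hY2 h3
  have e2 := wavePair_add u k (hY1.const_mul (2 * (Complex.I * k * t)))
    (hY.const_mul ((Complex.I * k * t) ^ 2))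
  rw [wavePair_const_mul, wavePair_const_mul] at e2
  rw [dytPair, ← e2]
  exact e1

theorem integral_mul_dx_re_wave (u : L2) (k : ℤ) {Y : ℝ → ℂ} (hY : MemLp Y 2 volume) :
    ∫ p, u p * dx (fun p => (wave k Y p).re) p = (-(Complex.I * k) * wavePair u k Y).re := by
  rw [dx_re_wave, ← wavePair_const_mul, ← integral_mul_re_wave u k (hY.const_mul _)]

theorem integral_mul_lap_re_wave (u : L2) (k : ℤ) (t : ℝ) {Y Y1 Y2 : ℝ → ℂ} (hb : IsBump Y)
    (h : ∀ y, HasDerivAt Y (Y1 y) y) (h1 : ∀ y, HasDerivAt Y1 (Y2 y) y)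
    (hY1 : MemLp Y1 2 volume) (hY2 : MemLp Y2 2 volume) :
    ∫ p, u p * lap t (fun p => (wave k Y p).re) p
      = (-(k : ℂ) ^ 2 * wavePair u k Y + dytPair u k t Y Y1 Y2).re := by
  have ht := isTest_re_wave k hb
  rw [Complex.add_re, ← integral_mul_dyt_dyt_re_wave u k t h h1 hb.memLp hY1 hY2]
  have hi : ∀ {ψ : Dom → ℝ}, IsTest ψ → Integrable (fun p => u p * ψ p) := fun hψ =>
    (Lp.memLp u).integrable_mul hψ.memLp
  have e : (-(k : ℂ) ^ 2 * wavePair u k Y).re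
      = ∫ p, u p * dx (dx (fun p => (wave k Y p).re)) p := by
    rw [dx_re_wave, integral_mul_dx_re_wave u k (hb.memLp.const_mul _), wavePair_const_mul]
    congr 1
    linear_combination (-(k : ℂ) ^ 2 * wavePair u k Y) * Complex.I_sq
  rw [e, ← integral_add (hi ht.dx.dx) (hi ((ht.dyt t).dyt t))]
  refine integral_congr_ae (Eventually.of_forall fun p => ?_)
  simp only [lap]
  ring

theorem dytPair_const_mul (u : L2) (k : ℤ) (t : ℝ) (c : ℂ) (Y Y1 Y2 : ℝ → ℂ) :
    dytPair u k t (fun y => c * Y y) (fun y => c * Y1 y) (fun y => c * Y2 y)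
      = c * dytPair u k t Y Y1 Y2 := by
  simp only [dytPair, wavePair_const_mul]
  ring

theorem dytPair_xft (u : L2) (k : ℤ) (t : ℝ) {χ : ℝ → ℂ} (hχ : IsBump χ) :
    dytPair u k t (xft χ) (xft (fun ξ => -(Complex.I * ξ) * χ ξ))
        (xft (fun ξ => -(Complex.I * ξ) * (-(Complex.I * ξ) * χ ξ)))
      = (2 * π : ℂ) * ∫ ξ, modeL k (hat u) ξ * (((-(ξ - k * t) ^ 2 : ℝ) : ℂ) * χ ξ) := by
  have h1 : IsBump (fun ξ => -(Complex.I * ξ) * χ ξ) := by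
    simpa only [neg_mul] using hχ.id_mul (-Complex.I)
  have h2 : IsBump (fun ξ => -(Complex.I * ξ) * (-(Complex.I * ξ) * χ ξ)) := by
    simpa only [neg_mul] using h1.id_mul (-Complex.I)
  have hm := Lp.memLp (modeL k (hat u))
  have i0 := integrable_mul_of_memLp hm hχ.memLp
  have i1 := integrable_mul_of_memLp hm h1.memLp
  have i2 := integrable_mul_of_memLp hm h2.memLp
  rw [dytPair, wavePair_xft u k hχ, wavePair_xft u k h1, wavePair_xft u k h2]
  have e : ∫ ξ, modeL k (hat u) ξ * (((-(ξ - k * t) ^ 2 : ℝ) : ℂ) * χ ξ)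
      = (∫ ξ, modeL k (hat u) ξ * (-(Complex.I * ξ) * (-(Complex.I * ξ) * χ ξ)))
        + (2 * (Complex.I * k * t) * (∫ ξ, modeL k (hat u) ξ * (-(Complex.I * ξ) * χ ξ))
        + (Complex.I * k * t) ^ 2 * ∫ ξ, modeL k (hat u) ξ * χ ξ) := by
    have i3 : Integrable (fun ξ : ℝ =>
        2 * (Complex.I * k * t) * (modeL k (hat u) ξ * (-(Complex.I * ξ) * χ ξ))
        + (Complex.I * k * t) ^ 2 * (modeL k (hat u) ξ * χ ξ)) :=
      (i1.const_mul _).add (i0.const_mul _)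
    rw [← integral_const_mul, ← integral_const_mul,
      ← integral_add (i1.const_mul _) (i0.const_mul _), ← integral_add i2 i3]
    refine integral_congr_ae (Eventually.of_forall fun ξ => ?_)
    simp only
    push_cast
    linear_combination (-(modeL k (hat u) ξ * χ ξ * (ξ - k * t) ^ 2)) * Complex.I_sq
  rw [e]
  ring

/-! ### From the weak formulation to the modes: the potential q and the equation of ω. -/

section

theorem IsBump.xft_package {χ : ℝ → ℂ} (hχ : IsBump χ) :
    IsBump (fun ξ => -(Complex.I * ξ) * χ ξ) ∧
      IsBump (fun ξ => -(Complex.I * ξ) * (-(Complex.I * ξ) * χ ξ)) := by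
  have h1 : IsBump (fun ξ => -(Complex.I * ξ) * χ ξ) := by
    simpa only [neg_mul] using hχ.id_mul (-Complex.I)
  exact ⟨h1, by simpa only [neg_mul] using h1.id_mul (-Complex.I)⟩

/-- The profile of `∂ₓ² Δ_t⁻¹ ω` in Fourier variables. -/
theorem IsDxxInvLap.mode_eq {t : ℝ} {w q : L2} (h : IsDxxInvLap t w q) {k : ℤ} (hk : k ≠ 0) :
    modeL k (hat q) =ᵐ[volume] fun ξ => (res k t ξ : ℂ) * modeL k (hat w) ξ := by
  have hk' : (k : ℝ) ≠ 0 := by exact_mod_cast hk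
  have hq2 : LocallyIntegrable (modeL k (hat q)) := (Lp.memLp _).locallyIntegrable one_le_two
  have hw2 : LocallyIntegrable (modeL k (hat w)) := (Lp.memLp _).locallyIntegrable one_le_two
  have key : (fun ξ : ℝ => ((-((k : ℝ) ^ 2 + (ξ - k * t) ^ 2) : ℝ) : ℂ) * modeL k (hat q) ξ)
      =ᵐ[volume] fun ξ => ((-(k : ℝ) ^ 2 : ℝ) : ℂ) * modeL k (hat w) ξ := by
    refine ae_eq_of_forall_bump ?_ ?_ fun χ hχ => ?_
    · have hc : Continuous (fun ξ : ℝ => ((-((k : ℝ) ^ 2 + (ξ - k * t) ^ 2) : ℝ) : ℂ)) := by fun_prop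
      simpa only [smul_eq_mul] using hq2.continuous_smul hc
    · have hc : Continuous (fun ξ : ℝ => ((-(k : ℝ) ^ 2 : ℝ) : ℂ)) := continuous_const
      simpa only [smul_eq_mul] using hw2.continuous_smul hc
    obtain ⟨h1, h2⟩ := hχ.xft_package
    obtain ⟨Z, Z1, Z2, ε, hε, hZ⟩ := hχ.exists_cutoff hχ.hasDerivAt_xft h1.hasDerivAt_xft
      h1.memLp_xft h2.memLp_xft
    have hn : ∀ n, -(k : ℂ) ^ 2 * wavePair q k (Z n) + dytPair q k t (Z n) (Z1 n) (Z2 n)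
        = -(k : ℂ) ^ 2 * wavePair w k (Z n) := by
      intro n
      obtain ⟨b0, b1, b2, d0, d1, -⟩ := hZ n
      -- Testing with c·Z for c = 1 and c = -i gives the real and imaginary parts of the identity.
      have re_eq : ∀ c : ℂ, (c * (-(k : ℂ) ^ 2 * wavePair q k (Z n)
          + dytPair q k t (Z n) (Z1 n) (Z2 n))).re = (c * (-(k : ℂ) ^ 2 * wavePair w k (Z n))).re := by
        intro c
        have bc : ∀ {χ : ℝ → ℂ}, IsBump χ → IsBump (fun y => c * χ y) := fun hb =>
          ⟨contDiff_const.mul hb.smooth, hb.compact.mul_left⟩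
        have e := h _ (isTest_re_wave k (bc b0))
        rw [integral_mul_lap_re_wave q k t (bc b0) (fun y => (d0 y).const_mul c)
          (fun y => (d1 y).const_mul c) (bc b1).memLp (bc b2).memLp, dytPair_const_mul,
          dx_re_wave, integral_mul_dx_re_wave w k ((bc b0).memLp.const_mul _),
          wavePair_const_mul, wavePair_const_mul, wavePair_const_mul] at e
        rw [mul_add, mul_left_comm, e]
        congr 1
        linear_combination (k : ℂ) ^ 2 * c * wavePair w k (Z n) * Complex.I_sq
      refine Complex.ext (by simpa using re_eq 1) ?_
      simpa using re_eq (-Complex.I)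
    have tq0 := tendsto_wavePair q k (fun n => (hZ n).1.memLp) hχ.memLp_xft hε
      fun n => (hZ n).2.2.2.2.2.1
    have tq1 := tendsto_wavePair q k (fun n => (hZ n).2.1.memLp) h1.memLp_xft hε
      fun n => (hZ n).2.2.2.2.2.2.1
    have tq2 := tendsto_wavePair q k (fun n => (hZ n).2.2.1.memLp) h2.memLp_xft hε
      fun n => (hZ n).2.2.2.2.2.2.2
    have tw0 := tendsto_wavePair w k (fun n => (hZ n).1.memLp) hχ.memLp_xft hε
      fun n => (hZ n).2.2.2.2.2.1
    have lim := tendsto_nhds_unique (((tq0.const_mul (-(k : ℂ) ^ 2)).add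
      (tq2.add ((tq1.const_mul _).add (tq0.const_mul _)))).congr hn)
      (tw0.const_mul (-(k : ℂ) ^ 2))
    have lim2 : -(k : ℂ) ^ 2 * wavePair q k (xft χ) + dytPair q k t (xft χ)
        (xft (fun ξ => -(Complex.I * ξ) * χ ξ))
        (xft (fun ξ => -(Complex.I * ξ) * (-(Complex.I * ξ) * χ ξ)))
        = -(k : ℂ) ^ 2 * wavePair w k (xft χ) := lim
    rw [dytPair_xft q k t hχ, wavePair_xft q k hχ, wavePair_xft w k hχ] at lim2
    have hmq := Lp.memLp (modeL k (hat q))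
    have hb : IsBump (fun ξ : ℝ => ((-(ξ - k * t) ^ 2 : ℝ) : ℂ) * χ ξ) :=
      hχ.mul_left (contDiff_ofReal_comp (g := fun ξ : ℝ => -(ξ - k * t) ^ 2) (by fun_prop))
    have e1 : ∫ ξ, ((-((k : ℝ) ^ 2 + (ξ - k * t) ^ 2) : ℝ) : ℂ) * modeL k (hat q) ξ * χ ξ
        = -(k : ℂ) ^ 2 * (∫ ξ, modeL k (hat q) ξ * χ ξ)
          + ∫ ξ, modeL k (hat q) ξ * (((-(ξ - k * t) ^ 2 : ℝ) : ℂ) * χ ξ) := by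
      rw [← integral_const_mul, ← integral_add
        ((integrable_mul_of_memLp hmq hχ.memLp).const_mul _) (integrable_mul_of_memLp hmq hb.memLp)]
      refine integral_congr_ae (Eventually.of_forall fun ξ => ?_)
      simp only
      push_cast
      ring
    have e2 : ∫ ξ, ((-(k : ℝ) ^ 2 : ℝ) : ℂ) * modeL k (hat w) ξ * χ ξ
        = -(k : ℂ) ^ 2 * ∫ ξ, modeL k (hat w) ξ * χ ξ := by
      rw [← integral_const_mul]
      refine integral_congr_ae (Eventually.of_forall fun ξ => ?_)
      simp only
      push_cast
      ring
    rw [e1, e2]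
    refine mul_left_cancel₀ (b := _) (by simp [Real.pi_ne_zero] : (2 * π : ℂ) ≠ 0) ?_
    linear_combination lim2
  -- For k ≠ 0 the symbol k² + (ξ-kt)² never vanishes and may be divided out.
  filter_upwards [key] with ξ hξ
  have hpos : (k : ℝ) ^ 2 + (ξ - k * t) ^ 2 ≠ 0 := by positivity
  have hpos' : ((k : ℂ) ^ 2 + (ξ - k * t) ^ 2) ≠ 0 := by exact_mod_cast hpos
  rw [res]
  push_cast at hξ ⊢
  field_simp
  linear_combination -hξ

theorem IsDxxInvLap.norm_mode_le {t : ℝ} {w q : L2} (h : IsDxxInvLap t w q) {k : ℤ} (hk : k ≠ 0) :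
    ‖modeL k (hat q)‖ ≤ ‖modeL k (hat w)‖ := by
  refine Lp.norm_le_norm_of_ae_le ?_
  filter_upwards [h.mode_eq hk] with ξ hξ
  rw [hξ, norm_mul, Complex.norm_real, Real.norm_of_nonneg (res_nonneg _ _ _)]
  exact mul_le_of_le_one_left (norm_nonneg _) (res_le_one _ _ _)

variable {ν : ℝ} {T : ℝ → ℝ} {ω₀ θ₀ : L2} {w θ : ℝ → L2}

theorem IsSolution.hasDerivAt_wavePair (h : IsSolution ν T ω₀ θ₀ w θ) (k : ℤ)
    {Z Z1 Z2 : ℝ → ℂ} (b0 : IsBump Z) (b1 : IsBump Z1) (b2 : IsBump Z2)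
    (d0 : ∀ y, HasDerivAt Z (Z1 y) y) (d1 : ∀ y, HasDerivAt Z1 (Z2 y) y) {t : ℝ} (ht : 0 < t) :
    HasDerivAt (fun s => wavePair (w s) k Z)
      (ν * dytPair (w t) k t Z Z1 Z2 + Complex.I * k * wavePair (θ t) k Z) t := by
  have key : ∀ c : ℂ, HasDerivAt (fun s => (c * wavePair (w s) k Z).re)
      (c * (ν * dytPair (w t) k t Z Z1 Z2 + Complex.I * k * wavePair (θ t) k Z)).re t := by
    intro c
    have bc : ∀ {χ : ℝ → ℂ}, IsBump χ → IsBump (fun y => c * χ y) := fun hb =>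
      ⟨contDiff_const.mul hb.smooth, hb.compact.mul_left⟩
    have e := h.eq_ω _ (isTest_re_wave k (bc b0)) t ht
    rw [integral_mul_dyt_dyt_re_wave (w t) k t (fun y => (d0 y).const_mul c)
      (fun y => (d1 y).const_mul c) (bc b0).memLp (bc b1).memLp (bc b2).memLp, dytPair_const_mul,
      integral_mul_dx_re_wave (θ t) k (bc b0).memLp, wavePair_const_mul] at e
    simp only [integral_mul_re_wave _ k (bc b0).memLp, wavePair_const_mul] at e
    convert! e using 1
    rw [← Complex.re_ofReal_mul, ← Complex.sub_re]
    congr 1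
    ring
  exact hasDerivAt_of_re (by simpa using key 1) (key (-Complex.I))

/-- The equation is tested with cutoffs of e^{-ikx}`xft χ` and the cutoff is removed. The error is
at most ε(n) times a function of t that is continuous because ω and θ are continuous in L². -/
theorem IsSolution.hasDerivAt_mode_a (h : IsSolution ν T ω₀ θ₀ w θ) (hν : 0 < ν) (k : ℤ)
    {χ : ℝ → ℂ} (hχ : IsBump χ) {t : ℝ} (ht : 0 < t) :
    HasDerivAt (fun s => ∫ ξ, modeL k (hat (w s)) ξ * χ ξ)
      (ν * (∫ ξ, modeL k (hat (w t)) ξ * (((-(ξ - k * t) ^ 2 : ℝ) : ℂ) * χ ξ))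
        + Complex.I * k * ∫ ξ, modeL k (hat (θ t)) ξ * χ ξ) t := by
  obtain ⟨h1, h2⟩ := hχ.xft_package
  obtain ⟨Z, Z1, Z2, ε, hε, hZ⟩ := hχ.exists_cutoff hχ.hasDerivAt_xft h1.hasDerivAt_xft
    h1.memLp_xft h2.memLp_xft
  have hcw : ContinuousOn (fun s => ‖modeL k (hat (w s))‖) (Ici 0) :=
    (((modeL k).continuous.comp hat.continuous).comp_continuousOn h.cont_ω).norm
  have hcθ : ContinuousOn (fun s => ‖modeL k (hat (θ s))‖) (Ici 0) :=
    (((modeL k).continuous.comp hat.continuous).comp_continuousOn h.cont_θ).norm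
  have key := hasDerivAt_of_approx (c := fun n s => wavePair (w s) k (Z n))
    (c' := fun n t => ν * dytPair (w t) k t (Z n) (Z1 n) (Z2 n)
      + Complex.I * k * wavePair (θ t) k (Z n))
    (C := fun s => wavePair (w s) k (xft χ))
    (d := fun t => ν * dytPair (w t) k t (xft χ) (xft (fun ξ => -(Complex.I * ξ) * χ ξ))
        (xft (fun ξ => -(Complex.I * ξ) * (-(Complex.I * ξ) * χ ξ)))
      + Complex.I * k * wavePair (θ t) k (xft χ))
    (M := fun t => 2 * π * (ν * ((1 + (2 * (|(k : ℝ)| * |t|) + (|(k : ℝ)| * |t|) ^ 2))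
        * ‖modeL k (hat (w t))‖) + |(k : ℝ)| * ‖modeL k (hat (θ t))‖))
    (fun n t ht => h.hasDerivAt_wavePair k (hZ n).1 (hZ n).2.1 (hZ n).2.2.1 (hZ n).2.2.2.1
      (hZ n).2.2.2.2.1 ht)
    (fun t _ => tendsto_wavePair (w t) k (fun n => (hZ n).1.memLp) hχ.memLp_xft hε
      fun n => (hZ n).2.2.2.2.2.1) ?_ ?_ hε ht
  · simp only [dytPair_xft _ k _ hχ, wavePair_xft _ k hχ] at key
    have h2π : (2 * π : ℂ) ≠ 0 := by simp [Real.pi_ne_zero]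
    have := key.const_mul (2 * π : ℂ)⁻¹
    simp only [inv_mul_cancel_left₀ h2π] at this
    refine this.congr_deriv ?_
    field_simp
  · intro n t _
    obtain ⟨b0, b1, b2, d0, d1, n0, n1, n2⟩ := hZ n
    have w0 := norm_wavePair_sub_le (w t) k b0.memLp hχ.memLp_xft n0
    have w1 := norm_wavePair_sub_le (w t) k b1.memLp h1.memLp_xft n1
    have w2 := norm_wavePair_sub_le (w t) k b2.memLp h2.memLp_xft n2
    have t0 := norm_wavePair_sub_le (θ t) k b0.memLp hχ.memLp_xft n0
    have e : ν * dytPair (w t) k t (Z n) (Z1 n) (Z2 n) + Complex.I * k * wavePair (θ t) k (Z n)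
        - (ν * dytPair (w t) k t (xft χ) (xft (fun ξ => -(Complex.I * ξ) * χ ξ))
        (xft (fun ξ => -(Complex.I * ξ) * (-(Complex.I * ξ) * χ ξ)))
      + Complex.I * k * wavePair (θ t) k (xft χ))
      = ν * ((wavePair (w t) k (Z2 n)
          - wavePair (w t) k (xft (fun ξ => -(Complex.I * ξ) * (-(Complex.I * ξ) * χ ξ))))
        + (2 * (Complex.I * k * t) * (wavePair (w t) k (Z1 n)
          - wavePair (w t) k (xft (fun ξ => -(Complex.I * ξ) * χ ξ)))
        + (Complex.I * k * t) ^ 2 * (wavePair (w t) k (Z n) - wavePair (w t) k (xft χ))))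
        + Complex.I * k * (wavePair (θ t) k (Z n) - wavePair (θ t) k (xft χ)) := by
      simp only [dytPair]
      ring
    have hkt : ‖(Complex.I * k * t : ℂ)‖ = |(k : ℝ)| * |t| := by
      rw [norm_mul, norm_mul, Complex.norm_I, one_mul, Complex.norm_real, Complex.norm_intCast]
      rfl
    have hk1 : ‖(Complex.I * k : ℂ)‖ = |(k : ℝ)| := by
      rw [norm_mul, Complex.norm_I, one_mul, Complex.norm_intCast]
    rw [e]
    calc _ ≤ ν * (2 * π * ‖modeL k (hat (w t))‖ * ε n
          + (2 * (|(k : ℝ)| * |t|) * (2 * π * ‖modeL k (hat (w t))‖ * ε n)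
          + (|(k : ℝ)| * |t|) ^ 2 * (2 * π * ‖modeL k (hat (w t))‖ * ε n)))
          + |(k : ℝ)| * (2 * π * ‖modeL k (hat (θ t))‖ * ε n) := by
          refine (norm_add_le _ _).trans (add_le_add ?_ ?_)
          · rw [norm_mul, Complex.norm_real, Real.norm_of_nonneg hν.le]
            gcongr
            refine (norm_add_le _ _).trans (add_le_add w2
              ((norm_add_le _ _).trans (add_le_add ?_ ?_)))
            · rw [norm_mul, norm_mul, hkt]
              simp only [Complex.norm_ofNat]
              gcongr
            · rw [norm_mul, norm_pow, hkt]
              gcongr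
          · rw [norm_mul, hk1]
            gcongr
      _ = _ := by ring
  · refine continuousOn_const.mul ((continuousOn_const.mul (ContinuousOn.mul ?_ hcw)).add
      (continuousOn_const.mul hcθ))
    fun_prop

end

/-! ### Multiplication by T' as a convolution, and the equation of b. -/

section

namespace HasFourierMeasure

variable {f : ℝ → ℝ} {m : Measure ℝ} {g : ℝ → ℂ}

theorem norm_exp_eq_one (ξ y : ℝ) : ‖Complex.exp (Complex.I * ξ * y)‖ = 1 := by
  have : Complex.I * ξ * y = ((ξ * y : ℝ) : ℂ) * Complex.I := by push_cast; ring
  rw [this, Complex.norm_exp_ofReal_mul_I]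

theorem continuous (h : HasFourierMeasure f m g) : Continuous f := by
  have h1 : Continuous (fun y : ℝ => (f y : ℂ)) := by
    simp only [h.eq]
    refine continuous_of_dominated (bound := fun ξ => ‖g ξ‖) (fun y => ?_) (fun y => ?_)
      h.integrable.norm ?_
    · have : Continuous (fun ξ : ℝ => Complex.exp (Complex.I * ξ * y)) := by fun_prop
      exact this.aestronglyMeasurable.mul h.integrable.1
    · refine Eventually.of_forall fun ξ => ?_
      rw [norm_mul, norm_exp_eq_one, one_mul]
    · exact Eventually.of_forall fun ξ => by fun_prop
  exact (Complex.continuous_re.comp h1)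

theorem abs_le (h : HasFourierMeasure f m g) (y : ℝ) : |f y| ≤ ∫ ξ, ‖g ξ‖ ∂m := by
  have : |f y| = ‖(f y : ℂ)‖ := by rw [Complex.norm_real]; rfl
  rw [this, h.eq]
  refine (norm_integral_le_integral_norm _).trans (le_of_eq ?_)
  simp only [norm_mul, norm_exp_eq_one, one_mul]

theorem memLp_mul (h : HasFourierMeasure f m g) {Y : ℝ → ℂ} (hY : MemLp Y 2 volume) :
    MemLp (fun y => (f y : ℂ) * Y y) 2 volume := by
  refine (hY.norm.const_mul (∫ ξ, ‖g ξ‖ ∂m)).of_le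
    ((Complex.continuous_ofReal.comp h.continuous).aestronglyMeasurable.mul hY.1)
    (Eventually.of_forall fun y => ?_)
  rw [norm_mul, Complex.norm_real, norm_mul, norm_norm]
  gcongr
  exact (h.abs_le y).trans (le_abs_self _)

theorem eLpNorm_mul_le (h : HasFourierMeasure f m g) {Y : ℝ → ℂ} (hY : MemLp Y 2 volume) :
    (eLpNorm (fun y => (f y : ℂ) * Y y) 2 volume).toReal
      ≤ (∫ ξ, ‖g ξ‖ ∂m) * (eLpNorm Y 2 volume).toReal := by
  have hM : 0 ≤ ∫ ξ, ‖g ξ‖ ∂m := integral_nonneg fun _ => norm_nonneg _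
  have h1 : eLpNorm (fun y => (f y : ℂ) * Y y) 2 volume
      ≤ ENNReal.ofReal (∫ ξ, ‖g ξ‖ ∂m) * eLpNorm Y 2 volume := by
    refine eLpNorm_le_mul_eLpNorm_of_ae_le_mul (Eventually.of_forall fun y => ?_) 2
    rw [norm_mul, Complex.norm_real]
    gcongr
    exact h.abs_le y
  have h2 := ENNReal.toReal_mono (ENNReal.mul_ne_top ENNReal.ofReal_ne_top hY.2.ne) h1
  rwa [ENNReal.toReal_mul, ENNReal.toReal_ofReal hM] at h2

/-- The total variation measure. -/
theorem isFiniteMeasure (h : HasFourierMeasure f m g) :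
    IsFiniteMeasure (m.withDensity fun η => ‖g η‖ₑ) :=
  isFiniteMeasure_withDensity h.integrable.2.ne

/-- Multiplication by `f` becomes convolution with its Fourier transform. -/
theorem wavePair_mul_xft [SigmaFinite m] (h : HasFourierMeasure f m g) (u : L2) (k : ℤ)
    {χ : ℝ → ℂ} (hχ : IsBump χ) :
    wavePair u k (fun y => (f y : ℂ) * xft χ y)
      = ∫ η, g η * wavePair u k (xft (fun ξ => χ (ξ + η))) ∂m := by
  have hF : Integrable (fun y => xMode u k y * xft χ y) :=
    integrable_mul_of_memLp (memLp_xMode u k) hχ.memLp_xft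
  have h1 : wavePair u k (fun y => (f y : ℂ) * xft χ y)
      = (2 * π : ℂ) * ∫ y : ℝ, ∫ η : ℝ, Complex.exp (Complex.I * η * y) * g η
        * (xMode u k y * xft χ y) ∂m := by
    rw [wavePair, integral_mul_wave u k (h.memLp_mul hχ.memLp_xft)]
    congr 1
    refine integral_congr_ae (Eventually.of_forall fun y => ?_)
    simp only
    rw [integral_mul_const, ← h.eq]
    ring
  rw [h1, integral_integral_swap, ← integral_const_mul]
  · refine integral_congr_ae (Eventually.of_forall fun η => ?_)
    simp only
    rw [wavePair, integral_mul_wave u k (hχ.comp_add η).memLp_xft, mul_left_comm (g η)]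
    congr 1
    rw [← integral_const_mul]
    refine integral_congr_ae (Eventually.of_forall fun y => ?_)
    simp only
    rw [← exp_mul_xft]
    ring
  · have h2 : Integrable (Function.uncurry fun (y η : ℝ) => (xMode u k y * xft χ y) * g η)
        (volume.prod m) := hF.mul_prod h.integrable
    have hc : Continuous (Function.uncurry fun (y η : ℝ) => Complex.exp (Complex.I * η * y)) := by
      unfold Function.uncurry
      fun_prop
    refine h2.mono ?_ (Eventually.of_forall fun p => ?_)
    · have := hc.aestronglyMeasurable.mul h2.1 (μ := (volume : Measure ℝ).prod m)
      refine this.congr (Eventually.of_forall fun p => ?_)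
      simp only [Function.uncurry, Pi.mul_apply]
      ring
    · simp only [Function.uncurry, norm_mul, norm_exp_eq_one, one_mul]
      rw [mul_comm]

end HasFourierMeasure

variable {ν : ℝ} {T : ℝ → ℝ} {ω₀ θ₀ : L2} {w θ : ℝ → L2} {m : Measure ℝ} {g : ℝ → ℂ}

theorem wave_ofReal_mul (k : ℤ) (f : ℝ → ℝ) (Y : ℝ → ℂ) (p : Dom) :
    wave k (fun y => (f y : ℂ) * Y y) p = f p.2 * wave k Y p := mul_left_comm _ _ _

theorem hasDerivAt_wavePair_θ (hT : HasFourierMeasure (deriv T) m g) {q : ℝ → L2}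
    (hq : ∀ φ : Dom → ℝ, IsTest φ → ∀ t : ℝ, 0 < t →
      HasDerivAt (fun s => -∫ p, θ s p * dx φ p) (-∫ p, deriv T p.2 * q t p * φ p) t)
    (k : ℤ) {Z : ℝ → ℂ} (b0 : IsBump Z) {t : ℝ} (ht : 0 < t) :
    HasDerivAt (fun s => Complex.I * k * wavePair (θ s) k Z)
      (-wavePair (q t) k (fun y => ((deriv T y : ℝ) : ℂ) * Z y)) t := by
  have key : ∀ c : ℂ, HasDerivAt (fun s => (c * (Complex.I * k * wavePair (θ s) k Z)).re)
      (c * (-wavePair (q t) k (fun y => ((deriv T y : ℝ) : ℂ) * Z y))).re t := by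
    intro c
    have bc : IsBump (fun y => c * Z y) := ⟨contDiff_const.mul b0.smooth, b0.compact.mul_left⟩
    have e := hq _ (isTest_re_wave k bc) t ht
    simp only [integral_mul_dx_re_wave _ k bc.memLp, wavePair_const_mul] at e
    have e2 : ∫ p, deriv T p.2 * q t p * (wave k (fun y => c * Z y) p).re
        = (c * wavePair (q t) k (fun y => ((deriv T y : ℝ) : ℂ) * Z y)).re := by
      rw [← wavePair_const_mul, ← integral_mul_re_wave (q t) k ((hT.memLp_mul b0.memLp).const_mul c)]
      refine integral_congr_ae (Eventually.of_forall fun p => ?_)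
      simp only
      rw [wave_const_mul, wave_const_mul, wave_ofReal_mul, mul_left_comm c, Complex.re_ofReal_mul]
      ring
    rw [e2] at e
    convert! e using 1
    · ext s
      rw [← Complex.neg_re]
      congr 1
      ring
    · rw [mul_neg, Complex.neg_re]
  exact hasDerivAt_of_re (by simpa using key 1) (key (-Complex.I))

/-- No continuity in time is known for q, so the error of the cutoff is measured by the mode of ω,
which dominates that of q and is continuous. -/
theorem IsSolution.hasDerivAt_mode_b [SigmaFinite m] (h : IsSolution ν T ω₀ θ₀ w θ)
    (hT : HasFourierMeasure (deriv T) m g) {k : ℤ} (hk : k ≠ 0) {χ : ℝ → ℂ} (hχ : IsBump χ)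
    {t : ℝ} (ht : 0 < t) : ∃ D,
    HasDerivAt (fun s => Complex.I * k * ∫ ξ, modeL k (hat (θ s)) ξ * χ ξ) D t ∧
      ‖D‖ₑ ≤ ∫⁻ η, (∫⁻ ξ, ENNReal.ofReal (res k t ξ) * ‖modeL k (hat (w t)) ξ‖ₑ * ‖χ (ξ + η)‖ₑ)
        ∂(m.withDensity fun η => ‖g η‖ₑ) := by
  obtain ⟨q, hqw, hq⟩ := h.eq_θ
  obtain ⟨h1, h2⟩ := hχ.xft_package
  obtain ⟨Z, Z1, Z2, ε, hε, hZ⟩ := hχ.exists_cutoff hχ.hasDerivAt_xft h1.hasDerivAt_xft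
    h1.memLp_xft h2.memLp_xft
  have hcw : ContinuousOn (fun s => ‖modeL k (hat (w s))‖) (Ici 0) :=
    (((modeL k).continuous.comp hat.continuous).comp_continuousOn h.cont_ω).norm
  have hM : 0 ≤ ∫ ξ, ‖g ξ‖ ∂m := integral_nonneg fun _ => norm_nonneg _
  have key := hasDerivAt_of_approx (c := fun n s => Complex.I * k * wavePair (θ s) k (Z n))
    (c' := fun n t => -wavePair (q t) k (fun y => ((deriv T y : ℝ) : ℂ) * Z n y))
    (C := fun s => Complex.I * k * wavePair (θ s) k (xft χ))
    (d := fun t => -wavePair (q t) k (fun y => ((deriv T y : ℝ) : ℂ) * xft χ y))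
    (M := fun t => 2 * π * ‖modeL k (hat (w t))‖ * ∫ ξ, ‖g ξ‖ ∂m)
    (fun n t ht => hasDerivAt_wavePair_θ hT hq k (hZ n).1 ht)
    (fun t _ => (tendsto_wavePair (θ t) k (fun n => (hZ n).1.memLp) hχ.memLp_xft hε
      fun n => (hZ n).2.2.2.2.2.1).const_mul _) ?_ ?_ hε ht
  · have h2π : (2 * π : ℂ) ≠ 0 := by simp [Real.pi_ne_zero]
    simp only [wavePair_xft _ k hχ] at key
    have hd := key.const_mul (2 * π : ℂ)⁻¹
    refine ⟨_, hd.congr_of_eventuallyEq (Eventually.of_forall fun s => ?_), ?_⟩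
    · simp only
      field_simp
    · rw [hT.wavePair_mul_xft (q t) k hχ]
      -- T' is written as a superposition of e^{iηy}, each of which translates χ by η; taking
      -- absolute values leaves the total variation of 𝓕(T').
      have e : (2 * π : ℂ)⁻¹ * -∫ η, g η * wavePair (q t) k (xft fun ξ => χ (ξ + η)) ∂m
          = -∫ η, (g η * ∫ ξ, modeL k (hat (q t)) ξ * χ (ξ + η)) ∂m := by
        rw [mul_neg, ← integral_const_mul]
        congr 1
        refine integral_congr_ae (Eventually.of_forall fun η => ?_)
        simp only
        rw [wavePair_xft _ k (hχ.comp_add η)]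
        field_simp
      rw [e, enorm_neg]
      refine (enorm_integral_le_lintegral_enorm _).trans ?_
      have hmeas : Measurable fun η => ∫⁻ ξ, ENNReal.ofReal (res k t ξ)
          * ‖modeL k (hat (w t)) ξ‖ₑ * ‖χ (ξ + η)‖ₑ := by
        refine Measurable.lintegral_prod_right' (f := fun p : ℝ × ℝ => ENNReal.ofReal (res k t p.2)
          * ‖modeL k (hat (w t)) p.2‖ₑ * ‖χ (p.2 + p.1)‖ₑ) ?_
        have c1 : Measurable χ := hχ.smooth.continuous.measurable
        have c2 : Measurable (modeL k (hat (w t))) := (Lp.stronglyMeasurable _).measurable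
        unfold res
        fun_prop
      rw [lintegral_withDensity_eq_lintegral_mul₀ hT.integrable.1.enorm hmeas.aemeasurable]
      refine lintegral_mono fun η => ?_
      rw [enorm_mul, Pi.mul_apply]
      gcongr
      refine (enorm_integral_le_lintegral_enorm _).trans (le_of_eq (lintegral_congr_ae ?_))
      filter_upwards [(hqw t ht).mode_eq hk] with ξ hξ
      rw [enorm_mul, hξ, enorm_mul, enorm_ofReal, Real.enorm_of_nonneg (res_nonneg _ _ _)]
  · intro n t ht
    obtain ⟨b0, b1, b2, d0, d1, n0, n1, n2⟩ := hZ n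
    have hs := b0.memLp.sub hχ.memLp_xft
    have e : -wavePair (q t) k (fun y => ((deriv T y : ℝ) : ℂ) * Z n y)
        - -wavePair (q t) k (fun y => ((deriv T y : ℝ) : ℂ) * xft χ y)
        = -wavePair (q t) k (fun y => ((deriv T y : ℝ) : ℂ) * (Z n - xft χ) y) := by
      have := wavePair_sub (q t) k (hT.memLp_mul b0.memLp) (hT.memLp_mul hχ.memLp_xft)
      rw [neg_sub_neg, ← neg_sub, ← this]
      simp only [Pi.sub_apply, mul_sub]
    rw [e, norm_neg]
    calc _ ≤ 2 * π * ‖modeL k (hat (q t))‖ * ((∫ ξ, ‖g ξ‖ ∂m) * ε n) := by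
          refine (norm_wavePair_le (q t) k (hT.memLp_mul hs)).trans ?_
          gcongr
          refine (hT.eLpNorm_mul_le hs).trans ?_
          gcongr
          exact n0
      _ ≤ 2 * π * ‖modeL k (hat (w t))‖ * ((∫ ξ, ‖g ξ‖ ∂m) * ε n) := by
          have : 0 ≤ ε n := ENNReal.toReal_nonneg.trans n0
          gcongr
          exact (hqw t ht).norm_mode_le hk
      _ = _ := by ring
  · exact (continuousOn_const.mul hcw).mul continuousOn_const

theorem integral_smul_mul_bump (c : ℂ) (f : Lp ℂ 2 (volume : Measure ℝ)) (χ : ℝ → ℂ) :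
    ∫ ξ, (c • f : Lp ℂ 2 (volume : Measure ℝ)) ξ * χ ξ = c * ∫ ξ, f ξ * χ ξ := by
  rw [← integral_const_mul]
  refine integral_congr_ae ?_
  filter_upwards [Lp.coeFn_smul c f] with ξ hξ
  rw [hξ, Pi.smul_apply, smul_eq_mul, mul_assoc]

theorem IsSolution.isModeSolution [SigmaFinite m] (h : IsSolution ν T ω₀ θ₀ w θ) (hν : 0 < ν)
    (hT : HasFourierMeasure (deriv T) m g) (k : ℤ) :
    IsModeSolution ν k (m.withDensity fun η => ‖g η‖ₑ) (fun t => modeL k (hat (w t)))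
      (fun t => (Complex.I * k : ℂ) • modeL k (hat (θ t))) where
  cont_a := ((modeL k).continuous.comp hat.continuous).comp_continuousOn h.cont_ω
  cont_b := (continuous_const_smul (Complex.I * k : ℂ)).comp_continuousOn
    (((modeL k).continuous.comp hat.continuous).comp_continuousOn h.cont_θ)
  eq_a χ hχ t ht := by
    refine (h.hasDerivAt_mode_a hν k hχ ht).congr_deriv ?_
    rw [integral_smul_mul_bump, ← integral_const_mul]
    congr 1
    refine integral_congr_ae (Eventually.of_forall fun ξ => ?_)
    simp only
    push_cast
    ring
  eq_b χ hχ t ht := by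
    simp only [integral_smul_mul_bump]
    rcases eq_or_ne k 0 with rfl | hk
    · exact ⟨0, by simpa using hasDerivAt_const t (0 : ℂ), by simp⟩
    · exact h.hasDerivAt_mode_b hT hk hχ ht

end

section

/-! ### The a priori estimates -/

/-- The contribution of the frequency `k` to the square of the `H^N` norm. -/
def modeSq (N : ℕ) (k : ℤ) (f : Lp ℂ 2 (volume : Measure ℝ)) : ℝ≥0∞ :=
  ∫⁻ ξ : ℝ, ENNReal.ofReal ((1 + (k : ℝ) ^ 2 + ξ ^ 2) ^ N) * ‖f ξ‖ₑ ^ 2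

theorem sobolevSq_fourierTR (N : ℕ) (u : L2) :
    sobolevSq N (fourierTR u) = ∑' k, modeSq N k (modeL k (hat u)) := by
  refine tsum_congr fun k => lintegral_congr_ae ?_
  filter_upwards [coeFn_modeL_hat k u] with ξ hξ
  rw [hξ]

theorem sobolevSq_fourierDx (N : ℕ) (u : L2) :
    sobolevSq N (fourierDx u) = ∑' k : ℤ, modeSq N k ((Complex.I * k : ℂ) • modeL k (hat u)) := by
  refine tsum_congr fun k => lintegral_congr_ae ?_
  filter_upwards [coeFn_modeL_hat k u, Lp.coeFn_smul (Complex.I * k : ℂ) (modeL k (hat u))] with ξ h1 h2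
  rw [h2, Pi.smul_apply, h1, smul_eq_mul, fourierDx]

theorem wnorm_sq {V : ℝ → ℝ} (hV : ∀ ξ, 0 ≤ V ξ) (G : ℝ → ℝ≥0∞) :
    wnorm V G ^ 2 = ∫⁻ ξ, ENNReal.ofReal (V ξ ^ 2) * G ξ ^ 2 := by
  rw [wnorm, eLpNorm_two_sq]
  refine lintegral_congr fun ξ => ?_
  rw [enorm_eq_self, mul_pow, ENNReal.ofReal_pow (hV ξ)]

theorem modeSq_le_wnorm {N : ℕ} {k : ℤ} {V : ℝ → ℝ} (hV0 : ∀ ξ, 0 ≤ V ξ)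
    (hV : ∀ ξ, (1 + (k : ℝ) ^ 2 + ξ ^ 2) ^ N ≤ V ξ ^ 2) (f : Lp ℂ 2 (volume : Measure ℝ)) :
    modeSq N k f ≤ wnorm V (fun ξ => ‖f ξ‖ₑ) ^ 2 := by
  rw [wnorm_sq hV0]
  refine lintegral_mono fun ξ => ?_
  gcongr
  exact hV ξ

theorem wnorm_le_modeSq {N : ℕ} {k : ℤ} {V : ℝ → ℝ} (hV0 : ∀ ξ, 0 ≤ V ξ) {c : ℝ} (hc : 0 ≤ c)
    (hV : ∀ ξ, V ξ ^ 2 ≤ c * (1 + (k : ℝ) ^ 2 + ξ ^ 2) ^ N) (f : Lp ℂ 2 (volume : Measure ℝ)) :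
    wnorm V (fun ξ => ‖f ξ‖ₑ) ^ 2 ≤ ENNReal.ofReal c * modeSq N k f := by
  rw [wnorm_sq hV0, modeSq, ← lintegral_const_mul' _ _ ENNReal.ofReal_ne_top]
  refine lintegral_mono fun ξ => ?_
  simp only
  rw [← mul_assoc, ← ENNReal.ofReal_mul hc]
  gcongr
  exact hV ξ

variable {ν : ℝ} {T : ℝ → ℝ} {ω₀ θ₀ : L2} {w θ : ℝ → L2} {m : Measure ℝ} {g : ℝ → ℂ}

/-- The mode bounds have a constant independent of k, so they can be summed; c is the price of
comparing V² with the Sobolev weight. -/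
theorem IsSolution.sobolev_le [SigmaFinite m] (h : IsSolution ν T ω₀ θ₀ w θ) (hν : 0 < ν)
    (hT : HasFourierMeasure (deriv T) m g) {L K q c : ℝ} {S : ℝ → ℝ≥0∞} {V : ℤ → ℝ → ℝ} {N : ℕ}
    (hc : 1 ≤ c) (hV : ∀ (k : ℤ) (ξ : ℝ), (1 + (k : ℝ) ^ 2 + ξ ^ 2) ^ N ≤ V k ξ ^ 2)
    (hV2 : ∀ (k : ℤ) (ξ : ℝ), V k ξ ^ 2 ≤ c * (1 + (k : ℝ) ^ 2 + ξ ^ 2) ^ N)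
    (hA : ∀ k : ℤ, k ≠ 0 → IsAdmissible ν L K q k (m.withDensity fun η => ‖g η‖ₑ) S (V k))
    {t : ℝ} (ht : 0 ≤ t) :
    sobolevSq N (fourierTR (w t)) + sobolevSq N (fourierDx (θ t))
      ≤ ENNReal.ofReal (68 * (Real.exp (L * π) * (1 / (1 - q)) * (1 + 2.29 * K)) ^ 2 * c
          * (1 + ν ^ (-(2 / 3) : ℝ)) ^ 2)
        * (sobolevSq N (fourierTR ω₀) + sobolevSq N (fourierDx θ₀)) := by
  have := hT.isFiniteMeasure
  have hA1 := hA 1 one_ne_zero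
  set D : ℝ := 68 * (Real.exp (L * π) * (1 / (1 - q)) * (1 + 2.29 * K)) ^ 2
    * (1 + ν ^ (-(2 / 3) : ℝ)) ^ 2 with hD
  have hq1 : (0 : ℝ) < 1 - q := by linarith [hA1.hq]
  have hr : 0 ≤ ν ^ (-(2 / 3) : ℝ) := by positivity
  have hK := hA1.hK
  have hD1 : 1 ≤ D := by
    have h1 : 1 ≤ Real.exp (L * π) := Real.one_le_exp (mul_nonneg hA1.hL.le Real.pi_pos.le)
    have h2 : 1 ≤ 1 / (1 - q) := (one_le_div hq1).2 (by linarith [hA1.hq0])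
    have h3 : 1 ≤ 1 + 2.29 * K := by nlinarith
    have h4 : 1 ≤ Real.exp (L * π) * (1 / (1 - q)) * (1 + 2.29 * K) :=
      one_le_mul_of_one_le_of_one_le (one_le_mul_of_one_le_of_one_le h1 h2) h3
    have h5 : 1 ≤ (1 + ν ^ (-(2 / 3) : ℝ)) ^ 2 := one_le_pow₀ (by linarith)
    have h6 := one_le_pow₀ h4 (n := 2)
    exact one_le_mul_of_one_le_of_one_le (one_le_mul_of_one_le_of_one_le (by norm_num) h6) h5
  have hDc : 68 * (Real.exp (L * π) * (1 / (1 - q)) * (1 + 2.29 * K)) ^ 2 * c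
          * (1 + ν ^ (-(2 / 3) : ℝ)) ^ 2 = D * c := by rw [hD]; ring
  rw [hDc]
  simp only [sobolevSq_fourierTR, sobolevSq_fourierDx]
  rw [← ENNReal.tsum_add, ← ENNReal.tsum_add, ← ENNReal.tsum_mul_left]
  refine ENNReal.tsum_le_tsum fun k => ?_
  have hmode := h.isModeSolution hν hT k
  have e0 : w 0 = ω₀ := h.init_ω
  have e1 : θ 0 = θ₀ := h.init_θ
  -- At k = 0 the contribution of θ vanishes and that of ω does not grow.
  rcases eq_or_ne k 0 with rfl | hk
  · have ha := hmode.enorm_a_le_of_b_eq_zero hν (fun s _ => by simp) ht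
    rw [e0] at ha
    have hz : ∀ f : Lp ℂ 2 (volume : Measure ℝ),
        modeSq N 0 ((Complex.I * ((0 : ℤ) : ℂ)) • f) = 0 := fun f => by
      rw [modeSq]
      refine (lintegral_eq_zero_of_ae_eq_zero ?_)
      filter_upwards [Lp.coeFn_smul (Complex.I * ((0 : ℤ) : ℂ)) f] with ξ hξ
      rw [hξ]
      simp
    rw [hz, hz, add_zero, add_zero]
    calc _ ≤ modeSq N 0 (modeL 0 (hat ω₀)) := by
          refine lintegral_mono_ae ?_
          filter_upwards [ha] with ξ hξ
          gcongr
      _ ≤ _ := by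
          refine le_mul_of_one_le_left' ?_
          rw [ENNReal.one_le_ofReal]
          exact one_le_mul_of_one_le_of_one_le hD1 hc
  · have hAk := hA k hk
    have hV0 : ∀ ξ, 0 ≤ V k ξ := fun ξ => zero_le_one.trans (hAk.hV1 ξ)
    have hb := hAk.sq_bound hmode ht
    rw [e0, e1] at hb
    calc _ ≤ _ := add_le_add (modeSq_le_wnorm hV0 (hV k) _) (modeSq_le_wnorm hV0 (hV k) _)
      _ ≤ _ := hb
      _ ≤ ENNReal.ofReal D * (ENNReal.ofReal c * modeSq N k (modeL k (hat ω₀))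
          + ENNReal.ofReal c * modeSq N k ((Complex.I * k : ℂ) • modeL k (hat θ₀))) := by
          refine mul_le_mul' le_rfl (add_le_add ?_ ?_)
          · exact wnorm_le_modeSq hV0 (by linarith) (hV2 k) _
          · exact wnorm_le_modeSq hV0 (by linarith) (hV2 k) _
      _ = _ := by
          rw [ENNReal.ofReal_mul (p := D) (by linarith), ← mul_add, mul_assoc]

theorem sobolevSq_fourierDx_le (N : ℕ) (u : L2) :
    sobolevSq N (fourierDx u) ≤ sobolevSq (N + 1) (fourierTR u) := by
  refine ENNReal.tsum_le_tsum fun k => lintegral_mono fun ξ => ?_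
  have e : ‖Complex.I * k‖ₑ ^ 2 = ENNReal.ofReal ((k : ℝ) ^ 2) := by
    rw [← ofReal_norm, norm_mul, Complex.norm_I, one_mul, Complex.norm_intCast,
      ← ENNReal.ofReal_pow (abs_nonneg _), sq_abs]
  simp only [fourierDx]
  rw [enorm_mul, mul_pow, e, ← mul_assoc, ← ENNReal.ofReal_mul (by positivity), pow_succ _ N]
  gcongr
  linarith [sq_nonneg ξ]

/-! ### Admissible weights -/

/-- The weight `(1 + k² + ξ²)^{N/2}`. -/
def sobWeight (N : ℕ) (k : ℤ) (ξ : ℝ) : ℝ := Real.sqrt (1 + (k : ℝ) ^ 2 + ξ ^ 2) ^ N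

theorem sobWeight_sq (N : ℕ) (k : ℤ) (ξ : ℝ) :
    sobWeight N k ξ ^ 2 = (1 + (k : ℝ) ^ 2 + ξ ^ 2) ^ N := by
  rw [sobWeight, ← pow_mul, mul_comm, pow_mul, Real.sq_sqrt (by positivity)]

theorem one_le_sobWeight (N : ℕ) (k : ℤ) (ξ : ℝ) : 1 ≤ sobWeight N k ξ :=
  one_le_pow₀ (Real.one_le_sqrt.2 (by nlinarith [sq_nonneg (k : ℝ), sq_nonneg ξ]))

theorem continuous_sobWeight (N : ℕ) (k : ℤ) : Continuous (sobWeight N k) := by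
  unfold sobWeight
  fun_prop

/-- A Peetre-type inequality: a shift by η multiplies the weight by at most 1 + |η|, uniformly in k.
-/
theorem sqrt_shift_le (k ξ η : ℝ) :
    Real.sqrt (1 + k ^ 2 + (ξ + η) ^ 2) ≤ (1 + |η|) * Real.sqrt (1 + k ^ 2 + ξ ^ 2) := by
  set r := Real.sqrt (1 + k ^ 2 + ξ ^ 2) with hr
  have hr2 : r ^ 2 = 1 + k ^ 2 + ξ ^ 2 := Real.sq_sqrt (by positivity)
  have hr0 : 0 ≤ r := Real.sqrt_nonneg _
  have h1 : 1 ≤ r ^ 2 := by rw [hr2]; nlinarith [sq_nonneg k, sq_nonneg ξ]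
  have hξ : |ξ| ≤ r := abs_le_of_sq_le_sq (by nlinarith [sq_nonneg k]) hr0
  rw [Real.sqrt_le_left (by positivity)]
  have h2 : ξ * η ≤ r * |η| := by
    calc ξ * η ≤ |ξ * η| := le_abs_self _
      _ = |ξ| * |η| := abs_mul _ _
      _ ≤ r * |η| := by gcongr
  have h3 : 1 ≤ r := by nlinarith
  have h4 : |η| ^ 2 = η ^ 2 := sq_abs η
  have h5 : r * |η| ≤ r ^ 2 * |η| := by
    refine mul_le_mul_of_nonneg_right ?_ (abs_nonneg η)
    nlinarith
  have h6 : η ^ 2 ≤ r ^ 2 * η ^ 2 := by nlinarith [sq_nonneg η]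
  nlinarith

theorem symRatio_le {V : ℝ → ℝ} (hV : ∀ ξ, 0 < V ξ) {c : ℝ → ℝ} (hc : ∀ η, c (-η) = c η)
    (h : ∀ ξ η, V (ξ + η) ≤ c η * V ξ) (ξ η : ℝ) : symRatio V ξ η ≤ c η := by
  refine max_le ((div_le_iff₀ (hV _)).2 (h ξ η)) ((div_le_iff₀ (hV _)).2 ?_)
  have := h (ξ + η) (-η)
  rwa [add_neg_cancel_right, hc] at this

theorem symRatio_sobWeight_le (N : ℕ) (k : ℤ) (ξ η : ℝ) :
    symRatio (sobWeight N k) ξ η ≤ (1 + |η|) ^ N := by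
  refine symRatio_le (fun ξ => zero_lt_one.trans_le (one_le_sobWeight N k ξ))
    (c := fun η => (1 + |η|) ^ N) (fun η => by rw [abs_neg]) (fun ξ η => ?_) ξ η
  rw [sobWeight, sobWeight, ← mul_pow]
  exact pow_le_pow_left₀ (Real.sqrt_nonneg _) (sqrt_shift_le _ _ _) N

/-- Comparison of derivatives: 1/(1+y²) ≤ 2/(1+2y) because (y-1)² + y² ≥ 0. -/
theorem arctan_le_log {x : ℝ} (hx : 0 ≤ x) : Real.arctan x ≤ Real.log (1 + 2 * x) := by
  have hd : ∀ y : ℝ, 0 ≤ y → HasDerivAt (fun y => Real.log (1 + 2 * y) - Real.arctan y)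
      (2 * 1 / (1 + 2 * y) - 1 / (1 + y ^ 2)) y := fun y hy =>
    ((((hasDerivAt_id y).const_mul 2).const_add 1).log (by positivity)).sub (Real.hasDerivAt_arctan y)
  have hmono : MonotoneOn (fun y => Real.log (1 + 2 * y) - Real.arctan y) (Ici 0) := by
    refine monotoneOn_of_deriv_nonneg (convex_Ici 0)
      (fun y hy => (hd y hy).continuousAt.continuousWithinAt)
      (fun y hy => (hd y (interior_subset hy)).differentiableAt.differentiableWithinAt) fun y hy => ?_
    have hy : 0 ≤ y := interior_subset hy
    rw [(hd y hy).deriv, sub_nonneg, div_le_div_iff₀ (by positivity) (by positivity)]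
    nlinarith [sq_nonneg (y - 1), sq_nonneg y]
  have := hmono self_mem_Ici hx hx
  simp only [mul_zero, add_zero, Real.log_one, Real.arctan_zero, sub_zero] at this
  linarith

/-- A modulus of continuity that grows only logarithmically, so its exponential, the shift cost of
`ghost`, is polynomial in η. -/
theorem arctan_sub_arctan_le_log {x y : ℝ} (h : x ≤ y) :
    Real.arctan y - Real.arctan x ≤ 2 * Real.log (1 + (y - x)) := by
  have hlog : ∀ {u : ℝ}, 0 ≤ u → Real.log (1 + 2 * u) ≤ 2 * Real.log (1 + u) := fun {u} hu => by
    have : 2 * Real.log (1 + u) = Real.log ((1 + u) ^ 2) := by rw [Real.log_pow]; norm_num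
    rw [this]
    exact Real.log_le_log (by positivity) (by nlinarith [sq_nonneg u])
  have hmain : ∀ {x y : ℝ}, 0 ≤ x → x ≤ y →
      Real.arctan y - Real.arctan x ≤ 2 * Real.log (1 + (y - x)) := fun {x y} hx hxy => by
    have hy : 0 ≤ y := hx.trans hxy
    -- For 0 ≤ x ≤ y the difference is arctan((y-x)/(1+xy)) ≤ arctan(y-x).
    have h1 := Real.arctan_add (x := y) (y := -x) (by nlinarith [mul_nonneg hx hy])
    rw [Real.arctan_neg, ← sub_eq_add_neg] at h1
    rw [h1]
    refine (Real.arctan_strictMono.monotone (?_ : _ ≤ y - x)).trans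
      ((arctan_le_log (sub_nonneg.2 hxy)).trans (hlog (sub_nonneg.2 hxy)))
    have : 0 ≤ y * x := mul_nonneg hy hx
    rw [div_le_iff₀ (by linarith)]
    nlinarith [mul_nonneg this (sub_nonneg.2 hxy)]
  rcases le_total 0 x with hx | hx
  · exact hmain hx h
  rcases le_total 0 y with hy | hy
  · have h1 := arctan_le_log hy
    have h2 := arctan_le_log (neg_nonneg.2 hx)
    rw [Real.arctan_neg] at h2
    -- Opposite signs: (1+2y)(1+2|x|) ≤ (1+y+|x|)², since 4y|x| ≤ (y+|x|)².
    have h3 : Real.log (1 + 2 * y) + Real.log (1 + 2 * -x) ≤ 2 * Real.log (1 + (y - x)) := by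
      have : 2 * Real.log (1 + (y - x)) = Real.log ((1 + (y - x)) ^ 2) := by
        rw [Real.log_pow]; norm_num
      rw [this, ← Real.log_mul (by positivity) (by linarith)]
      refine Real.log_le_log (mul_pos (by positivity) (by linarith)) ?_
      nlinarith [sq_nonneg (y + x)]
    linarith
  · have := hmain (neg_nonneg.2 hy) (neg_le_neg h)
    rw [Real.arctan_neg, Real.arctan_neg] at this
    have e : -x - -y = y - x := by ring
    rw [e] at this
    linarith

/-- The argument of arctan moves by η/k, and |k| ≥ 1 makes the bound uniform in k. The resulting
factor is (1+|η|)^{2L}. -/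
theorem ghost_shift_le {L : ℝ} (hL : 0 ≤ L) {k : ℤ} (hk : k ≠ 0) (t ξ η : ℝ) :
    ghost L k t (ξ - η) ≤ Real.exp (2 * L * Real.log (1 + |η|)) * ghost L k t ξ := by
  rw [ghost, ghost, ← Real.exp_add, Real.exp_le_exp]
  have hk1 : (1 : ℝ) ≤ |(k : ℝ)| := by
    exact_mod_cast Int.one_le_abs hk
  have hηk : |η / k| ≤ |η| := by
    rw [abs_div]
    exact div_le_self (abs_nonneg η) hk1
  have key : Real.arctan (t - (ξ - η) / k) - Real.arctan (t - ξ / k)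
      ≤ 2 * Real.log (1 + |η|) := by
    have e : t - (ξ - η) / k = t - ξ / k + η / k := by ring
    have hlog : 0 ≤ Real.log (1 + |η|) := Real.log_nonneg (by linarith [abs_nonneg η])
    rcases le_total (t - ξ / k) (t - (ξ - η) / k) with h | h
    · refine (arctan_sub_arctan_le_log h).trans ?_
      have h2 : t - (ξ - η) / k - (t - ξ / k) = η / k := by rw [e]; ring
      have h3 : 0 ≤ η / k := by linarith
      rw [h2]
      gcongr
      exact (le_abs_self _).trans hηk
    · have := Real.arctan_strictMono.monotone h
      linarith
  nlinarith [mul_le_mul_of_nonneg_left key hL]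

end

/-! ### The three choices of parameters and the resulting bounds. -/

section

variable {ν : ℝ} {T : ℝ → ℝ} {ω₀ θ₀ : L2} {w θ : ℝ → L2} {m : Measure ℝ} {g : ℝ → ℂ}

theorem lintegral_totalVariation (hg : AEStronglyMeasurable g m) {F : ℝ → ℝ≥0∞}
    (hF : Measurable F) :
    ∫⁻ η, F η ∂(m.withDensity fun η => ‖g η‖ₑ) = ∫⁻ η, F η * ‖g η‖ₑ ∂m := by
  rw [lintegral_withDensity_eq_lintegral_mul₀ hg.enorm hF.aemeasurable]
  exact lintegral_congr fun η => mul_comm _ _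

theorem measurable_symRatio {V : ℝ → ℝ} (hV : Measurable V) (ξ : ℝ) :
    Measurable (fun η => symRatio V ξ η) := by
  unfold symRatio
  fun_prop

/-- The exponent N+5 splits as N for the Sobolev weight and 5 = 2L for the shift of `ghost`. With K
= 1 the contraction needs L > 2.29, and L = 5/2 makes the exponent an integer. -/
theorem isAdmissible_weightedMass (hν : 0 < ν) (hg : AEStronglyMeasurable g m) {N : ℕ}
    (h : weightedMass N m g ≤ ENNReal.ofReal ((4 : ℝ)⁻¹ ^ N * ν ^ (1 / 3 : ℝ))) {k : ℤ}
    (hk : k ≠ 0) :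
    IsAdmissible ν (5 / 2) 1 (2.29 / 2.5) k (m.withDensity fun η => ‖g η‖ₑ)
      (fun η => ENNReal.ofReal ((1 + |η|) ^ 5)) (sobWeight N k) where
  hν := hν
  hL := by norm_num
  hK := by norm_num
  hq0 := by norm_num
  hq := by norm_num
  hKq := by norm_num
  hk := hk
  hSm := by fun_prop
  hS1 η := ENNReal.one_le_ofReal.2 (one_le_pow₀ (by linarith [abs_nonneg η]))
  hS t ξ η := by
    rw [← ENNReal.ofReal_mul (by positivity)]
    refine ENNReal.ofReal_le_ofReal ((ghost_shift_le (by norm_num) hk t ξ η).trans (le_of_eq ?_))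
    have : (2 * (5 / 2) * Real.log (1 + |η|) : ℝ) = (5 : ℕ) * Real.log (1 + |η|) := by
      push_cast; ring
    rw [this, Real.exp_nat_mul, Real.exp_log (by positivity)]
  hVm := (continuous_sobWeight N k).measurable
  hV1 := one_le_sobWeight N k
  hVeven ξ := by rw [sobWeight, sobWeight, neg_sq]
  hκ ξ := by
    have hsm := measurable_symRatio (continuous_sobWeight N k).measurable ξ
    rw [lintegral_totalVariation hg (F := fun η => ENNReal.ofReal (symRatio (sobWeight N k) ξ η)
      * ENNReal.ofReal ((1 + |η|) ^ 5)) (by fun_prop)]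
    refine le_trans (lintegral_mono fun η => ?_) (h.trans (ENNReal.ofReal_le_ofReal ?_))
    · rw [← ENNReal.ofReal_mul' (by positivity), pow_add]
      gcongr
      exact symRatio_sobWeight_le N k ξ η
    · gcongr
      exact pow_le_one₀ (by norm_num) (by norm_num)

/-- The weight `(1 + |k| + |ξ|)^N`. -/
def absWeight (N : ℕ) (k : ℤ) (ξ : ℝ) : ℝ := (1 + |(k : ℝ)| + |ξ|) ^ N

theorem one_le_absWeight (N : ℕ) (k : ℤ) (ξ : ℝ) : 1 ≤ absWeight N k ξ :=
  one_le_pow₀ (by linarith [abs_nonneg (k : ℝ), abs_nonneg ξ])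

theorem measurable_absWeight (N : ℕ) (k : ℤ) : Measurable (absWeight N k) := by
  unfold absWeight
  fun_prop

theorem le_absWeight_sq (N : ℕ) (k : ℤ) (ξ : ℝ) :
    (1 + (k : ℝ) ^ 2 + ξ ^ 2) ^ N ≤ absWeight N k ξ ^ 2 := by
  rw [absWeight, ← pow_mul, mul_comm, pow_mul]
  refine pow_le_pow_left₀ (by positivity) ?_ N
  rw [← sq_abs (k : ℝ), ← sq_abs ξ]
  have := abs_nonneg (k : ℝ)
  have := abs_nonneg ξ
  nlinarith [mul_nonneg (abs_nonneg (k : ℝ)) (abs_nonneg ξ)]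

theorem absWeight_sq_le (N : ℕ) (k : ℤ) (ξ : ℝ) :
    absWeight N k ξ ^ 2 ≤ 3 ^ N * (1 + (k : ℝ) ^ 2 + ξ ^ 2) ^ N := by
  rw [absWeight, ← pow_mul, mul_comm, pow_mul, ← mul_pow]
  refine pow_le_pow_left₀ (by positivity) ?_ N
  rw [← sq_abs (k : ℝ), ← sq_abs ξ]
  nlinarith [sq_nonneg (|(k : ℝ)| - |ξ|), sq_nonneg (|(k : ℝ)| - 1), sq_nonneg (|ξ| - 1)]

/-- The reason for preferring (1+|k|+|ξ|)^N: adding |k| to numerator and denominator pushes the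
quotient towards 1, so the ratio is bounded by the expression in `commutatorMass`, with constant 1.
-/
theorem symRatio_absWeight_le (N : ℕ) (k : ℤ) (ξ η : ℝ) :
    symRatio (absWeight N k) ξ η
      ≤ ((1 + |ξ + η|) / (1 + |ξ|) + (1 + |ξ|) / (1 + |ξ + η|)) ^ N := by
  have key : ∀ {a b c : ℝ}, 0 ≤ a → 0 ≤ b → 0 ≤ c → (1 + a + b) / (1 + a + c)
      ≤ (1 + b) / (1 + c) + (1 + c) / (1 + b) := by
    intro a b c ha hb hc
    rcases le_total b c with h | h
    · have h1 : (1 + a + b) / (1 + a + c) ≤ 1 := div_le_one_of_le₀ (by linarith) (by positivity)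
      have h2 : 1 ≤ (1 + c) / (1 + b) := (one_le_div (by positivity)).2 (by linarith)
      have h3 : 0 ≤ (1 + b) / (1 + c) := by positivity
      linarith
    · have h1 : (1 + a + b) / (1 + a + c) ≤ (1 + b) / (1 + c) := by
        rw [div_le_div_iff₀ (by positivity) (by positivity)]
        nlinarith [mul_nonneg ha (sub_nonneg.2 h)]
      have h3 : 0 ≤ (1 + c) / (1 + b) := by positivity
      linarith
  unfold symRatio absWeight
  refine max_le ?_ ?_
  · rw [← div_pow]
    exact pow_le_pow_left₀ (by positivity) (key (abs_nonneg _) (abs_nonneg _) (abs_nonneg _)) N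
  · rw [← div_pow, add_comm ((1 + |ξ + η|) / (1 + |ξ|))]
    exact pow_le_pow_left₀ (by positivity) (key (abs_nonneg _) (abs_nonneg _) (abs_nonneg _)) N

/-- With L = 1/π the weight stays in [1,e], so the constant S = e covers every shift. The factor
1/100 in the assumption leaves K = e/100. -/
theorem isAdmissible_commutatorMass (hν : 0 < ν) (hg : AEStronglyMeasurable g m) {N : ℕ}
    (h : commutatorMass N ν m g < ENNReal.ofReal (1 / 100 * ν ^ (1 / 3 : ℝ))) {k : ℤ}
    (hk : k ≠ 0) :
    IsAdmissible ν (1 / π) (Real.exp 1 / 100) (1 / 2) k (m.withDensity fun η => ‖g η‖ₑ)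
      (fun _ => ENNReal.ofReal (Real.exp 1)) (absWeight N k) where
  hν := hν
  hL := by positivity
  hK := by positivity
  hq0 := by norm_num
  hq := by norm_num
  hKq := by
    -- Numerically 2.29e/100 < 0.07, while qL = 1/(2π) ≥ 1/8.
    have h1 := Real.exp_one_lt_d9
    have h2 := Real.pi_lt_d2
    have h3 : 1 / 4 ≤ 1 / π := one_div_le_one_div_of_le Real.pi_pos (by linarith)
    linarith
  hk := hk
  hSm := measurable_const
  hS1 _ := ENNReal.one_le_ofReal.2 (Real.one_le_exp zero_le_one)
  hS t ξ η := by
    rw [← ENNReal.ofReal_mul (by positivity)]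
    refine ENNReal.ofReal_le_ofReal ?_
    have h1 := ghost_le (L := 1 / π) (by positivity) k t (ξ - η)
    have h2 := one_le_ghost (L := 1 / π) (by positivity) k t ξ
    rw [one_div_mul_cancel Real.pi_ne_zero] at h1
    nlinarith [Real.exp_pos 1]
  hVm := measurable_absWeight N k
  hV1 := one_le_absWeight N k
  hVeven ξ := by rw [absWeight, absWeight, abs_neg]
  hκ ξ := by
    have hsm := measurable_symRatio (measurable_absWeight N k) ξ
    rw [lintegral_totalVariation hg (F := fun η => ENNReal.ofReal (symRatio (absWeight N k) ξ η)
      * ENNReal.ofReal (Real.exp 1)) (by fun_prop)]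
    have h1 : ∫⁻ η, ENNReal.ofReal (((1 + |ξ + η|) / (1 + |ξ|) + (1 + |ξ|) / (1 + |ξ + η|)) ^ N
        * (1 + min (ν ^ (-(2 / 3) : ℝ)) (|η| ^ (2 / 3 : ℝ)))) * ‖g η‖ₑ ∂m
        ≤ ENNReal.ofReal (1 / 100 * ν ^ (1 / 3 : ℝ)) :=
      (le_iSup (fun ξ : ℝ => ∫⁻ η, ENNReal.ofReal (((1 + |ξ + η|) / (1 + |ξ|)
        + (1 + |ξ|) / (1 + |ξ + η|)) ^ N
        * (1 + min (ν ^ (-(2 / 3) : ℝ)) (|η| ^ (2 / 3 : ℝ)))) * ‖g η‖ₑ ∂m) ξ).trans h.le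
    have e : Real.exp 1 / 100 * ν ^ (1 / 3 : ℝ) = Real.exp 1 * (1 / 100 * ν ^ (1 / 3 : ℝ)) := by ring
    rw [e, ENNReal.ofReal_mul (Real.exp_pos 1).le]
    refine le_trans ?_ (mul_le_mul' le_rfl h1)
    rw [← lintegral_const_mul' _ _ ENNReal.ofReal_ne_top]
    refine lintegral_mono fun η => ?_
    simp only
    rw [mul_comm (ENNReal.ofReal (symRatio _ _ _)), mul_assoc]
    gcongr
    refine (symRatio_absWeight_le N k ξ η).trans (le_mul_of_one_le_right (by positivity) ?_)
    have : 0 ≤ min (ν ^ (-(2 / 3) : ℝ)) (|η| ^ (2 / 3 : ℝ)) := by positivity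
    linarith

theorem hasFourierMeasure_affine (α : ℝ) :
    HasFourierMeasure (deriv fun y : ℝ => α * y) (Measure.dirac 0) (fun _ => (α : ℂ)) := by
  refine ⟨integrable_const _, fun y => ?_⟩
  have : deriv (fun y : ℝ => α * y) y = α := by simp
  rw [this, integral_dirac]
  simp

/-- The Dirac mass at 0 produces no shift, so the cost of S away from 0 is invisible. Then K =
|α|ν^{-1/3}, and L = 5K + 1 gives q = 1/2 for α of any size; the constant pays e^{Lπ}. -/
theorem isAdmissible_affine (hν : 0 < ν) (α : ℝ) (N : ℕ) {k : ℤ} (hk : k ≠ 0) :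
    IsAdmissible ν (5 * (|α| * ν ^ (-(1 / 3) : ℝ)) + 1) (|α| * ν ^ (-(1 / 3) : ℝ)) (1 / 2) k
      ((Measure.dirac (0 : ℝ)).withDensity fun _ => ‖(α : ℂ)‖ₑ)
      (fun η => if η = 0 then 1
        else ENNReal.ofReal (Real.exp ((5 * (|α| * ν ^ (-(1 / 3) : ℝ)) + 1) * π)))
      (sobWeight N k) where
  hν := hν
  hL := by positivity
  hK := by positivity
  hq0 := by norm_num
  hq := by norm_num
  hKq := by
    have : 0 ≤ |α| * ν ^ (-(1 / 3) : ℝ) := by positivity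
    linarith
  hk := hk
  hSm := Measurable.ite (measurableSet_singleton 0) measurable_const measurable_const
  hS1 η := by
    split_ifs
    · exact le_rfl
    · exact ENNReal.one_le_ofReal.2 (Real.one_le_exp (by positivity))
  hS t ξ η := by
    split_ifs with hη
    · rw [hη, sub_zero, one_mul]
    · rw [← ENNReal.ofReal_mul (by positivity)]
      refine ENNReal.ofReal_le_ofReal ?_
      have h0 : 0 ≤ 5 * (|α| * ν ^ (-(1 / 3) : ℝ)) + 1 := by positivity
      exact (ghost_le h0 k t (ξ - η)).trans
        (le_mul_of_one_le_right (Real.exp_pos _).le (one_le_ghost h0 k t ξ))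
  hVm := (continuous_sobWeight N k).measurable
  hV1 := one_le_sobWeight N k
  hVeven ξ := by rw [sobWeight, sobWeight, neg_sq]
  hκ ξ := by
    rw [withDensity_const, lintegral_smul_measure, lintegral_dirac]
    have h0 : sobWeight N k ξ ≠ 0 := (zero_lt_one.trans_le (one_le_sobWeight N k ξ)).ne'
    have h1 : |α| * ν ^ (-(1 / 3) : ℝ) * ν ^ (1 / 3 : ℝ) = |α| := by
      rw [mul_assoc, ← Real.rpow_add hν]
      norm_num
    rw [h1, enorm_ofReal, Real.enorm_eq_ofReal_abs]
    simp [symRatio, div_self h0]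

theorem IsSolution.bound_weightedMass [SigmaFinite m] (h : IsSolution ν T ω₀ θ₀ w θ) (hν : 0 < ν)
    (hT : HasFourierMeasure (deriv T) m g) {N : ℕ}
    (hm : weightedMass N m g ≤ ENNReal.ofReal ((4 : ℝ)⁻¹ ^ N * ν ^ (1 / 3 : ℝ)))
    {t : ℝ} (ht : 0 ≤ t) :
    sobolevSq N (fourierTR (w t)) + sobolevSq N (fourierDx (θ t))
      ≤ ENNReal.ofReal (68 * (Real.exp (5 / 2 * π) * (1 / (1 - 2.29 / 2.5)) * (1 + 2.29 * 1)) ^ 2 * 1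
          * (1 + ν ^ (-(2 / 3) : ℝ)) ^ 2)
        * (sobolevSq N (fourierTR ω₀) + sobolevSq (N + 1) (fourierTR θ₀)) := by
  refine (h.sobolev_le hν hT le_rfl (fun k ξ => (sobWeight_sq N k ξ).ge)
    (fun k ξ => by rw [sobWeight_sq, one_mul])
    (fun k hk => isAdmissible_weightedMass hν hT.integrable.1 hm hk) ht).trans ?_
  gcongr
  exact sobolevSq_fourierDx_le N θ₀

theorem IsSolution.bound_commutatorMass [SigmaFinite m] (h : IsSolution ν T ω₀ θ₀ w θ) (hν : 0 < ν)
    (hT : HasFourierMeasure (deriv T) m g) {N : ℕ}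
    (hm : commutatorMass N ν m g < ENNReal.ofReal (1 / 100 * ν ^ (1 / 3 : ℝ)))
    {t : ℝ} (ht : 0 ≤ t) :
    sobolevSq N (fourierTR (w t)) + sobolevSq N (fourierDx (θ t))
      ≤ ENNReal.ofReal (68 * (Real.exp (1 / π * π) * (1 / (1 - 1 / 2))
          * (1 + 2.29 * (Real.exp 1 / 100))) ^ 2 * 3 ^ N * (1 + ν ^ (-(2 / 3) : ℝ)) ^ 2)
        * (sobolevSq N (fourierTR ω₀) + sobolevSq N (fourierDx θ₀)) :=
  h.sobolev_le hν hT (one_le_pow₀ (by norm_num)) (fun k ξ => le_absWeight_sq N k ξ)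
    (fun k ξ => absWeight_sq_le N k ξ)
    (fun k hk => isAdmissible_commutatorMass hν hT.integrable.1 hm hk) ht

theorem IsSolution.bound_affine {α : ℝ} (h : IsSolution ν (fun y => α * y) ω₀ θ₀ w θ) (hν : 0 < ν)
    (N : ℕ) {t : ℝ} (ht : 0 ≤ t) :
    sobolevSq N (fourierTR (w t)) + sobolevSq N (fourierDx (θ t))
      ≤ ENNReal.ofReal (68 * (Real.exp ((5 * (|α| * ν ^ (-(1 / 3) : ℝ)) + 1) * π)
          * (1 / (1 - 1 / 2)) * (1 + 2.29 * (|α| * ν ^ (-(1 / 3) : ℝ)))) ^ 2 * 1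
          * (1 + ν ^ (-(2 / 3) : ℝ)) ^ 2)
        * (sobolevSq N (fourierTR ω₀) + sobolevSq N (fourierDx θ₀)) :=
  h.sobolev_le hν (hasFourierMeasure_affine α) le_rfl (fun k ξ => (sobWeight_sq N k ξ).ge)
    (fun k ξ => by rw [sobWeight_sq, one_mul])
    (fun k hk => isAdmissible_affine hν α N hk) ht

end

/-! ### Linear Volterra equations -/

theorem integral_exp_mul_le {l t : ℝ} (hl : 0 < l) :
    ∫ s in (0 : ℝ)..t, Real.exp (l * s) ≤ Real.exp (l * t) / l := by
  have hd : ∀ s : ℝ, HasDerivAt (fun s => Real.exp (l * s) / l) (Real.exp (l * s)) s := by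
    intro s
    have h1 : HasDerivAt (fun s => l * s) (l * 1) s := (hasDerivAt_id s).const_mul l
    have := (h1.exp).div_const l
    convert! this using 1
    field_simp
  rw [intervalIntegral.integral_eq_sub_of_hasDerivAt (fun s _ => hd s)
    ((by fun_prop : Continuous fun s => Real.exp (l * s)).intervalIntegrable _ _)]
  have : 0 < Real.exp (l * 0) / l := by positivity
  linarith

/-- Linear Volterra equations with strongly continuous, bounded kernels are globally solvable. -/
theorem exists_volterra {E : Type*} [NormedAddCommGroup E] [NormedSpace ℝ E] [CompleteSpace E]
    {F : ℝ → E} (hF : Continuous F) {C : ℝ} (hFC : ∀ t, ‖F t‖ ≤ C) {K : ℝ → ℝ → E →L[ℝ] E}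
    (hK : Continuous fun p : (ℝ × ℝ) × E => K p.1.1 p.1.2 p.2) {κ : ℝ} (hκ : 0 ≤ κ)
    (hKκ : ∀ t s x, ‖K t s x‖ ≤ κ * ‖x‖) :
    ∃ y : ℝ → E, Continuous y ∧ ∀ t, 0 ≤ t → y t = F t + ∫ s in (0 : ℝ)..t, K t s (y s) := by
  -- The unknown is sought as e^{lt}x(t) with x bounded; then the Volterra operator has norm at most
  -- κ/l ≤ 1/2.
  set l : ℝ := 2 * κ + 1 with hl
  have hl0 : 0 < l := by positivity
  have hG : ∀ x : BoundedContinuousFunction ℝ E,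
      Continuous (Function.uncurry fun t s : ℝ => K t s (Real.exp (l * s) • x s)) := fun x => by
    have h1 : Continuous fun p : ℝ × ℝ => ((p, Real.exp (l * p.2) • x p.2) : (ℝ × ℝ) × E) := by
      have := x.continuous
      fun_prop
    exact hK.comp h1
  have hbd : ∀ (x : BoundedContinuousFunction ℝ E) (t : ℝ), 0 ≤ t →
      ‖Real.exp (-(l * t)) • ∫ s in (0 : ℝ)..t, K t s (Real.exp (l * s) • x s)‖ ≤ 1 / 2 * ‖x‖ := by
    intro x t ht
    have h1 : ‖∫ s in (0 : ℝ)..t, K t s (Real.exp (l * s) • x s)‖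
        ≤ ∫ s in (0 : ℝ)..t, κ * ‖x‖ * Real.exp (l * s) := by
      refine intervalIntegral.norm_integral_le_of_norm_le ht ?_ ?_
      · refine Eventually.of_forall fun s _ => (hKκ t s _).trans ?_
        rw [norm_smul, Real.norm_of_nonneg (Real.exp_pos _).le, mul_assoc, mul_comm ‖x‖]
        gcongr
        exact x.norm_coe_le_norm s
      · exact (by fun_prop : Continuous fun s => κ * ‖x‖ * Real.exp (l * s)).intervalIntegrable _ _
    rw [intervalIntegral.integral_const_mul] at h1
    rw [norm_smul, Real.norm_of_nonneg (Real.exp_pos _).le]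
    calc _ ≤ Real.exp (-(l * t)) * (κ * ‖x‖ * (Real.exp (l * t) / l)) := by
          gcongr
          exact h1.trans (by gcongr; exact integral_exp_mul_le hl0)
      _ = κ / l * ‖x‖ * (Real.exp (-(l * t)) * Real.exp (l * t)) := by ring
      _ = κ / l * ‖x‖ := by rw [← Real.exp_add, neg_add_cancel, Real.exp_zero, mul_one]
      _ ≤ _ := by
          refine mul_le_mul_of_nonneg_right ?_ (norm_nonneg _)
          rw [div_le_div_iff₀ hl0 two_pos]
          linarith
  -- Replacing t by max(t,0) extends the map to functions on all of ℝ, where bounded continuous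
  -- functions form a complete space.
  let Φ : BoundedContinuousFunction ℝ E → BoundedContinuousFunction ℝ E := fun x =>
    BoundedContinuousFunction.ofNormedAddCommGroup
      (fun t => Real.exp (-(l * max t 0)) • (F (max t 0)
        + ∫ s in (0 : ℝ)..(max t 0), K (max t 0) s (Real.exp (l * s) • x s)))
      (by
        have hc := intervalIntegral.continuous_parametric_intervalIntegral_of_continuous
          (μ := volume) (a₀ := 0) (hG x) continuous_id
        have hm : Continuous fun t : ℝ => max t 0 := by fun_prop
        exact (by fun_prop : Continuous fun t : ℝ => Real.exp (-(l * max t 0))).smul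
          ((hF.comp hm).add (hc.comp hm)))
      (C + 1 / 2 * ‖x‖)
      (fun t => by
        have ht : 0 ≤ max t 0 := le_max_right _ _
        rw [smul_add]
        refine (norm_add_le _ _).trans (add_le_add ?_ (hbd x _ ht))
        rw [norm_smul, Real.norm_of_nonneg (Real.exp_pos _).le]
        refine (mul_le_of_le_one_left (norm_nonneg _) ?_).trans (hFC _)
        exact Real.exp_le_one_iff.2 (neg_nonpos.2 (by positivity)))
  have hΦ : ContractingWith (1 / 2) Φ := by
    refine ⟨by norm_num, LipschitzWith.of_dist_le_mul fun x y => ?_⟩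
    rw [BoundedContinuousFunction.dist_le (by positivity)]
    intro t
    have ht : 0 ≤ max t 0 := le_max_right _ _
    have hi : ∀ z : BoundedContinuousFunction ℝ E, IntervalIntegrable
        (fun s => K (max t 0) s (Real.exp (l * s) • z s)) volume 0 (max t 0) := fun z =>
      ((hG z).comp (by fun_prop : Continuous fun s : ℝ => (max t 0, s))).intervalIntegrable _ _
    have e : Φ x t - Φ y t = Real.exp (-(l * max t 0)) • ∫ s in (0 : ℝ)..(max t 0),
        K (max t 0) s (Real.exp (l * s) • (x - y) s) := by
      change Real.exp (-(l * max t 0)) • (F (max t 0) + ∫ s in (0 : ℝ)..(max t 0), _)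
        - Real.exp (-(l * max t 0)) • (F (max t 0) + ∫ s in (0 : ℝ)..(max t 0), _) = _
      rw [← smul_sub, add_sub_add_left_eq_sub, ← intervalIntegral.integral_sub (hi x) (hi y)]
      congr 1
      refine intervalIntegral.integral_congr fun s _ => ?_
      rw [← map_sub, ← smul_sub]
      rfl
    rw [dist_eq_norm, e, dist_eq_norm]
    refine (hbd (x - y) _ ht).trans (le_of_eq ?_)
    norm_num
  obtain ⟨x, hx⟩ : ∃ x, Φ x = x := ⟨_, hΦ.fixedPoint_isFixedPt⟩
  refine ⟨fun t => Real.exp (l * t) • x t, by have := x.continuous; fun_prop, fun t ht => ?_⟩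
  have h1 : x t = Real.exp (-(l * max t 0)) • (F (max t 0)
        + ∫ s in (0 : ℝ)..(max t 0), K (max t 0) s (Real.exp (l * s) • x s)) := by
    conv_lhs => rw [← hx]
    rfl
  rw [max_eq_left ht] at h1
  simp only
  conv_lhs => rw [h1]
  rw [smul_smul, ← Real.exp_add, add_neg_cancel, Real.exp_zero, one_smul]

/-! ### Multiplication operators -/

theorem exists_mul_op {α 𝕜 : Type*} [MeasurableSpace α] {m : Measure α} [RCLike 𝕜] {ρ : α → 𝕜}
    (hρ : AEStronglyMeasurable ρ m) {M : ℝ} (hM : ∀ x, ‖ρ x‖ ≤ M) :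
    ∃ A : Lp 𝕜 2 m →L[ℝ] Lp 𝕜 2 m, (∀ f, A f =ᵐ[m] fun x => ρ x * f x) ∧ ∀ f, ‖A f‖ ≤ M * ‖f‖ := by
  have hL : ∀ f : Lp 𝕜 2 m, MemLp (fun x => ρ x * f x) 2 m := fun f => by
    refine ((Lp.memLp f).norm.const_mul M).of_le (hρ.mul (Lp.aestronglyMeasurable f))
      (Eventually.of_forall fun x => ?_)
    rw [norm_mul, norm_mul, norm_norm]
    gcongr
    exact (hM x).trans (le_abs_self _)
  have hn : ∀ f : Lp 𝕜 2 m, ‖(hL f).toLp _‖ ≤ M * ‖f‖ := fun f => by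
    refine Lp.norm_le_mul_norm_of_ae_le_mul ?_
    filter_upwards [(hL f).coeFn_toLp] with x hx
    rw [hx, norm_mul]
    gcongr
    exact hM x
  refine ⟨LinearMap.mkContinuous
    { toFun := fun f => (hL f).toLp _
      map_add' := fun f g => ?_
      map_smul' := fun c f => ?_ } M hn, fun f => (hL f).coeFn_toLp, hn⟩
  · rw [← MemLp.toLp_add]
    refine MemLp.toLp_congr _ _ ?_
    filter_upwards [Lp.coeFn_add f g] with x hx
    rw [hx, Pi.add_apply, Pi.add_apply, mul_add]
  · rw [RingHom.id_apply, ← MemLp.toLp_const_smul]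
    refine MemLp.toLp_congr _ _ ?_
    filter_upwards [Lp.coeFn_smul c f] with x hx
    rw [hx, Pi.smul_apply, Pi.smul_apply, mul_smul_comm]

/-- A Fourier multiplier on `ℤ × ℝ` bounded by `1`. -/
structure IsMult (ρ : ℤ × ℝ → ℂ) : Prop where
  measurable : Measurable ρ
  le_one : ∀ z, ‖ρ z‖ ≤ 1

/-- Multiplication by `ρ` on `L²(ℤ × ℝ)`. -/
def mulOp {ρ : ℤ × ℝ → ℂ} (h : IsMult ρ) : L2hat →L[ℝ] L2hat :=
  (exists_mul_op (m := dualMeasure) h.measurable.aestronglyMeasurable h.le_one).choose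

theorem coeFn_mulOp {ρ : ℤ × ℝ → ℂ} (h : IsMult ρ) (f : L2hat) :
    mulOp h f =ᵐ[dualMeasure] fun z => ρ z * f z :=
  (exists_mul_op (m := dualMeasure) h.measurable.aestronglyMeasurable h.le_one).choose_spec.1 f

theorem norm_mulOp_le {ρ : ℤ × ℝ → ℂ} (h : IsMult ρ) (f : L2hat) : ‖mulOp h f‖ ≤ ‖f‖ := by
  have := (exists_mul_op (m := dualMeasure) h.measurable.aestronglyMeasurable
    h.le_one).choose_spec.2 f
  rwa [one_mul] at this

theorem mulOp_eq_toLp {ρ : ℤ × ℝ → ℂ} (h : IsMult ρ) (f : L2hat)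
    (hL : MemLp (fun z => ρ z * f z) 2 dualMeasure) : mulOp h f = hL.toLp _ :=
  Lp.ext ((coeFn_mulOp h f).trans hL.coeFn_toLp.symm)

theorem memLp_mul {ρ : ℤ × ℝ → ℂ} (h : IsMult ρ) (f : L2hat) :
    MemLp (fun z => ρ z * f z) 2 dualMeasure :=
  (memLp_congr_ae (coeFn_mulOp h f)).1 (Lp.memLp _)

/-- Multipliers are in general only strongly continuous in the parameter; the uniform bound by 1
upgrades this to joint continuity, which is what `exists_volterra` asks for. -/
theorem continuous_mulOp {ι : Type*} [TopologicalSpace ι] [FirstCountableTopology ι]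
    {ρ : ι → ℤ × ℝ → ℂ} (h : ∀ i, IsMult (ρ i)) (hc : ∀ z, Continuous fun i => ρ i z) :
    Continuous fun p : ι × L2hat => mulOp (h p.1) p.2 := by
  have h1 : ∀ f, Continuous fun i => mulOp (h i) f := fun f => by
    refine continuous_iff_continuousAt.2 fun i => ?_
    simp only [ContinuousAt]
    rw [mulOp_eq_toLp (h i) f (memLp_mul (h i) f)]
    refine (tendsto_toLp_of_dominated (fun i => memLp_mul (h i) f) (memLp_mul (h i) f)
      (Lp.memLp f).norm (Eventually.of_forall fun j z => ?_) fun z => ?_).congr fun j =>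
        (mulOp_eq_toLp (h j) f (memLp_mul (h j) f)).symm
    · rw [norm_mul]
      exact mul_le_of_le_one_left (norm_nonneg _) ((h j).le_one z)
    · exact ((hc z).tendsto i).mul_const _
  refine continuous_iff_continuousAt.2 fun ⟨i, f⟩ => ?_
  have h2 : Tendsto (fun p : ι × L2hat => mulOp (h p.1) (p.2 - f) + mulOp (h p.1) f) (𝓝 (i, f))
      (𝓝 (0 + mulOp (h i) f)) := by
    refine Tendsto.add ?_ (((h1 f).tendsto i).comp continuous_fst.continuousAt)
    refine squeeze_zero_norm (fun p => norm_mulOp_le _ _) ?_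
    have : Continuous fun p : ι × L2hat => ‖p.2 - f‖ := by fun_prop
    simpa using this.tendsto (i, f)
  rw [zero_add] at h2
  exact h2.congr fun p => by rw [← map_add, sub_add_cancel]

/-- The inner product of `L²(ℤ × ℝ)` seen as a real Hilbert space depends only on the pointwise
inner products. -/
theorem inner_congr {f g f' g' : L2hat}
    (h : ∀ᵐ z ∂dualMeasure, inner ℝ (f z) (g z) = inner ℝ (f' z) (g' z)) :
    inner ℝ f g = inner ℝ f' g' := by
  rw [L2.inner_def, L2.inner_def]
  exact integral_congr_ae h

/-- The adjoint of the Fourier transform. -/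
def unhat : L2hat →L[ℝ] L2 := ContinuousLinearMap.adjoint hat.toContinuousLinearMap

theorem inner_unhat (f : L2hat) (u : L2) : inner ℝ (unhat f) u = inner ℝ f (hat u) :=
  ContinuousLinearMap.adjoint_inner_left _ _ _

theorem unhat_hat (u : L2) : unhat (hat u) = u := by
  refine ext_inner_right ℝ fun v => ?_
  rw [inner_unhat]
  exact hat.inner_map_map u v

theorem integral_mul_eq_inner (u v : L2) : ∫ p, u p * v p = inner ℝ u v := by
  rw [L2.inner_def]
  refine integral_congr_ae (Eventually.of_forall fun p => ?_)
  simp [mul_comm]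

theorem integral_mul_test (u : L2) {φ : Dom → ℝ} (hφ : IsTest φ) :
    ∫ p, u p * φ p = inner ℝ u hφ.toL2 := by
  rw [← integral_mul_eq_inner]
  refine integral_congr_ae ?_
  filter_upwards [hφ.coeFn_toL2] with p hp
  rw [hp]

theorem integral_unhat_mul_test (f : L2hat) {φ : Dom → ℝ} (hφ : IsTest φ) :
    ∫ p, unhat f p * φ p = inner ℝ f (hat hφ.toL2) := by
  rw [integral_mul_test, inner_unhat]

/-! ### The multipliers of the linearized system -/

/-- `e^{-ν|∫ₛᵗ(ξ - kr)² dr|}`. -/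
def eMult (ν t s : ℝ) (z : ℤ × ℝ) : ℂ :=
  (Real.exp (-(ν * |phase z.1 z.2 t - phase z.1 z.2 s|)) : ℂ)

/-- The symbol of `∂ₓ² Δ_t⁻¹`. -/
def rMult (t : ℝ) (z : ℤ × ℝ) : ℂ := (res z.1 t z.2 : ℂ)

/-- The symbol of `∂ₓ Δ_t⁻¹`. -/
def sMult (t : ℝ) (z : ℤ × ℝ) : ℂ :=
  -Complex.I * ((z.1 : ℝ) / ((z.1 : ℝ) ^ 2 + (z.2 - z.1 * t) ^ 2) : ℝ)

theorem measurable_intCast_fst : Measurable fun z : ℤ × ℝ => (z.1 : ℝ) :=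
  (Measurable.of_discrete (f := fun k : ℤ => (k : ℝ))).comp measurable_fst

theorem isMult_eMult {ν : ℝ} (hν : 0 < ν) (t s : ℝ) : IsMult (eMult ν t s) := by
  refine ⟨?_, fun z => ?_⟩
  · have := measurable_intCast_fst
    unfold eMult phase
    fun_prop
  · rw [eMult, Complex.norm_real, Real.norm_of_nonneg (Real.exp_pos _).le, Real.exp_le_one_iff]
    exact neg_nonpos.2 (by positivity)

theorem continuous_eMult (ν : ℝ) (z : ℤ × ℝ) : Continuous fun p : ℝ × ℝ => eMult ν p.1 p.2 z := by
  unfold eMult phase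
  fun_prop

theorem isMult_rMult (t : ℝ) : IsMult (rMult t) := by
  refine ⟨?_, fun z => ?_⟩
  · have := measurable_intCast_fst
    unfold rMult res
    fun_prop
  · rw [rMult, Complex.norm_real, Real.norm_of_nonneg (res_nonneg _ _ _)]
    exact res_le_one _ _ _

theorem denom_ne_zero {k : ℤ} (hk : k ≠ 0) (x : ℝ) : (k : ℝ) ^ 2 + x ^ 2 ≠ 0 := by
  have : (k : ℝ) ≠ 0 := by exact_mod_cast hk
  positivity

theorem continuous_rMult (z : ℤ × ℝ) : Continuous fun t => rMult t z := by
  obtain ⟨k, ξ⟩ := z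
  rcases eq_or_ne k 0 with rfl | hk
  · simpa [rMult, res] using continuous_const
  · unfold rMult res
    have h := fun t : ℝ => denom_ne_zero hk (ξ - k * t)
    exact Complex.continuous_ofReal.comp (Continuous.div (by fun_prop) (by fun_prop) h)

theorem isMult_sMult (t : ℝ) : IsMult (sMult t) := by
  refine ⟨?_, fun z => ?_⟩
  · have := measurable_intCast_fst
    unfold sMult
    fun_prop
  · obtain ⟨k, ξ⟩ := z
    rw [sMult, norm_mul, norm_neg, Complex.norm_I, one_mul, Complex.norm_real, Real.norm_eq_abs,
      abs_div]
    refine div_le_one_of_le₀ ?_ (abs_nonneg _)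
    rw [abs_of_nonneg (by positivity : 0 ≤ (k : ℝ) ^ 2 + (ξ - k * t) ^ 2)]
    -- |k| ≤ k² because k is an integer; thus dividing by Δ_t after one x-derivative costs nothing.
    have h1 : |(k : ℝ)| ≤ (k : ℝ) ^ 2 := by
      rw [← sq_abs]
      rcases eq_or_ne k 0 with rfl | hk
      · simp
      · have : (1 : ℝ) ≤ |(k : ℝ)| := by exact_mod_cast Int.one_le_abs hk
        nlinarith
    nlinarith [sq_nonneg (ξ - k * t)]

theorem continuous_sMult (z : ℤ × ℝ) : Continuous fun t => sMult t z := by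
  obtain ⟨k, ξ⟩ := z
  rcases eq_or_ne k 0 with rfl | hk
  · simpa [sMult] using continuous_const
  · unfold sMult
    have h := fun t : ℝ => denom_ne_zero hk (ξ - k * t)
    exact continuous_const.mul
      (Complex.continuous_ofReal.comp (Continuous.div (by fun_prop) (by fun_prop) h))

/-! ### Mild solutions in Fourier variables -/

theorem eMult_self (ν t : ℝ) (z : ℤ × ℝ) : eMult ν t t z = 1 := by simp [eMult]

theorem eMult_mul (ν : ℝ) {r t s : ℝ} (hrt : r ≤ t) (hts : t ≤ s) (z : ℤ × ℝ) :
    eMult ν s t z * eMult ν t r z = eMult ν s r z := by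
  have h1 := phase_sub_nonneg z.1 z.2 hrt
  have h2 := phase_sub_nonneg z.1 z.2 hts
  rw [eMult, eMult, eMult, abs_of_nonneg h1, abs_of_nonneg h2, abs_of_nonneg (by linarith),
    ← Complex.ofReal_mul, ← Real.exp_add]
  congr 2
  ring

theorem mulOp_eMult_self {ν : ℝ} (hν : 0 < ν) (t : ℝ) (f : L2hat) :
    mulOp (isMult_eMult hν t t) f = f := by
  refine Lp.ext ?_
  filter_upwards [coeFn_mulOp (isMult_eMult hν t t) f] with z hz
  rw [hz, eMult_self, one_mul]

theorem mulOp_eMult_mul {ν : ℝ} (hν : 0 < ν) {r t s : ℝ} (hrt : r ≤ t) (hts : t ≤ s) (f : L2hat) :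
    mulOp (isMult_eMult hν s t) (mulOp (isMult_eMult hν t r) f) = mulOp (isMult_eMult hν s r) f := by
  refine Lp.ext ?_
  filter_upwards [coeFn_mulOp (isMult_eMult hν s t) (mulOp (isMult_eMult hν t r) f),
    coeFn_mulOp (isMult_eMult hν t r) f, coeFn_mulOp (isMult_eMult hν s r) f] with z h1 h2 h3
  rw [h1, h2, h3, ← mul_assoc, eMult_mul ν hrt hts]

theorem continuous_mulOp_eMult {ν : ℝ} (hν : 0 < ν) :
    Continuous fun p : (ℝ × ℝ) × L2hat => mulOp (isMult_eMult hν p.1.1 p.1.2) p.2 :=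
  continuous_mulOp (ι := ℝ × ℝ) (fun i => isMult_eMult hν i.1 i.2) (continuous_eMult ν)

/-- A continuous pair solves the system in mild form. -/
structure IsMild {ν : ℝ} (hν : 0 < ν) (B : L2hat →L[ℝ] L2hat) (a₀ b₀ : L2hat) (a b : ℝ → L2hat) :
    Prop where
  cont_a : Continuous a
  cont_b : Continuous b
  eq_a : ∀ t, 0 ≤ t → a t = mulOp (isMult_eMult hν t 0) a₀
    + ∫ s in (0 : ℝ)..t, mulOp (isMult_eMult hν t s) (b s)
  eq_b : ∀ t, 0 ≤ t → b t = b₀ - ∫ s in (0 : ℝ)..t, B (mulOp (isMult_rMult s) (a s))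

/-- The coupled equations for (a,b) form a single Volterra equation on H × H, with kernel (e b, -B R
a). -/
theorem exists_volterra_pair {H : Type*} [NormedAddCommGroup H] [NormedSpace ℝ H] [CompleteSpace H]
    {e : ℝ → ℝ → H →L[ℝ] H} {R : ℝ → H →L[ℝ] H} (B : H →L[ℝ] H) (a₀ b₀ : H)
    (ce : Continuous fun p : (ℝ × ℝ) × H => e p.1.1 p.1.2 p.2)
    (cr : Continuous fun p : ℝ × H => R p.1 p.2)
    (he : ∀ t s x, ‖e t s x‖ ≤ ‖x‖) (hr : ∀ s x, ‖R s x‖ ≤ ‖x‖) :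
    ∃ a b : ℝ → H, Continuous a ∧ Continuous b
      ∧ (∀ t, 0 ≤ t → a t = e t 0 a₀ + ∫ s in (0 : ℝ)..t, e t s (b s))
      ∧ ∀ t, 0 ≤ t → b t = b₀ - ∫ s in (0 : ℝ)..t, B (R s (a s)) := by
  let K : ℝ → ℝ → (H × H) →L[ℝ] (H × H) := fun t s =>
    ((e t s).comp (ContinuousLinearMap.snd ℝ H H)).prod
      (-((B.comp (R s)).comp (ContinuousLinearMap.fst ℝ H H)))
  have hK1 : ∀ t s x, (K t s x).1 = e t s x.2 := fun _ _ _ => rfl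
  have hK2 : ∀ t s x, (K t s x).2 = -B (R s x.1) := fun _ _ _ => rfl
  have hKc : Continuous fun p : (ℝ × ℝ) × (H × H) => K p.1.1 p.1.2 p.2 := by
    refine Continuous.prodMk ?_ ?_
    · exact ce.comp (by fun_prop :
        Continuous fun p : (ℝ × ℝ) × (H × H) => (p.1, p.2.2))
    · exact (B.continuous.comp (cr.comp (by fun_prop :
        Continuous fun p : (ℝ × ℝ) × (H × H) => (p.1.2, p.2.1)))).neg
  have hKb : ∀ t s x, ‖K t s x‖ ≤ (1 + ‖B‖) * ‖x‖ := by
    intro t s x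
    rw [Prod.norm_def, hK1, hK2, norm_neg]
    refine max_le ?_ ?_
    · calc _ ≤ ‖x.2‖ := he _ _ _
        _ ≤ 1 * ‖x‖ := by rw [one_mul]; exact norm_snd_le x
        _ ≤ _ := by gcongr; linarith [norm_nonneg B]
    · calc _ ≤ ‖B‖ * ‖R s x.1‖ := B.le_opNorm _
        _ ≤ ‖B‖ * ‖x‖ := by gcongr; exact (hr _ _).trans (norm_fst_le x)
        _ ≤ _ := by gcongr; linarith
  obtain ⟨y, hy, hyeq⟩ := exists_volterra (E := H × H)
    (F := fun t => (e t 0 a₀, b₀)) (C := ‖a₀‖ + ‖b₀‖)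
    (Continuous.prodMk (ce.comp (by fun_prop : Continuous fun t : ℝ => ((t, (0 : ℝ)), a₀)))
      continuous_const)
    (fun t => by
      rw [Prod.norm_def]
      exact max_le ((he _ _ _).trans (by linarith [norm_nonneg b₀]))
        (by simp))
    hKc (by positivity) hKb
  have hi : ∀ t, IntervalIntegrable (fun s => K t s (y s)) volume 0 t := fun t =>
    (hKc.comp (by fun_prop : Continuous fun s : ℝ => ((t, s), y s))).intervalIntegrable _ _
  refine ⟨fun t => (y t).1, fun t => (y t).2, by fun_prop, by fun_prop, fun t ht => ?_,
    fun t ht => ?_⟩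
  · have h1 := (ContinuousLinearMap.fst ℝ H H).intervalIntegral_comp_comm (hi t)
    have h2 := congrArg Prod.fst (hyeq t ht)
    rw [Prod.fst_add] at h2
    change (y t).1 = _
    rw [h2]
    exact congrArg _ h1.symm
  · have h1 := (ContinuousLinearMap.snd ℝ H H).intervalIntegral_comp_comm (hi t)
    have h2 := congrArg Prod.snd (hyeq t ht)
    rw [Prod.snd_add] at h2
    change (y t).2 = _
    rw [h2, sub_eq_add_neg, ← intervalIntegral.integral_neg]
    exact congrArg _ h1.symm

theorem exists_isMild {ν : ℝ} (hν : 0 < ν) (B : L2hat →L[ℝ] L2hat) (a₀ b₀ : L2hat) :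
    ∃ a b, IsMild hν B a₀ b₀ a b := by
  obtain ⟨a, b, h1, h2, h3, h4⟩ := exists_volterra_pair
    (e := fun t s => mulOp (isMult_eMult hν t s)) (R := fun t => mulOp (isMult_rMult t)) B a₀ b₀
    (continuous_mulOp_eMult hν) (continuous_mulOp (fun t => isMult_rMult t) continuous_rMult)
    (fun _ _ _ => norm_mulOp_le _ _) (fun _ _ => norm_mulOp_le _ _)
  exact ⟨a, b, h1, h2, h3, h4⟩

/-- The dependence of the integrand on s does not contribute: the interval shrinks to a point, so
only continuity of H at (t,t) is used. -/
theorem hasDerivAt_integral_diag {H : ℝ → ℝ → ℝ} (hH : Continuous (Function.uncurry H)) (t : ℝ) :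
    HasDerivAt (fun s => ∫ r in t..s, H s r) (H t t) t := by
  rw [hasDerivAt_iff_isLittleO, Asymptotics.isLittleO_iff]
  intro c hc
  have h0 : Tendsto (Function.uncurry H) (𝓝 (t, t)) (𝓝 (H t t)) := hH.tendsto (t, t)
  obtain ⟨δ, hδ, h1⟩ := Metric.tendsto_nhds_nhds.1 h0 c hc
  filter_upwards [Metric.ball_mem_nhds t hδ] with s hs
  rw [Metric.mem_ball, Real.dist_eq] at hs
  have hi : IntervalIntegrable (fun r => H s r) volume t s :=
    (hH.comp (by fun_prop : Continuous fun r : ℝ => (s, r))).intervalIntegrable _ _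
  have e : (∫ r in t..s, H s r) - (∫ r in t..t, H t r) - (s - t) • H t t
      = ∫ r in t..s, (H s r - H t t) := by
    rw [intervalIntegral.integral_sub hi intervalIntegrable_const,
      intervalIntegral.integral_same, intervalIntegral.integral_const, sub_zero]
  rw [e]
  refine (intervalIntegral.norm_integral_le_of_norm_le_const fun r hr => ?_)
  have hr2 : |r - t| ≤ |s - t| := by
    rw [mem_uIoc] at hr
    rcases hr with ⟨h2, h3⟩ | ⟨h2, h3⟩
    · rw [abs_of_pos (by linarith), abs_of_pos (by linarith)]; linarith
    · rw [abs_of_nonpos (by linarith), abs_of_nonpos (by linarith)]; linarith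
  have h2 : dist ((s, r) : ℝ × ℝ) (t, t) < δ := by
    rw [Prod.dist_eq]
    exact max_lt hs (lt_of_le_of_lt hr2 hs)
  exact (h1 h2).le

/-- Restarting the mild formula at time t, by the semigroup property of the damping factors. -/
theorem IsMild.eq_a_from {ν : ℝ} {hν : 0 < ν} {B : L2hat →L[ℝ] L2hat} {a₀ b₀ : L2hat}
    {a b : ℝ → L2hat} (h : IsMild hν B a₀ b₀ a b) {t s : ℝ} (ht : 0 ≤ t) (hts : t ≤ s) :
    a s = mulOp (isMult_eMult hν s t) (a t) + ∫ r in t..s, mulOp (isMult_eMult hν s r) (b r) := by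
  have hi : ∀ s u v, IntervalIntegrable (fun r => mulOp (isMult_eMult hν s r) (b r)) volume u v :=
    fun s u v => ((continuous_mulOp_eMult hν).comp (by have := h.cont_b; fun_prop :
      Continuous fun r : ℝ => ((s, r), b r))).intervalIntegrable _ _
  rw [h.eq_a s (ht.trans hts), h.eq_a t ht, map_add, mulOp_eMult_mul hν ht hts,
    ← ContinuousLinearMap.intervalIntegral_comp_comm _ (hi t 0 t), add_assoc,
    ← intervalIntegral.integral_add_adjacent_intervals (hi s 0 t) (hi s t s)]
  congr 2
  refine intervalIntegral.integral_congr fun r hr => ?_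
  rw [uIcc_of_le ht] at hr
  exact (mulOp_eMult_mul hν hr.2 hts (b r)).symm

/-! ### The weak form of the vorticity equation -/

theorem memLp_dissipation {ψ : L2hat}
    (hξ : MemLp (fun z : ℤ × ℝ => z.2 ^ 2 * ‖ψ z‖) 2 dualMeasure)
    (hk : MemLp (fun z : ℤ × ℝ => (z.1 : ℝ) ^ 2 * ‖ψ z‖) 2 dualMeasure) (ν t : ℝ) :
    MemLp (fun z : ℤ × ℝ => ((-(ν * (z.2 - z.1 * t) ^ 2) : ℝ) : ℂ) * ψ z) 2 dualMeasure := by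
  refine ((hξ.const_mul (|ν| * 2)).add (hk.const_mul (|ν| * (2 * t ^ 2)))).of_le ?_
    (Eventually.of_forall fun z => ?_)
  · refine AEStronglyMeasurable.mul ?_ (Lp.aestronglyMeasurable ψ)
    have := measurable_intCast_fst
    exact (by fun_prop : Measurable fun z : ℤ × ℝ =>
      ((-(ν * (z.2 - z.1 * t) ^ 2) : ℝ) : ℂ)).aestronglyMeasurable
  · rw [norm_mul, Complex.norm_real, Pi.add_apply, norm_neg, norm_mul, Real.norm_eq_abs ν,
      Real.norm_of_nonneg (sq_nonneg _), Real.norm_of_nonneg (by positivity)]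
    have h : (z.2 - z.1 * t) ^ 2 ≤ 2 * z.2 ^ 2 + 2 * t ^ 2 * (z.1 : ℝ) ^ 2 := by
      nlinarith [sq_nonneg (z.2 + z.1 * t)]
    calc |ν| * (z.2 - z.1 * t) ^ 2 * ‖ψ z‖
        ≤ |ν| * (2 * z.2 ^ 2 + 2 * t ^ 2 * (z.1 : ℝ) ^ 2) * ‖ψ z‖ := by gcongr
      _ = _ := by ring

theorem continuous_toLp_dissipation {ψ : L2hat}
    (hξ : MemLp (fun z : ℤ × ℝ => z.2 ^ 2 * ‖ψ z‖) 2 dualMeasure)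
    (hk : MemLp (fun z : ℤ × ℝ => (z.1 : ℝ) ^ 2 * ‖ψ z‖) 2 dualMeasure) (ν : ℝ) :
    Continuous fun t => (memLp_dissipation hξ hk ν t).toLp _ := by
  refine continuous_iff_continuousAt.2 fun t => ?_
  refine tendsto_toLp_of_dominated _ _
    ((hξ.const_mul (|ν| * 2)).add (hk.const_mul (|ν| * (2 * (|t| + 1) ^ 2)))) ?_ fun z => ?_
  · filter_upwards [Metric.ball_mem_nhds t one_pos] with s hs z
    rw [Metric.mem_ball, Real.dist_eq] at hs
    rw [norm_mul, Complex.norm_real, Pi.add_apply, norm_neg, norm_mul, Real.norm_eq_abs ν,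
      Real.norm_of_nonneg (sq_nonneg _)]
    have h1 : s ^ 2 ≤ (|t| + 1) ^ 2 := by
      rw [← sq_abs s]
      have := abs_sub_abs_le_abs_sub s t
      gcongr
      linarith
    have h : (z.2 - z.1 * s) ^ 2 ≤ 2 * z.2 ^ 2 + 2 * (|t| + 1) ^ 2 * (z.1 : ℝ) ^ 2 := by
      nlinarith [sq_nonneg (z.2 + z.1 * s), mul_le_mul_of_nonneg_right h1 (sq_nonneg (z.1 : ℝ))]
    calc |ν| * (z.2 - z.1 * s) ^ 2 * ‖ψ z‖
        ≤ |ν| * (2 * z.2 ^ 2 + 2 * (|t| + 1) ^ 2 * (z.1 : ℝ) ^ 2) * ‖ψ z‖ := by gcongr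
      _ = _ := by ring
  · exact (by fun_prop : Continuous fun s : ℝ =>
      ((-(ν * (z.2 - z.1 * s) ^ 2) : ℝ) : ℂ) * ψ z).tendsto t

/-- The absolute value in `eMult`, which keeps it bounded by 1 at all times, in general leaves a
kink at s = t; hence a derivative from the right. -/
theorem hasDerivWithinAt_eMult (ν t : ℝ) (z : ℤ × ℝ) :
    HasDerivWithinAt (fun s => eMult ν s t z) ((-(ν * (z.2 - z.1 * t) ^ 2) : ℝ) : ℂ) (Ici t) t := by
  have h1 : HasDerivAt (fun s => Real.exp (-(ν * (phase z.1 z.2 s - phase z.1 z.2 t))))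
      (-(ν * (z.2 - z.1 * t) ^ 2)) t := by
    have := ((((hasDerivAt_phase z.1 z.2 t).sub_const (phase z.1 z.2 t)).const_mul ν).neg).exp
    simpa using this
  refine (h1.ofReal_comp.hasDerivWithinAt (s := Ici t)).congr (fun s hs => ?_) ?_
  · rw [eMult, abs_of_nonneg (phase_sub_nonneg z.1 z.2 hs)]
  · rw [eMult, sub_self, abs_zero]

theorem norm_eMult_sub_le {ν : ℝ} (hν : 0 < ν) {t s : ℝ} (hts : t ≤ s) (hs : s ≤ t + 1)
    (z : ℤ × ℝ) : ‖eMult ν s t z - 1‖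
      ≤ |s - t| * (ν * (2 * z.2 ^ 2 + (2 * (|t| + 1) ^ 2 + 1) * (z.1 : ℝ) ^ 2)) := by
  have h0 := phase_sub_nonneg z.1 z.2 hts
  rw [eMult, abs_of_nonneg h0, ← Complex.ofReal_one, ← Complex.ofReal_sub, Complex.norm_real,
    Real.norm_eq_abs, abs_of_nonpos (by
      rw [sub_nonpos, Real.exp_le_one_iff]; nlinarith)]
  -- 1 - e^{-x} ≤ x turns the claim into a bound on the increment of the phase.
  have h1 := Real.add_one_le_exp (-(ν * (phase z.1 z.2 s - phase z.1 z.2 t)))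
  have h2 : phase z.1 z.2 s - phase z.1 z.2 t
      ≤ (s - t) * (2 * z.2 ^ 2 + (2 * (|t| + 1) ^ 2 + 1) * (z.1 : ℝ) ^ 2) := by
    rw [phase_sub]
    have h3 : ((t + s) / 2) ^ 2 ≤ (|t| + 1) ^ 2 := by
      rw [← sq_abs]
      have := neg_abs_le t
      have := le_abs_self t
      gcongr
      exact abs_le.2 ⟨by linarith, by linarith⟩
    have h4 : (s - t) ^ 2 ≤ 1 := by nlinarith
    refine mul_le_mul_of_nonneg_left ?_ (sub_nonneg.2 hts)
    nlinarith [sq_nonneg (z.2 + z.1 * ((t + s) / 2)),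
      mul_le_mul_of_nonneg_right h3 (sq_nonneg (z.1 : ℝ)),
      mul_le_mul_of_nonneg_right h4 (sq_nonneg (z.1 : ℝ))]
  rw [abs_of_nonneg (sub_nonneg.2 hts)]
  nlinarith [mul_le_mul_of_nonneg_left h2 hν.le]

/-- The multiplier is real, hence symmetric; placed on ψ, whose transform decays, it becomes
differentiable in time. -/
theorem inner_mulOp_eMult {ν : ℝ} (hν : 0 < ν) (t s : ℝ) (f ψ : L2hat) :
    inner ℝ (mulOp (isMult_eMult hν s t) f) ψ
      = inner ℝ f ((memLp_mul (isMult_eMult hν s t) ψ).toLp _) := by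
  refine inner_congr ?_
  filter_upwards [coeFn_mulOp (isMult_eMult hν s t) f,
    (memLp_mul (isMult_eMult hν s t) ψ).coeFn_toLp] with z h1 h2
  rw [h1, h2, eMult, Complex.inner, Complex.inner]
  simp only [map_mul, Complex.conj_ofReal]
  congr 1
  ring

theorem hasDerivWithinAt_toLp_eMult {ν : ℝ} (hν : 0 < ν) {ψ : L2hat}
    (hξ : MemLp (fun z : ℤ × ℝ => z.2 ^ 2 * ‖ψ z‖) 2 dualMeasure)
    (hk : MemLp (fun z : ℤ × ℝ => (z.1 : ℝ) ^ 2 * ‖ψ z‖) 2 dualMeasure) (t : ℝ) :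
    HasDerivWithinAt (fun s => (memLp_mul (isMult_eMult hν s t) ψ).toLp _)
      ((memLp_dissipation hξ hk ν t).toLp _) (Ici t) t := by
  refine hasDerivWithinAt_toLp _ _ ((hξ.const_mul (ν * 2)).add
    (hk.const_mul (ν * (2 * (|t| + 1) ^ 2 + 1)))) (fun z => ?_) ?_
  · exact (hasDerivWithinAt_eMult ν t z).mul_const (ψ z)
  · have h1 : ∀ᶠ s in 𝓝[Ici t \ {t}] t, s < t + 1 :=
      (eventually_lt_nhds (by linarith)).filter_mono nhdsWithin_le_nhds
    filter_upwards [h1, self_mem_nhdsWithin] with s hs hs2 z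
    rw [eMult_self, ← sub_mul, norm_mul]
    refine (mul_le_mul_of_nonneg_right (norm_eMult_sub_le hν hs2.1 hs.le z)
      (norm_nonneg _)).trans (le_of_eq ?_)
    rw [Pi.add_apply]
    ring

theorem IsMild.continuous_eMult {ν : ℝ} {hν : 0 < ν} {B : L2hat →L[ℝ] L2hat} {a₀ b₀ : L2hat}
    {a b : ℝ → L2hat} (h : IsMild hν B a₀ b₀ a b) :
    Continuous fun p : ℝ × ℝ => mulOp (isMult_eMult hν p.1 p.2) (b p.2) := by
  have hb : Continuous fun p : ℝ × ℝ => (p, b p.2) :=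
    continuous_id.prodMk (h.cont_b.comp continuous_snd)
  have h1 := (continuous_mulOp_eMult hν).comp hb
  exact h1

theorem IsMild.hasDerivWithinAt_inner {ν : ℝ} {hν : 0 < ν} {B : L2hat →L[ℝ] L2hat} {a₀ b₀ : L2hat}
    {a b : ℝ → L2hat} (h : IsMild hν B a₀ b₀ a b) {ψ : L2hat}
    (hξ : MemLp (fun z : ℤ × ℝ => z.2 ^ 2 * ‖ψ z‖) 2 dualMeasure)
    (hk : MemLp (fun z : ℤ × ℝ => (z.1 : ℝ) ^ 2 * ‖ψ z‖) 2 dualMeasure) {t : ℝ} (ht : 0 ≤ t) :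
    HasDerivWithinAt (fun s => inner ℝ (a s) ψ)
      (inner ℝ (a t) ((memLp_dissipation hξ hk ν t).toLp _) + inner ℝ (b t) ψ) (Ici t) t := by
  have hc : Continuous (Function.uncurry fun s r =>
      inner ℝ (mulOp (isMult_eMult hν s r) (b r)) ψ) :=
    h.continuous_eMult.inner continuous_const
  have hi : ∀ s u v, IntervalIntegrable (fun r => mulOp (isMult_eMult hν s r) (b r)) volume u v :=
    fun s u v => (h.continuous_eMult.comp (by fun_prop :
      Continuous fun r : ℝ => (s, r))).intervalIntegrable _ _
  have h1 : HasDerivWithinAt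
      (fun s => inner ℝ (a t) ((memLp_mul (isMult_eMult hν s t) ψ).toLp _))
      (inner ℝ (a t) ((memLp_dissipation hξ hk ν t).toLp _)) (Ici t) t :=
    (innerSL ℝ (a t)).hasFDerivAt.comp_hasDerivWithinAt t
      (hasDerivWithinAt_toLp_eMult hν hξ hk t)
  have h2 := (hasDerivAt_integral_diag hc t).hasDerivWithinAt (s := Ici t)
  rw [mulOp_eMult_self hν] at h2
  have e : ∀ s ∈ Ici t, inner ℝ (a s) ψ
      = inner ℝ (a t) ((memLp_mul (isMult_eMult hν s t) ψ).toLp _)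
        + ∫ r in t..s, inner ℝ (mulOp (isMult_eMult hν s r) (b r)) ψ := by
    intro s hs
    have h3 := (innerSL ℝ ψ).intervalIntegral_comp_comm (hi s t s)
    simp only [innerSL_apply_apply] at h3
    rw [h.eq_a_from ht hs, inner_add_left, inner_mulOp_eMult hν, real_inner_comm ψ, ← h3]
    congr 1
    refine intervalIntegral.integral_congr fun r _ => ?_
    exact real_inner_comm _ _
  exact (h1.add h2).congr e (e t self_mem_Ici)

/-- The right derivative is a continuous function of t, so the pairing is its primitive and is
differentiable from both sides. -/
theorem IsMild.hasDerivAt_inner {ν : ℝ} {hν : 0 < ν} {B : L2hat →L[ℝ] L2hat} {a₀ b₀ : L2hat}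
    {a b : ℝ → L2hat} (h : IsMild hν B a₀ b₀ a b) {ψ : L2hat}
    (hξ : MemLp (fun z : ℤ × ℝ => z.2 ^ 2 * ‖ψ z‖) 2 dualMeasure)
    (hk : MemLp (fun z : ℤ × ℝ => (z.1 : ℝ) ^ 2 * ‖ψ z‖) 2 dualMeasure) {t : ℝ} (ht : 0 < t) :
    HasDerivAt (fun s => inner ℝ (a s) ψ)
      (inner ℝ (a t) ((memLp_dissipation hξ hk ν t).toLp _) + inner ℝ (b t) ψ) t := by
  have ca := h.cont_a
  have cb := h.cont_b
  have cd := continuous_toLp_dissipation hξ hk ν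
  have cG : Continuous fun t => inner ℝ (a t) ((memLp_dissipation hξ hk ν t).toLp _)
      + inner ℝ (b t) ψ := (ca.inner cd).add (cb.inner continuous_const)
  have e : ∀ s, 0 ≤ s → inner ℝ (a s) ψ = inner ℝ (a 0) ψ
      + ∫ r in (0 : ℝ)..s, (inner ℝ (a r) ((memLp_dissipation hξ hk ν r).toLp _)
        + inner ℝ (b r) ψ) := by
    intro s hs
    rw [intervalIntegral.integral_eq_sub_of_hasDeriv_right
      (f := fun s => inner ℝ (a s) ψ) (ca.inner continuous_const).continuousOn ?_
      (cG.intervalIntegrable _ _)]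
    · ring
    · intro x hx
      rw [min_eq_left hs] at hx
      exact (h.hasDerivWithinAt_inner hξ hk hx.1.le).mono Ioi_subset_Ici_self
  refine ((cG.integral_hasStrictDerivAt 0 t).hasDerivAt.const_add (inner ℝ (a 0) ψ)).congr_of_eventuallyEq ?_
  filter_upwards [eventually_gt_nhds ht] with s hs
  exact e s hs.le

/-! ### Existence of solutions -/

theorem ae_of_modes {F G : ℤ → ℝ → ℂ} (h : ∀ k, F k =ᵐ[volume] G k) :
    ∀ᵐ z ∂dualMeasure, F z.1 z.2 = G z.1 z.2 := ae_dualMeasure.2 h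

theorem memLp_fourierDx {N : ℕ} {u : L2} (h : sobolevSq N (fourierDx u) < ⊤) :
    MemLp (fun z : ℤ × ℝ => fourierDx u z.1 z.2) 2 dualMeasure := by
  have hm : Measurable (fun z : ℤ × ℝ => fourierDx u z.1 z.2) :=
    measurable_from_prod_countable_right fun k =>
      (measurable_fourierTR u k).const_mul (Complex.I * k)
  refine ⟨hm.aestronglyMeasurable, ?_⟩
  have h1 : eLpNorm (fun z : ℤ × ℝ => fourierDx u z.1 z.2) 2 dualMeasure ^ 2 < ⊤ := by
    rw [eLpNorm_two_sq, lintegral_dualMeasure]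
    refine lt_of_le_of_lt (ENNReal.tsum_le_tsum fun k => lintegral_mono fun ξ => ?_) h
    refine le_mul_of_one_le_left' ?_
    rw [← ENNReal.ofReal_one]
    exact ENNReal.ofReal_le_ofReal (one_le_pow₀ (by nlinarith [sq_nonneg (k : ℝ), sq_nonneg ξ]))
  by_contra h2
  rw [not_lt, top_le_iff] at h2
  simp [h2] at h1

theorem IsTest.memLp_sq_snd {φ : Dom → ℝ} (h : IsTest φ) :
    MemLp (fun z : ℤ × ℝ => z.2 ^ 2 * ‖hat h.toL2 z‖) 2 dualMeasure := by
  refine (Lp.memLp (hat ((h.dyt 0).dyt 0).toL2)).norm.ae_eq ?_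
  filter_upwards [coeFn_hat ((h.dyt 0).dyt 0).toL2, coeFn_hat h.toL2,
    ae_of_modes (fun k => fourierTR_toL2_dyt_dyt h 0 k)] with z h1 h2 h3
  rw [h1, h2, h3, norm_mul, Complex.norm_real, norm_neg, mul_zero, sub_zero,
    Real.norm_of_nonneg (sq_nonneg _)]

theorem IsTest.memLp_sq_fst {φ : Dom → ℝ} (h : IsTest φ) :
    MemLp (fun z : ℤ × ℝ => (z.1 : ℝ) ^ 2 * ‖hat h.toL2 z‖) 2 dualMeasure := by
  refine (Lp.memLp (hat h.dx.dx.toL2)).norm.ae_eq ?_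
  filter_upwards [coeFn_hat h.dx.dx.toL2, coeFn_hat h.toL2,
    ae_of_modes (fun k => fourierTR_toL2_dx_dx h k)] with z h1 h2 h3
  rw [h1, h2, h3, norm_mul, Complex.norm_real, norm_neg, Real.norm_of_nonneg (sq_nonneg _)]

theorem IsTest.inner_dissipation {φ : Dom → ℝ} (h : IsTest φ) (ν t : ℝ) (f : L2hat) :
    inner ℝ f ((memLp_dissipation h.memLp_sq_snd h.memLp_sq_fst ν t).toLp _)
      = ν * ∫ p, unhat f p * Boussinesq.dyt t (Boussinesq.dyt t φ) p := by
  rw [integral_unhat_mul_test f ((h.dyt t).dyt t), ← inner_smul_right]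
  refine inner_congr ?_
  filter_upwards [(memLp_dissipation h.memLp_sq_snd h.memLp_sq_fst ν t).coeFn_toLp,
    Lp.coeFn_smul ν (hat ((h.dyt t).dyt t).toL2), coeFn_hat ((h.dyt t).dyt t).toL2,
    coeFn_hat h.toL2, ae_of_modes (fun k => fourierTR_toL2_dyt_dyt h t k)] with z h1 h2 h3 h4 h5
  rw [h1, h2, Pi.smul_apply, h3, h4, h5, Complex.real_smul]
  congr 1
  push_cast
  ring

/-- f need not be the transform of a real function: `unhat` is tested only against transforms of
real test functions, and the real symbol passes across the inner product. -/
theorem isDxxInvLap_unhat (t : ℝ) (f : L2hat) :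
    IsDxxInvLap t (unhat f) (unhat (mulOp (isMult_rMult t) f)) := by
  intro φ h
  rw [integral_unhat_mul_test _ (h.lap t), integral_unhat_mul_test _ h.dx.dx]
  refine inner_congr ?_
  filter_upwards [coeFn_mulOp (isMult_rMult t) f, coeFn_hat (h.lap t).toL2,
    coeFn_hat h.dx.dx.toL2,
    ae_of_modes (fun k => fourierTR_toL2_lap h t k),
    ae_of_modes (fun k => fourierTR_toL2_dx_dx h k)] with z h1 h2 h3 h4 h5
  obtain ⟨k, ξ⟩ := z
  have e : res k t ξ * -((k : ℝ) ^ 2 + (ξ - k * t) ^ 2) = -(k : ℝ) ^ 2 := by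
    rcases eq_or_ne k 0 with rfl | hk
    · simp [res]
    · have := denom_ne_zero hk (ξ - k * t)
      unfold res
      field_simp
  rw [h1, h2, h3, h4, h5, rMult, Complex.inner, Complex.inner]
  simp only [map_mul, Complex.conj_ofReal]
  rw [← e, Complex.ofReal_mul]
  congr 1
  ring

theorem inner_mul_op {ρ : ℝ → ℝ} {M : L2 →L[ℝ] L2}
    (hM : ∀ f, M f =ᵐ[volume] fun p : Dom => ρ p.2 * f p) (f g : L2) :
    inner ℝ (M f) g = inner ℝ f (M g) := by
  rw [← integral_mul_eq_inner, ← integral_mul_eq_inner]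
  refine integral_congr_ae ?_
  filter_upwards [hM f, hM g] with p h1 h2
  rw [h1, h2]
  ring

/-- Integration by parts in x: ∂ₓ commutes with multiplication by a function of y, and ∂ₓ∂ₓΔ_t⁻¹ has
symbol `rMult`. It allows θ to be built without dividing b by ik. -/
theorem inner_mul_op_sMult {ρ : ℝ → ℝ} {M : L2 →L[ℝ] L2}
    (hM : ∀ f, M f =ᵐ[volume] fun p : Dom => ρ p.2 * f p) {φ : Dom → ℝ} (h : IsTest φ) (t : ℝ)
    (f : L2hat) :
    inner ℝ (M (unhat (mulOp (isMult_sMult t) f))) h.dx.toL2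
      = -inner ℝ (M (unhat (mulOp (isMult_rMult t) f))) h.toL2 := by
  rw [inner_mul_op hM, inner_mul_op hM, inner_unhat, inner_unhat, ← inner_neg_right]
  refine inner_congr ?_
  have h0 : ∀ k, fourierTR (M h.dx.toL2) k
      =ᵐ[volume] fun ξ => Complex.I * k * fourierTR (M h.toL2) k ξ := fun k => by
    refine fourierTR_mul_dx h ρ ?_ ?_ k
    · filter_upwards [hM h.dx.toL2, h.dx.coeFn_toL2] with p h1 h2
      rw [h1, h2]
    · filter_upwards [hM h.toL2, h.coeFn_toL2] with p h1 h2
      rw [h1, h2]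
  filter_upwards [coeFn_mulOp (isMult_rMult t) f, coeFn_mulOp (isMult_sMult t) f,
    coeFn_hat (M h.dx.toL2), coeFn_hat (M h.toL2), Lp.coeFn_neg (hat (M h.toL2)),
    ae_of_modes h0] with z h1 h2 h3 h4 h5 h6
  rw [h1, h2, h3, h5, Pi.neg_apply, h4, h6, rMult, sMult, res, Complex.inner, Complex.inner]
  simp only [map_mul, map_neg, Complex.conj_ofReal, Complex.conj_I]
  congr 1
  push_cast
  linear_combination (z.1 : ℂ) ^ 2 / ((z.1 : ℂ) ^ 2 + (z.2 - z.1 * t) ^ 2)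
    * (starRingEnd ℂ) (f z) * fourierTR (M h.toL2) z.1 z.2 * Complex.I_sq

theorem inner_fourierDx {u : L2} (hu : MemLp (fun z : ℤ × ℝ => fourierDx u z.1 z.2) 2 dualMeasure)
    {φ : Dom → ℝ} (h : IsTest φ) :
    inner ℝ (hu.toLp _) (hat h.toL2) = -∫ p, u p * dx φ p := by
  rw [integral_mul_test u h.dx, ← hat.inner_map_map u, ← inner_neg_left]
  refine inner_congr ?_
  filter_upwards [hu.coeFn_toLp, coeFn_hat h.toL2, coeFn_hat h.dx.toL2, coeFn_hat u,
    Lp.coeFn_neg (hat u),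
    ae_of_modes (fun k => fourierTR_toL2_dx h k)] with z h1 h2 h3 h4 h5 h6
  rw [h1, h2, h3, h5, Pi.neg_apply, h4, h6, fourierDx, Complex.inner, Complex.inner]
  simp only [map_mul, map_neg, Complex.conj_I, map_intCast]
  congr 1
  ring

/-- The mild system is solved for a and b. Then ω = `unhat a`, and θ is obtained by integrating ∂ₜθ
= -T'∂ₓΔ_t⁻¹ω in time, which keeps θ in L² and includes its mode k = 0. -/
theorem exists_isSolution {ν : ℝ} (hν : 0 < ν) {T : ℝ → ℝ} {m : Measure ℝ} {g : ℝ → ℂ}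
    (hT : HasFourierMeasure (deriv T) m g) (ω₀ θ₀ : L2) {N : ℕ}
    (hθ : sobolevSq N (fourierDx θ₀) < ⊤) : ∃ w θ : ℝ → L2, IsSolution ν T ω₀ θ₀ w θ := by
  have hb := memLp_fourierDx hθ
  obtain ⟨M, hM, -⟩ := exists_mul_op (m := (volume : Measure Dom)) (𝕜 := ℝ)
    (ρ := fun p => deriv T p.2) (hT.continuous.comp continuous_snd).aestronglyMeasurable
    (M := ∫ ξ, ‖g ξ‖ ∂m) fun p => hT.abs_le p.2
  obtain ⟨a, b, h⟩ := exists_isMild hν ((hat.toContinuousLinearMap.comp M).comp unhat)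
    (hat ω₀) (hb.toLp _)
  have ca := h.cont_a
  have cσ : Continuous fun s => M (unhat (mulOp (isMult_sMult s) (a s))) := by
    have h1 := (continuous_mulOp (fun t => isMult_sMult t) continuous_sMult).comp
      (continuous_id.prodMk ca)
    exact (M.continuous.comp unhat.continuous).comp h1
  have cr : Continuous fun s => M (unhat (mulOp (isMult_rMult s) (a s))) := by
    have h1 := (continuous_mulOp (fun t => isMult_rMult t) continuous_rMult).comp
      (continuous_id.prodMk ca)
    exact (M.continuous.comp unhat.continuous).comp h1
  have eb : ∀ φ (hφ : IsTest φ) (t : ℝ), 0 ≤ t → inner ℝ (b t) (hat hφ.toL2)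
      = (-∫ p, θ₀ p * dx φ p)
        - ∫ s in (0 : ℝ)..t, inner ℝ (M (unhat (mulOp (isMult_rMult s) (a s)))) hφ.toL2 := by
    intro φ hφ t ht
    have h1 := (innerSL ℝ hφ.toL2).intervalIntegral_comp_comm (cr.intervalIntegrable (μ := volume) 0 t)
    have h2 := hat.toContinuousLinearMap.intervalIntegral_comp_comm (cr.intervalIntegrable (μ := volume) 0 t)
    simp only [innerSL_apply_apply] at h1
    rw [h.eq_b t ht, inner_sub_left, inner_fourierDx hb hφ]
    congr 1
    refine (congrArg (fun x => inner ℝ x (hat hφ.toL2)) h2).trans ?_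
    refine (hat.inner_map_map _ _).trans ?_
    rw [real_inner_comm, ← h1]
    exact intervalIntegral.integral_congr fun s _ => real_inner_comm _ _
  -- The θ so defined has ∂ₓθ equal to b when tested; this links the mild pair to the weak
  -- formulation.
  have eθ : ∀ φ (hφ : IsTest φ) (t : ℝ), 0 ≤ t → -∫ p, (θ₀ - ∫ s in (0 : ℝ)..t,
      M (unhat (mulOp (isMult_sMult s) (a s))) : L2) p * dx φ p = inner ℝ (b t) (hat hφ.toL2) := by
    intro φ hφ t ht
    have h1 := (innerSL ℝ hφ.dx.toL2).intervalIntegral_comp_comm (cσ.intervalIntegrable (μ := volume) 0 t)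
    simp only [innerSL_apply_apply] at h1
    rw [eb φ hφ t ht, integral_mul_test _ hφ.dx, integral_mul_test _ hφ.dx, inner_sub_left, neg_sub,
      sub_eq_neg_add, sub_eq_add_neg]
    congr 1
    rw [real_inner_comm, ← h1, ← intervalIntegral.integral_neg]
    refine intervalIntegral.integral_congr fun s _ => ?_
    exact (real_inner_comm _ _).trans (inner_mul_op_sMult hM hφ s (a s))
  refine ⟨fun t => unhat (a t), fun t => θ₀ - ∫ s in (0 : ℝ)..t,
    M (unhat (mulOp (isMult_sMult s) (a s))), ?_, ?_, ?_, ?_, ?_,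
    fun t => unhat (mulOp (isMult_rMult t) (a t)), fun t _ => isDxxInvLap_unhat t (a t), ?_⟩
  · exact (unhat.continuous.comp ca).continuousOn
  · exact (continuous_const.sub (intervalIntegral.continuous_primitive
      (fun u v => cσ.intervalIntegrable u v) 0)).continuousOn
  · have h1 := h.eq_a 0 le_rfl
    rw [intervalIntegral.integral_same, add_zero, mulOp_eMult_self hν] at h1
    simp only [h1, unhat_hat]
  · simp
  · intro φ hφ t ht
    have h1 := h.hasDerivAt_inner hφ.memLp_sq_snd hφ.memLp_sq_fst ht
    rw [hφ.inner_dissipation, ← eθ φ hφ t ht.le, ← sub_eq_add_neg] at h1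
    exact h1.congr_of_eventuallyEq (Eventually.of_forall fun s => integral_unhat_mul_test (a s) hφ)
  · intro φ hφ t ht
    have e : ∫ p, deriv T p.2 * unhat (mulOp (isMult_rMult t) (a t)) p * φ p
        = inner ℝ (M (unhat (mulOp (isMult_rMult t) (a t)))) hφ.toL2 := by
      rw [← integral_mul_test _ hφ]
      refine integral_congr_ae ?_
      filter_upwards [hM (unhat (mulOp (isMult_rMult t) (a t)))] with p h1
      rw [h1]
    rw [e]
    have ci : Continuous fun s => inner ℝ (M (unhat (mulOp (isMult_rMult s) (a s)))) hφ.toL2 :=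
      cr.inner continuous_const
    refine ((ci.integral_hasStrictDerivAt 0 t).hasDerivAt.const_sub
      (-∫ p, θ₀ p * dx φ p)).congr_of_eventuallyEq ?_
    filter_upwards [eventually_gt_nhds ht] with s hs
    rw [eθ φ hφ s hs.le, eb φ hφ s hs.le]

end Boussinesq

end

end

/-! ### Assembly of existence and bounds, with explicit constants. -/

theorem mainTheorem1 :
    (∃ C : ℝ, 0 < C ∧ ∀ (N : ℕ) (ν : ℝ), 0 < ν →
      ∀ T : ℝ → ℝ, Differentiable ℝ T →
      ∀ (m : Measure ℝ) [SigmaFinite m] (g : ℝ → ℂ),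
        HasFourierMeasure (deriv T) m g →
        weightedMass N m g ≤ ENNReal.ofReal ((4 : ℝ)⁻¹ ^ N * ν ^ (1 / 3 : ℝ)) →
      ∀ ω₀ θ₀ : L2,
        sobolevSq N (fourierTR ω₀) < ⊤ →
        sobolevSq (N + 1) (fourierTR θ₀) < ⊤ →
        (∃ ω θ : ℝ → L2, IsSolution ν T ω₀ θ₀ ω θ) ∧
        ∀ ω θ : ℝ → L2, IsSolution ν T ω₀ θ₀ ω θ → ∀ t : ℝ, 0 ≤ t →
          sobolevSq N (fourierTR (ω t))
              + sobolevSq N (fourierDx (θ t))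
            ≤ ENNReal.ofReal (C * (1 + ν ^ (-(2 / 3) : ℝ)) ^ 2)
              * (sobolevSq N (fourierTR ω₀)
                + sobolevSq (N + 1) (fourierTR θ₀))) ∧
    (∀ N : ℕ, ∃ C : ℝ, 0 < C ∧ ∀ ν : ℝ, 0 < ν →
      ∀ T : ℝ → ℝ, Differentiable ℝ T →
      ∀ (m : Measure ℝ) [SigmaFinite m] (g : ℝ → ℂ),
        HasFourierMeasure (deriv T) m g →
        commutatorMass N ν m g < ENNReal.ofReal (1 / 100 * ν ^ (1 / 3 : ℝ)) →
      ∀ ω₀ θ₀ : L2,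
        sobolevSq N (fourierTR ω₀) < ⊤ →
        sobolevSq N (fourierDx θ₀) < ⊤ →
        (∃ ω θ : ℝ → L2, IsSolution ν T ω₀ θ₀ ω θ) ∧
        ∀ ω θ : ℝ → L2, IsSolution ν T ω₀ θ₀ ω θ → ∀ t : ℝ, 0 ≤ t →
          sobolevSq N (fourierTR (ω t))
              + sobolevSq N (fourierDx (θ t))
            ≤ ENNReal.ofReal (C * (1 + ν ^ (-(2 / 3) : ℝ)) ^ 2)
              * (sobolevSq N (fourierTR ω₀)
                + sobolevSq N (fourierDx θ₀))) ∧
    (∀ (N : ℕ) (ν : ℝ), 0 < ν → ∀ α : ℝ, -(1 / 100 * ν ^ (1 / 3 : ℝ)) < α → ∃ C : ℝ, 0 < C ∧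
      ∀ ω₀ θ₀ : L2,
        sobolevSq N (fourierTR ω₀) < ⊤ →
        sobolevSq N (fourierDx θ₀) < ⊤ →
        (∃ ω θ : ℝ → L2, IsSolution ν (fun y => α * y) ω₀ θ₀ ω θ) ∧
        ∀ ω θ : ℝ → L2, IsSolution ν (fun y => α * y) ω₀ θ₀ ω θ → ∀ t : ℝ, 0 ≤ t →
          sobolevSq N (fourierTR (ω t)) + sobolevSq N (fourierDx (θ t))
            ≤ ENNReal.ofReal C * (sobolevSq N (fourierTR ω₀) + sobolevSq N (fourierDx θ₀))) := by
  refine ⟨⟨68 * (Real.exp (5 / 2 * π) * (1 / (1 - 2.29 / 2.5)) * (1 + 2.29 * 1)) ^ 2 * 1,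
    by norm_num; positivity, ?_⟩, fun N => ⟨68 * (Real.exp (1 / π * π) * (1 / (1 - 1 / 2))
      * (1 + 2.29 * (Real.exp 1 / 100))) ^ 2 * 3 ^ N, by norm_num; positivity, ?_⟩, ?_⟩
  · intro N ν hν T _ m _ g hT hm ω₀ θ₀ _ hθ
    exact ⟨exists_isSolution hν hT ω₀ θ₀ ((sobolevSq_fourierDx_le N θ₀).trans_lt hθ),
      fun ω θ h t ht => h.bound_weightedMass hν hT hm ht⟩
  · intro ν hν T _ m _ g hT hm ω₀ θ₀ _ hθ
    exact ⟨exists_isSolution hν hT ω₀ θ₀ hθ, fun ω θ h t ht => h.bound_commutatorMass hν hT hm ht⟩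
  · intro N ν hν α _
    refine ⟨68 * (Real.exp ((5 * (|α| * ν ^ (-(1 / 3) : ℝ)) + 1) * π) * (1 / (1 - 1 / 2))
      * (1 + 2.29 * (|α| * ν ^ (-(1 / 3) : ℝ)))) ^ 2 * 1 * (1 + ν ^ (-(2 / 3) : ℝ)) ^ 2,
      by norm_num; positivity, fun ω₀ θ₀ _ hθ => ?_⟩
    exact ⟨exists_isSolution hν (hasFourierMeasure_affine α) ω₀ θ₀ hθ,
      fun ω θ h t ht => h.bound_affine hν N ht⟩
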